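/- Let $k$ be a field and $n\ge 1$. Let $Q^r=\mathrm{Spec}\,k[t_0,\dots,t_r]/(\sum t_i)$ with vertex $0=(0,\dots,0)$, and $\Delta^r=\mathrm{Spec}\,k[t_0,\dots,t_r]/(\sum t_i-1)$; in both cases the faces are the subschemes cut out by the vanishing of some of the $t_i$, and $\partial_j$ denotes restriction of cycles to the face $t_j=0$ (intersection counted with multiplicities). Let $SH^p(k,r)$ be the $r$-th homology group of the complex whose term in degree $r$ is the free abelian group on the integral closed subschemes of codimension $p$ of $Q^r$ that do not contain $0$ and that meet all faces properly, with differential $\partial=\sum_j(-1)^j\partial_j$. Let $CH^p(k,r)$ be the higher Chow group, defined in the same way with $\Delta^\bullet$ in place of $Q^\bullet$. For $x\in k^\times$ let $x\star(t_0,\dots,t_r)=(t_0/x,\dots,t_r/x)$ on $Q^r$. Let $\Omega^{n-1}_k$ be the absolute Kähler differentials of $k$, $K^M_*(k)$ Milnor $K$-theory, and for $b_1,\dots,b_{n-1}\in k^\times$ put $c=-1+\sum_{i=1}^{n-1}b_i$. Then the action $\star$ of $k^\times$ on cycles induces the scalar multiplication, by the elements of $k^\times$, of a $k$-vector space structure on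 $SH^n(k,n)$ (so $0\star x=0$), and for this structure there is a $k$-linear map $$\phi:\Omega^{n-1}_k\to SH^n(k,n),\qquad a\,d\log b_1\wedge\dots\wedge d\log b_{n-1}\mapsto a\star\Big[\Big(-1,\frac{b_1}{c},\dots,\frac{b_{n-1}}{c},-\frac1c\Big)\Big]$$ for all $a\in k$, $b_i\in k^\times$, where the right side is read as $0$ if $c=0$. Moreover there is a homomorphism $T:K^M_{n-1}(k)\to CH^{n-1}(k,n-1)$ with $T\{b_1,\dots,b_{n-1}\}=\big[\big(\frac{b_1}{c},\dots,\frac{b_{n-1}}{c},-\frac1c\big)\big]$ if $c\ne0$ and $T\{b_1,\dots,b_{n-1}\}=0$ if $c=0$; the closed embedding $\Delta^{n-1}\to Q^n$, $(u_0,\dots,u_{n-1})\mapsto(-1,u_0,\dots,u_{n-1})$, induces by push-forward of cycles a homomorphism $\iota:CH^{n-1}(k,n-1)\to SH^n(k,n)$; and $$\phi\circ d\log=\iota\circ T:\ K^M_{n-1}(k)\to SH^n(k,n),$$ where $d\log:K^M_{n-1}(k)\to\Omega^{n-1}_k$ is the homomorphism $\{b_1,\dots,b_{n-1}\}\mapsto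 d\log b_1\wedge\dots\wedge d\log b_{n-1}$. -/

import Mathlib

open scoped TensorProduct

noncomputable section

namespace AdditiveChow

/-! ## The simplices `∑ tᵢ = e` and their faces -/

/-- The coordinate ring `k[t₀, …, tₙ] / (∑ tᵢ - e)`.  For `e = 0` its spectrum is the degenerate
simplex `Qⁿ`, for `e = 1` it is the usual algebraic simplex `Δⁿ`. -/
abbrev SimplexRing (k : Type*) [Field k] (e : k) (n : ℕ) : Type _ :=
  MvPolynomial (Fin (n + 1)) k ⧸
    Ideal.span {(∑ i, MvPolynomial.X i - MvPolynomial.C e : MvPolynomial (Fin (n + 1)) k)}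

section Simplex

variable {k : Type*} [Field k] (e : k)

/-- The coordinate function `tᵢ`. -/
def coord (n : ℕ) (i : Fin (n + 1)) : SimplexRing k e n :=
  Ideal.Quotient.mk _ (MvPolynomial.X i)

lemma sum_coord (n : ℕ) : ∑ i, coord e n i = algebraMap k (SimplexRing k e n) e := by
  have h : (Ideal.Quotient.mk (Ideal.span
      {(∑ i, MvPolynomial.X i - MvPolynomial.C e : MvPolynomial (Fin (n + 1)) k)}))
      (∑ i, MvPolynomial.X i - MvPolynomial.C e) = 0 :=
    Ideal.Quotient.eq_zero_iff_mem.2 (Ideal.subset_span rfl)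
  rw [map_sub, map_sum, sub_eq_zero] at h
  exact h

/-- The `k`-algebra map out of `k[t₀, …, tₙ] / (∑ tᵢ - e)` that sends `tᵢ` to `vᵢ`. -/
def simplexLift {n : ℕ} {A : Type*} [CommRing A] [Algebra k A] (v : Fin (n + 1) → A)
    (hv : ∑ i, v i = algebraMap k A e) : SimplexRing k e n →ₐ[k] A :=
  Ideal.Quotient.liftₐ _ (MvPolynomial.aeval v) (by
    intro a ha
    have h : Ideal.span
        {(∑ i, MvPolynomial.X i - MvPolynomial.C e : MvPolynomial (Fin (n + 1)) k)} ≤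
        RingHom.ker (MvPolynomial.aeval v : MvPolynomial (Fin (n + 1)) k →ₐ[k] A) := by
      rw [Ideal.span_singleton_le_iff_mem, RingHom.mem_ker]
      simp [hv]
    exact RingHom.mem_ker.1 (h ha))

@[simp] lemma simplexLift_coord {n : ℕ} {A : Type*} [CommRing A] [Algebra k A]
    (v : Fin (n + 1) → A) (hv : ∑ i, v i = algebraMap k A e) (i : Fin (n + 1)) :
    simplexLift e v hv (coord e n i) = v i :=
  MvPolynomial.aeval_X v i

/-- Pull-back of functions along the `j`-th face:
`tᵢ ↦ tᵢ` for `i < j`, `tⱼ ↦ 0`, and `tᵢ ↦ tᵢ₋₁` for `i > j`. -/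
def face (n : ℕ) (j : Fin (n + 2)) : SimplexRing k e (n + 1) →ₐ[k] SimplexRing k e n :=
  simplexLift e (j.insertNth (α := fun _ => SimplexRing k e n) 0 (coord e n)) (by
    rw [Fin.sum_univ_succAbove _ j]
    simp [sum_coord])

end Simplex

/-! ## Cycles -/

/-- The fundamental cycle of the closed subscheme `Spec (R / J)` of `Spec R`: each irreducible
component (minimal prime `q` of `J`) is counted with the length of the local ring
`R_q / J R_q`. A prime stands for the corresponding integral closed subscheme. -/
def fundamentalCycle {R : Type*} [CommRing R] [IsNoetherianRing R] (J : Ideal R) :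
    PrimeSpectrum R →₀ ℤ := by
  classical
  exact Finsupp.ofSupportFinite
    (fun q => if q.asIdeal ∈ J.minimalPrimes then
      ((Module.length (Localization.AtPrime q.asIdeal)
        (Localization.AtPrime q.asIdeal ⧸
          J.map (algebraMap R (Localization.AtPrime q.asIdeal)))).toNat : ℤ) else 0)
    (((J.finite_minimalPrimes_of_isNoetherianRing R).preimage
      (fun _ _ _ _ h => PrimeSpectrum.ext h)).subset (fun q hq => by
        by_contra h
        exact hq (if_neg h)))

/-- Free abelian group on the integral closed subschemes of the simplex `∑ tᵢ = e`. -/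
abbrev AllCycles (k : Type*) [Field k] (e : k) (n : ℕ) : Type _ :=
  PrimeSpectrum (SimplexRing k e n) →₀ ℤ

section Complex

variable {k : Type*} [Field k] (e : k)

/-- The integral closed subscheme `V = Spec (R / P)` of the `n`-dimensional affine space
`∑ tᵢ = e` has codimension `p` (that is, dimension `n - p`), does not meet the vertex
`t₀ = ⋯ = tₙ = 0` (an empty condition for `e ≠ 0`), and meets every face properly: all components
of the intersection of `V` with a face `{tᵢ = 0, i ∈ I}` (of dimension `n - #I`) have
codimension at least `p` in this face. -/
structure IsGood {n : ℕ} (p : ℕ) (P : PrimeSpectrum (SimplexRing k e n)) : Prop where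
  codim : ringKrullDim (SimplexRing k e n ⧸ P.asIdeal) + (p : WithBot ℕ∞) = (n : WithBot ℕ∞)
  vertex : ¬ ∃ q : PrimeSpectrum (SimplexRing k e n),
    P.asIdeal ≤ q.asIdeal ∧ ∀ i, coord e n i ∈ q.asIdeal
  proper : ∀ (I : Finset (Fin (n + 1))) (q : PrimeSpectrum (SimplexRing k e n)),
    P.asIdeal ≤ q.asIdeal → (∀ i ∈ I, coord e n i ∈ q.asIdeal) →
    ringKrullDim (SimplexRing k e n ⧸ q.asIdeal) + (p : WithBot ℕ∞) + (I.card : WithBot ℕ∞)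
      ≤ (n : WithBot ℕ∞)

/-- The group of codimension `p` cycles in good position on the simplex `∑ tᵢ = e`. -/
def goodCycles (p n : ℕ) : Submodule ℤ (AllCycles k e n) :=
  Submodule.span ℤ {z | ∃ P, IsGood e p P ∧ z = Finsupp.single P 1}

/-- Restriction to the `j`-th face: an integral `V` not contained in the face goes to the cycle
of the scheme-theoretic intersection of `V` with the face (which is a Cartier divisor
on `V`). -/
def faceRestriction (n : ℕ) (j : Fin (n + 2)) : AllCycles k e (n + 1) →ₗ[ℤ] AllCycles k e n :=
  Finsupp.linearCombination ℤ fun P => fundamentalCycle (P.asIdeal.map (face e n j))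

/-- `∂ = ∑ (-1)ʲ ∂ⱼ`. -/
def boundary (n : ℕ) : AllCycles k e (n + 1) →ₗ[ℤ] AllCycles k e n :=
  ∑ j : Fin (n + 2), (-1 : ℤ) ^ (j : ℕ) • faceRestriction e n j

/-- The kernel of `∂` in the group of good cycles in degree `n` (the differential leaving
degree `0` is zero). -/
def closedCycles (p : ℕ) : (n : ℕ) → Submodule ℤ (AllCycles k e n)
  | 0 => goodCycles e p 0
  | n + 1 => goodCycles e p (n + 1) ⊓ LinearMap.ker (boundary e n)

/-- The image of `∂` in degree `n`. -/
def boundaries (p n : ℕ) : Submodule ℤ (AllCycles k e n) :=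
  (goodCycles e p (n + 1)).map (boundary e n)

/-- The `n`-th homology group of the complex of good codimension `p` cycles on the simplices
`∑ tᵢ = e`. -/
def ChowHomology (p n : ℕ) : Type _ :=
  closedCycles e p n ⧸ (boundaries e p n).submoduleOf (closedCycles e p n)

instance (p n : ℕ) : AddCommGroup (ChowHomology e p n) :=
  inferInstanceAs
    (AddCommGroup (closedCycles e p n ⧸ (boundaries e p n).submoduleOf (closedCycles e p n)))

/-- The homology class of a closed cycle. -/
def chowClass {p n : ℕ} (z : AllCycles k e n) (hz : z ∈ closedCycles e p n) :
    ChowHomology e p n :=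
  Submodule.Quotient.mk (p := (boundaries e p n).submoduleOf (closedCycles e p n)) ⟨z, hz⟩

/-- The `k`-rational point with coordinates `u`. -/
def ratPoint {n : ℕ} (u : Fin (n + 1) → k) (hu : ∑ i, u i = e) :
    PrimeSpectrum (SimplexRing k e n) :=
  ⟨RingHom.ker (simplexLift e u hu), RingHom.ker_isPrime _⟩

lemma coord_mem_of_ratPoint_le {n : ℕ} {u : Fin (n + 1) → k} (hu : ∑ i, u i = e) (i : Fin (n + 1))
    (hi : u i ≠ 0) (J : Ideal (SimplexRing k e n)) (hJ : (ratPoint e u hu).asIdeal ≤ J)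
    (h : coord e n i ∈ J) : J = ⊤ := by
  have h1 : coord e n i - algebraMap k _ (u i) ∈ J := by
    apply hJ
    change _ ∈ RingHom.ker _
    rw [RingHom.mem_ker, map_sub, simplexLift_coord]
    simp
  have h2 : algebraMap k (SimplexRing k e n) (u i) ∈ J := by
    have := J.sub_mem h h1
    simpa using this
  exact J.eq_top_of_isUnit_mem h2 ((isUnit_iff_ne_zero.2 hi).map _)

instance ratPoint_isMaximal {n : ℕ} (u : Fin (n + 1) → k) (hu : ∑ i, u i = e) :
    (ratPoint e u hu).asIdeal.IsMaximal :=
  RingHom.ker_isMaximal_of_surjective (simplexLift e u hu) fun x => ⟨algebraMap k _ x, by simp⟩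

lemma isGood_ratPoint {n : ℕ} (u : Fin (n + 1) → k) (hu : ∑ i, u i = e) (h0 : ∀ i, u i ≠ 0) :
    IsGood e n (ratPoint e u hu) := by
  have hdim : ringKrullDim (SimplexRing k e n ⧸ (ratPoint e u hu).asIdeal) = 0 :=
    ringKrullDim_eq_zero_of_isField
      ((Ideal.Quotient.maximal_ideal_iff_isField_quotient _).1 inferInstance)
  refine ⟨by rw [hdim, zero_add], ?_, ?_⟩
  · rintro ⟨q, hq, hi⟩
    exact q.isPrime.ne_top (coord_mem_of_ratPoint_le e hu 0 (h0 0) _ hq (hi 0))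
  · intro I q hq hI
    rcases I.eq_empty_or_nonempty with rfl | ⟨i, hi⟩
    · have : (ratPoint e u hu) = q := PrimeSpectrum.ext
        ((ratPoint_isMaximal e u hu).eq_of_le q.isPrime.ne_top hq)
      rw [← this, hdim]
      simp
    · exact absurd (coord_mem_of_ratPoint_le e hu i (h0 i) _ hq (hI i hi)) q.isPrime.ne_top

lemma fundamentalCycle_top {R : Type*} [CommRing R] [IsNoetherianRing R] :
    fundamentalCycle (⊤ : Ideal R) = 0 := by
  ext q
  simp [fundamentalCycle, Finsupp.ofSupportFinite, Ideal.minimalPrimes_top]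

lemma single_ratPoint_mem {n : ℕ} (u : Fin (n + 1) → k) (hu : ∑ i, u i = e) (h0 : ∀ i, u i ≠ 0) :
    Finsupp.single (ratPoint e u hu) 1 ∈ closedCycles e n n := by
  have hg : Finsupp.single (ratPoint e u hu) 1 ∈ goodCycles e n n :=
    Submodule.subset_span ⟨_, isGood_ratPoint e u hu h0, rfl⟩
  cases n with
  | zero => exact hg
  | succ n =>
    refine ⟨hg, ?_⟩
    change _ ∈ LinearMap.ker _
    rw [LinearMap.mem_ker, boundary, LinearMap.sum_apply]
    refine Finset.sum_eq_zero fun j _ => ?_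
    have htop : (ratPoint e u hu).asIdeal.map (face e n j) = ⊤ := by
      have h1 : coord e (n + 1) j - algebraMap k _ (u j) ∈ (ratPoint e u hu).asIdeal := by
        change _ ∈ RingHom.ker _
        rw [RingHom.mem_ker, map_sub, simplexLift_coord]
        simp
      have h2 := Ideal.mem_map_of_mem (face e n j) h1
      have h3 : face e n j (coord e (n + 1) j - algebraMap k _ (u j))
          = - algebraMap k _ (u j) := by
        rw [map_sub, face, simplexLift_coord]
        simp
      rw [h3] at h2
      have hu' : IsUnit (algebraMap k (SimplexRing k e n) (u j)) :=
        (isUnit_iff_ne_zero.2 (h0 j)).map _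
      exact Ideal.eq_top_of_isUnit_mem _ h2 ((IsUnit.neg_iff _).2 hu')
    simp [faceRestriction, htop, fundamentalCycle_top]

/-- The class of a `k`-rational point that lies on no face. -/
def pointClass {n : ℕ} (u : Fin (n + 1) → k) (hu : ∑ i, u i = e) (h0 : ∀ i, u i ≠ 0) :
    ChowHomology e n n :=
  chowClass e (Finsupp.single (ratPoint e u hu) 1) (single_ratPoint_mem e u hu h0)

end Complex

/-- The additive Chow group `SHᵖ(k, n)`. -/
abbrev SH (k : Type*) [Field k] (p n : ℕ) : Type _ := ChowHomology (0 : k) p n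

/-- Bloch's higher Chow group `CHᵖ(k, n)`. -/
abbrev CH (k : Type*) [Field k] (p n : ℕ) : Type _ := ChowHomology (1 : k) p n

/-! ## The action of `kˣ` and the embedding `u ↦ (-1, u)` on cycles -/

section Maps

variable {k : Type*} [Field k]

/-- Pull-back of functions along `x ⋆ (t₀, …, tₙ) = (t₀ / x, …, tₙ / x)` on `Qⁿ`. -/
def starHom (n : ℕ) (x : kˣ) : SimplexRing k 0 n →ₐ[k] SimplexRing k 0 n :=
  simplexLift 0 (fun i => (x : k)⁻¹ • coord 0 n i) (by
    rw [← Finset.smul_sum, sum_coord]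
    simp)

/-- `V ↦ x ⋆ V` on cycles: the prime of the image of `V` is the preimage of the prime of `V`. -/
def starCycle {n : ℕ} (x : kˣ) : AllCycles k 0 n →ₗ[ℤ] AllCycles k 0 n :=
  Finsupp.lmapDomain ℤ ℤ (PrimeSpectrum.comap (starHom n x).toRingHom)

/-- Pull-back of functions along the closed embedding
`Δⁿ → Qⁿ⁺¹, (u₀, …, uₙ) ↦ (-1, u₀, …, uₙ)`. -/
def iotaHom (n : ℕ) : SimplexRing k 0 (n + 1) →ₐ[k] SimplexRing k 1 n :=
  simplexLift 0 (Fin.cons (α := fun _ => SimplexRing k 1 n) (-1) (coord 1 n)) (by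
    rw [Fin.sum_univ_succ]
    simp [sum_coord])

/-- Push-forward of cycles along `(u₀, …, uₙ) ↦ (-1, u₀, …, uₙ)`. -/
def iotaCycle (n : ℕ) : AllCycles k 1 n →ₗ[ℤ] AllCycles k 0 (n + 1) :=
  Finsupp.lmapDomain ℤ ℤ
    (PrimeSpectrum.comap (iotaHom (k := k) n).toRingHom)

/-! ## The points attached to a symbol -/

/-- `c = -1 + ∑ bᵢ`. -/
def symbolSum {m : ℕ} (b : Fin m → kˣ) : k := -1 + ∑ i, (b i : k)

/-- `(b₁ / c, …, b_m / c, -1 / c)`. -/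
def symbolPoint {m : ℕ} (b : Fin m → kˣ) : Fin (m + 1) → k :=
  Fin.snoc (α := fun _ => k) (fun i => (b i : k) / symbolSum b) (-1 / symbolSum b)

lemma sum_symbolPoint {m : ℕ} (b : Fin m → kˣ) (hc : symbolSum b ≠ 0) :
    ∑ i, symbolPoint b i = 1 := by
  rw [Fin.sum_univ_castSucc]
  simp only [symbolPoint, Fin.snoc_castSucc, Fin.snoc_last]
  rw [← Finset.sum_div, ← add_div, add_comm]
  exact div_self hc

lemma symbolPoint_ne_zero {m : ℕ} (b : Fin m → kˣ) (hc : symbolSum b ≠ 0) (i : Fin (m + 1)) :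
    symbolPoint b i ≠ 0 := by
  refine Fin.lastCases ?_ (fun i => ?_) i
  · simpa [symbolPoint] using hc
  · simpa [symbolPoint] using hc

/-- The class in `CHᵐ(k, m)` of the point `(b₁ / c, …, b_m / c, -1 / c)` of `Δᵐ` if `c ≠ 0`, and
`0` if `c = 0`. -/
def chowSymbol {m : ℕ} (b : Fin m → kˣ) : CH k m m := by
  classical
  exact if hc : symbolSum b ≠ 0 then
    pointClass 1 (symbolPoint b) (sum_symbolPoint b hc) (symbolPoint_ne_zero b hc) else 0

/-- The class in `SHᵐ⁺¹(k, m + 1)` of the point `(-1, b₁ / c, …, b_m / c, -1 / c)` of `Qᵐ⁺¹` if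
`c ≠ 0`, and `0` if `c = 0`. -/
def additiveSymbol {m : ℕ} (b : Fin m → kˣ) : SH k (m + 1) (m + 1) := by
  classical
  exact if hc : symbolSum b ≠ 0 then
    pointClass 0 (Fin.cons (α := fun _ => k) (-1) (symbolPoint b))
      (by simp [Fin.sum_univ_succ, sum_symbolPoint b hc])
      (fun i => Fin.cases (by simp) (fun i => by simpa using symbolPoint_ne_zero b hc i) i)
    else 0

end Maps

/-! ## Milnor K-theory and logarithmic differentials -/

section Milnor

variable (k : Type*) [Field k]

/-- The subgroup of `(kˣ)^{⊗m}` generated by the Steinberg relations. -/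
def steinbergRelations (m : ℕ) : Submodule ℤ (⨂[ℤ] _ : Fin m, Additive kˣ) :=
  Submodule.span ℤ {z | ∃ b : Fin m → kˣ,
    (∃ i j : Fin m, (i : ℕ) + 1 = j ∧ (b i : k) + (b j : k) = 1) ∧
    z = PiTensorProduct.tprod ℤ fun i => Additive.ofMul (b i)}

/-- The Milnor K-group `K^M_m(k)`. -/
abbrev MilnorK (m : ℕ) : Type _ :=
  (⨂[ℤ] _ : Fin m, Additive kˣ) ⧸ steinbergRelations k m

variable {k}

/-- The symbol `{b₁, …, b_m}`. -/
def milnorSymbol {m : ℕ} (b : Fin m → kˣ) : MilnorK k m :=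
  Submodule.Quotient.mk (PiTensorProduct.tprod ℤ fun i => Additive.ofMul (b i))

/-- `dlog b = b⁻¹ db` as a homomorphism to the absolute Kähler differentials. -/
def dlog : Additive kˣ →ₗ[ℤ] Ω[k⁄ℤ] :=
  AddMonoidHom.toIntLinearMap
    { toFun := fun b => (b.toMul : k)⁻¹ • KaehlerDifferential.D ℤ k (b.toMul : k)
      map_zero' := by simp
      map_add' := fun a b => by
        have ha : (a.toMul : k) ≠ 0 := a.toMul.ne_zero
        have hb : (b.toMul : k) ≠ 0 := b.toMul.ne_zero
        simp only [toMul_add, Units.val_mul, Derivation.leibniz, smul_add, smul_smul]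
        rw [add_comm]
        congr 2 <;> field_simp }

/-- The form `dlog b₁ ∧ ⋯ ∧ dlog b_m`. -/
def dlogForm {m : ℕ} (b : Fin m → kˣ) : ⋀[k]^m Ω[k⁄ℤ] :=
  exteriorPower.ιMulti k m fun i => dlog (Additive.ofMul (b i))

lemma dlogForm_eq_zero {m : ℕ} (b : Fin m → kˣ) (i j : Fin m) (hij : i ≠ j)
    (h : (b i : k) + (b j : k) = 1) : dlogForm b = 0 := by
  have hb : (b j : k) ≠ 0 := (b j).ne_zero
  have ha : (b i : k) ≠ 0 := (b i).ne_zero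
  have hD : KaehlerDifferential.D ℤ k (b j : k) = - KaehlerDifferential.D ℤ k (b i : k) := by
    rw [eq_neg_iff_add_eq_zero, ← map_add, add_comm, h, Derivation.map_one_eq_zero]
  have hlog : dlog (Additive.ofMul (b j)) =
      (-(b j : k)⁻¹ * (b i : k)) • dlog (Additive.ofMul (b i)) := by
    change (b j : k)⁻¹ • KaehlerDifferential.D ℤ k (b j : k) =
      (-(b j : k)⁻¹ * (b i : k)) • (b i : k)⁻¹ • KaehlerDifferential.D ℤ k (b i : k)
    rw [hD, smul_smul, smul_neg, ← neg_smul]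
    congr 1
    field_simp
  have hv : (fun l => dlog (Additive.ofMul (b l))) =
      Function.update (fun l => dlog (Additive.ofMul (b l))) j
        ((-(b j : k)⁻¹ * (b i : k)) • dlog (Additive.ofMul (b i))) := by
    rw [← hlog, Function.update_eq_self_iff.2 rfl]
  unfold dlogForm
  rw [hv, AlternatingMap.map_update_smul]
  have h0 := (exteriorPower.ιMulti k m (M := Ω[k⁄ℤ])).map_update_self
    (fun l => dlog (Additive.ofMul (b l))) hij.symm
  exact (congrArg _ h0).trans (smul_zero _)

/-- `dlog : K^M_m(k) → Ω^m_k`, `{b₁, …, b_m} ↦ dlog b₁ ∧ ⋯ ∧ dlog b_m`. -/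
def dlogMilnor (m : ℕ) : MilnorK k m →ₗ[ℤ] ⋀[k]^m Ω[k⁄ℤ] :=
  (steinbergRelations k m).liftQ
    (PiTensorProduct.lift
      (((exteriorPower.ιMulti k m (M := Ω[k⁄ℤ])).toMultilinearMap.restrictScalars
        ℤ).compLinearMap fun _ => dlog))
    (by
      rw [steinbergRelations, Submodule.span_le]
      rintro z ⟨b, ⟨i, j, hij, h⟩, rfl⟩
      change _ = _
      rw [PiTensorProduct.lift.tprod]
      exact dlogForm_eq_zero b i j (fun h => by subst h; omega) h)

lemma dlogMilnor_symbol {m : ℕ} (b : Fin m → kˣ) :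
    dlogMilnor m (milnorSymbol b) = dlogForm b := by
  change (steinbergRelations k m).liftQ _ _ (Submodule.Quotient.mk _) = _
  rw [Submodule.liftQ_apply, PiTensorProduct.lift.tprod]
  rfl

end Milnor

end AdditiveChow

end

open AdditiveChow

/-!
# Logarithmic differential forms and additive Chow groups

A zero-cycle on a simplex is shown to be a boundary by moving it along a curve.  The curves in use
are all of one kind.  Let `B` be the coordinate ring of an open subset of the affine line over a
finite extension of `k`, and let a tuple `v` of functions on it with sum `e` be given, all of which
are units except possibly `vᵢ = α + β`.  Replacing `vᵢ` by the two functions `α` and `β` gives a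
map from the curve to the simplex of one dimension more.  If it is finite and `α`, `β` have no
common zeros, then its image meets no face except the two where `α` or `β` vanishes.  The
push-forward of `div α - div β` along `v` is, up to sign, `∂` of the image taken with the degree of
the curve over it as coefficient, because `vᵢ ≡ β` modulo `α` and `vᵢ ≡ α` modulo `β`.  This is
`sub_mem_boundaries_of_split`.  Lengths on the curve are compared with lengths on its image by
`exists_mult_cut_eq`, a Herbrand quotient argument: `B` contains a free module over the coordinate
ring of the image with quotient of finite length.

Four choices of curves and of splittings give all relations:
* `starCycle_add_mem_boundaries`: the action of `kˣ` on `SHᵐ⁺¹(k, m + 1)` is additive, so that it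
  extends to a `k`-vector space structure (`additiveChowModule`);
* `pointCycle_mem_boundaries`: a rational point is a boundary if some of its coordinates add up to
  zero; this contains the Steinberg relation and the vanishing of `{…, 1, …}`;
* `homPoint_mul_mem_boundaries`: the points that define `T` are multiplicative in each `bᵢ`;
* `addPoint_add_mem_boundaries`: `b ⋆ [(-1, u(b))]` is additive in `b = bᵢ`, where `u(b)` is the
  point of the symbol.

The first three relations in the Chow group give `T`, and the push-forward along `u ↦ (-1, u)`
carries them to the additive Chow group.  There, with the fourth one, the expression
`(b₁ ⋯ b_m) ⋆ [(-1, u(b))]`, extended by zero to tuples with an entry `0`, is an absolute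
derivation in each `bᵢ`: it is additive by the fourth relation, and the Leibniz rule is the
multiplicativity of the symbol.  So it is given by a multilinear map on Kähler differentials
(`IsMultiDerivation.exists_multilinearMap`), and this is alternating by the Steinberg relation,
as the value at `(…, a, …, a, …)` is minus the value at `(…, a, …, 1 - a, …)`
(`exists_linearMap_dlogForm`).  The equality `φ ∘ dlog = ι ∘ T` holds on symbols by construction.
-/

open scoped TensorProduct

noncomputable section

namespace AdditiveChow

/-! ### Multiplicities of modules at primes -/

/-- The multiplicity of the `R`-module `M` at the prime `q`: the length of `M_q` over `R_q`. -/
def mult (R : Type*) [CommRing R] (M : Type*) [AddCommGroup M] [Module R M]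
    (q : PrimeSpectrum R) : ℕ∞ :=
  Module.length (Localization.AtPrime q.asIdeal) (LocalizedModule q.asIdeal.primeCompl M)

section Mult

variable {R : Type*} [CommRing R] {M N P : Type*} [AddCommGroup M] [Module R M]
  [AddCommGroup N] [Module R N] [AddCommGroup P] [Module R P]

lemma mult_eq_length (q : PrimeSpectrum R) (f : M →ₗ[R] N)
    [Module (Localization.AtPrime q.asIdeal) N]
    [IsScalarTower R (Localization.AtPrime q.asIdeal) N]
    [IsLocalizedModule q.asIdeal.primeCompl f] :
    mult R M q = Module.length (Localization.AtPrime q.asIdeal) N :=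
  ((IsLocalizedModule.linearEquiv q.asIdeal.primeCompl
    (LocalizedModule.mkLinearMap q.asIdeal.primeCompl M) f).extendScalarsOfIsLocalization
      q.asIdeal.primeCompl (Localization.AtPrime q.asIdeal)).length_eq

lemma mult_exact (f : M →ₗ[R] N) (g : N →ₗ[R] P) (hf : Function.Injective f)
    (hg : Function.Surjective g) (h : Function.Exact f g) (q : PrimeSpectrum R) :
    mult R N q = mult R M q + mult R P q := by
  refine Module.length_eq_add_of_exact
    (LocalizedModule.map q.asIdeal.primeCompl f) (LocalizedModule.map q.asIdeal.primeCompl g)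
    (LocalizedModule.map_injective _ f hf) (LocalizedModule.map_surjective _ g hg) ?_
  exact LocalizedModule.map_exact q.asIdeal.primeCompl f g h

lemma mult_congr (e : M ≃ₗ[R] N) (q : PrimeSpectrum R) : mult R M q = mult R N q := by
  have := mult_exact (M := PUnit) (0 : PUnit →ₗ[R] M) e.toLinearMap
    (fun _ _ _ => Subsingleton.elim _ _) e.surjective (by
      intro x
      simp [eq_comm (a := (0 : M))]) q
  rw [this]
  have h0 : mult R PUnit q = 0 := Module.length_eq_zero
  rw [h0, zero_add]

lemma mult_of_subsingleton [Subsingleton M] (q : PrimeSpectrum R) : mult R M q = 0 :=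
  Module.length_eq_zero

lemma mult_eq_zero_of_smul_eq_zero (q : PrimeSpectrum R) (a : R) (ha : a ∉ q.asIdeal)
    (h : ∀ m : M, a • m = 0) : mult R M q = 0 := by
  rw [mult, Module.length_eq_zero_iff, LocalizedModule.subsingleton_iff]
  exact fun m => ⟨a, ha, h m⟩

/-- The multiplicity of a cokernel is additive for composition with an injective map. -/
lemma mult_coker_comp (g : N →ₗ[R] P) (f : M →ₗ[R] N) (hg : Function.Injective g)
    (q : PrimeSpectrum R) :
    mult R (P ⧸ LinearMap.range (g ∘ₗ f)) q =
      mult R (N ⧸ LinearMap.range f) q + mult R (P ⧸ LinearMap.range g) q := by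
  have hle : LinearMap.range (g ∘ₗ f) ≤ LinearMap.range g := LinearMap.range_comp_le_range f g
  refine mult_exact (Submodule.mapQ _ _ g ?_) (Submodule.factor hle) ?_
    (Submodule.factor_surjective hle) ?_ q
  · rintro _ ⟨x, rfl⟩
    exact ⟨x, rfl⟩
  · rw [← LinearMap.ker_eq_bot, LinearMap.ker_eq_bot']
    intro m hm
    obtain ⟨m, rfl⟩ := Submodule.Quotient.mk_surjective _ m
    rw [Submodule.mapQ_apply, Submodule.Quotient.mk_eq_zero] at hm
    obtain ⟨x, hx⟩ := hm
    rw [Submodule.Quotient.mk_eq_zero]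
    exact ⟨x, hg hx⟩
  · intro y
    obtain ⟨y, rfl⟩ := Submodule.Quotient.mk_surjective _ y
    constructor
    · intro hy
      have hy' : y ∈ LinearMap.range g := by
        rw [← Submodule.Quotient.mk_eq_zero]
        exact hy
      obtain ⟨x, rfl⟩ := hy'
      exact ⟨Submodule.Quotient.mk x, rfl⟩
    · rintro ⟨x, hx⟩
      obtain ⟨x, rfl⟩ := Submodule.Quotient.mk_surjective _ x
      rw [← hx]
      change Submodule.Quotient.mk (g x) = 0
      rw [Submodule.Quotient.mk_eq_zero]
      exact ⟨x, rfl⟩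

/-- Multiplicities do not change under restriction of scalars along a surjection. -/
lemma mult_comap {S N : Type*} [CommRing S] [AddCommGroup N] [Module S N] (f : R →+* S)
    (hf : Function.Surjective f) (e : M ≃+ N) (he : ∀ (r : R) m, e (r • m) = f r • e m)
    (q : PrimeSpectrum S) : mult R M (PrimeSpectrum.comap f q) = mult S N q := by
  let p := PrimeSpectrum.comap f q
  have hp : p.asIdeal = q.asIdeal.comap f := rfl
  let F := Localization.localRingHom p.asIdeal q.asIdeal f hp
  let Nq := LocalizedModule q.asIdeal.primeCompl N
  let _ : Module (Localization.AtPrime p.asIdeal) Nq := Module.compHom Nq F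
  let _ : Module R Nq := Module.compHom Nq f
  let _ : Algebra (Localization.AtPrime p.asIdeal) (Localization.AtPrime q.asIdeal) := F.toAlgebra
  have hs (r : R) (x : Nq) : r • x = f r • x := rfl
  have hF (r : Localization.AtPrime p.asIdeal) (x : Nq) : r • x = F r • x := rfl
  have : IsScalarTower R (Localization.AtPrime p.asIdeal) Nq := by
    refine IsScalarTower.of_algebraMap_smul fun r x => ?_
    rw [hF, Localization.localRingHom_to_map, hs, algebraMap_smul]
  have : IsScalarTower (Localization.AtPrime p.asIdeal) (Localization.AtPrime q.asIdeal) Nq := by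
    refine IsScalarTower.of_algebraMap_smul fun r x => rfl
  let g : M →ₗ[R] Nq :=
    { toFun := fun m => LocalizedModule.mkLinearMap q.asIdeal.primeCompl N (e m)
      map_add' := fun a b => by rw [map_add, map_add]
      map_smul' := fun r m => by
        rw [he, map_smul]
        rfl }
  have hmem (s : R) : s ∈ p.asIdeal.primeCompl ↔ f s ∈ q.asIdeal.primeCompl := Iff.rfl
  have : IsLocalizedModule p.asIdeal.primeCompl g := by
    refine ⟨fun s => ?_, fun y => ?_, fun {x y} h => ?_⟩
    · have := IsLocalizedModule.map_units
        (LocalizedModule.mkLinearMap q.asIdeal.primeCompl N) ⟨f s, (hmem s).1 s.2⟩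
      rw [Module.End.isUnit_iff] at this ⊢
      exact this
    · obtain ⟨⟨n, s⟩, h⟩ := IsLocalizedModule.surj q.asIdeal.primeCompl
        (LocalizedModule.mkLinearMap q.asIdeal.primeCompl N) y
      obtain ⟨t, ht⟩ := hf s
      refine ⟨⟨e.symm n, ⟨t, (hmem t).2 (ht ▸ s.2)⟩⟩, ?_⟩
      change f t • y = LocalizedModule.mkLinearMap q.asIdeal.primeCompl N (e (e.symm n))
      rw [e.apply_symm_apply, ht]
      exact h
    · obtain ⟨s, h⟩ := IsLocalizedModule.exists_of_eq (S := q.asIdeal.primeCompl)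
        (f := LocalizedModule.mkLinearMap q.asIdeal.primeCompl N) h
      obtain ⟨t, ht⟩ := hf s
      refine ⟨⟨t, (hmem t).2 (ht ▸ s.2)⟩, e.injective ?_⟩
      change e (t • x) = e (t • y)
      rw [he, he, ht]
      exact h
  rw [show mult R M (PrimeSpectrum.comap f q) = _ from mult_eq_length p g]
  refine Module.length_eq_of_surjective (S := Localization.AtPrime p.asIdeal)
    (R := Localization.AtPrime q.asIdeal) (M := Nq) ?_
  intro x
  obtain ⟨a, s, rfl⟩ := IsLocalization.exists_mk'_eq q.asIdeal.primeCompl x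
  obtain ⟨b, rfl⟩ := hf a
  obtain ⟨t, ht⟩ := hf s
  refine ⟨IsLocalization.mk' _ b ⟨t, (hmem t).2 (ht ▸ s.2)⟩, ?_⟩
  change F _ = _
  rw [Localization.localRingHom_mk']
  congr 1
  exact Subtype.ext ht

lemma mult_pi (d : ℕ) (q : PrimeSpectrum R) : mult R (Fin d → M) q = d * mult R M q := by
  induction d with
  | zero => simpa using mult_of_subsingleton q
  | succ d ih =>
    rw [mult_exact (LinearMap.single R (fun _ : Fin (d + 1) => M) 0)
      (LinearMap.funLeft R M (Fin.succ (n := d))) (fun a b h => by simpa using congrFun h 0) (fun y => ⟨Fin.cons 0 y, by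
        ext i
        simp [LinearMap.funLeft]⟩) ?_ q, ih]
    · push_cast
      ring
    · intro y
      constructor
      · intro h
        refine ⟨y 0, ?_⟩
        ext i
        refine Fin.cases ?_ (fun i => ?_) i
        · simp
        · have := congrFun h i
          simpa [LinearMap.funLeft, eq_comm] using this
      · rintro ⟨x, rfl⟩
        ext i
        simp [LinearMap.funLeft]

/-- At a minimal prime `q` of `J`, the multiplicity of `R / J` is the coefficient of `q` in the
fundamental cycle of `J`. -/
lemma mult_quotient (J : Ideal R) (q : PrimeSpectrum R) :
    mult R (R ⧸ J) q = Module.length (Localization.AtPrime q.asIdeal)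
        (Localization.AtPrime q.asIdeal ⧸
          J.map (algebraMap R (Localization.AtPrime q.asIdeal))) := by
  have h := mult_eq_length q (Submodule.toLocalizedQuotient' (Localization.AtPrime q.asIdeal)
    q.asIdeal.primeCompl (Algebra.linearMap R (Localization.AtPrime q.asIdeal)) J)
  rw [Ideal.localized'_eq_map] at h
  exact h

lemma mult_quotient_of_not_le (J : Ideal R) (q : PrimeSpectrum R) (h : ¬ J ≤ q.asIdeal) :
    mult R (R ⧸ J) q = 0 := by
  obtain ⟨a, ha, hap⟩ := Set.not_subset.1 h
  refine mult_eq_zero_of_smul_eq_zero q a hap fun m => ?_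
  obtain ⟨m, rfl⟩ := Ideal.Quotient.mk_surjective m
  rw [Algebra.smul_def, Ideal.Quotient.algebraMap_eq, Ideal.Quotient.eq_zero_iff_mem.2 ha, zero_mul]

lemma mult_quotient_of_isMaximal (q : PrimeSpectrum R) (hq : q.asIdeal.IsMaximal)
    (p : PrimeSpectrum R) :
    mult R (R ⧸ q.asIdeal) p = ((Finsupp.single q 1 : PrimeSpectrum R →₀ ℕ) p : ℕ) := by
  classical
  rw [Finsupp.single_apply]
  split_ifs with h
  · subst h
    rw [mult_quotient, Localization.AtPrime.map_eq_maximalIdeal, Nat.cast_one,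
      Module.length_eq_one_iff, isSimpleModule_iff_isCoatom]
    exact (IsLocalRing.maximalIdeal.isMaximal _).out
  · by_cases hle : q.asIdeal ≤ p.asIdeal
    · exact absurd (PrimeSpectrum.ext (hq.eq_of_le p.isPrime.ne_top hle)) h
    · exact mult_quotient_of_not_le _ p hle

lemma mult_ne_top_of_isFiniteLength (h : IsFiniteLength R M) (q : PrimeSpectrum R) :
    mult R M q ≠ ⊤ := by
  induction h with
  | of_subsingleton => simp [mult_of_subsingleton]
  | @of_simple_quotient M _ _ N hN _ ih =>
    rw [mult_exact N.subtype N.mkQ N.injective_subtype N.mkQ_surjective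
      (LinearMap.exact_subtype_mkQ N) q]
    obtain ⟨m, hm, ⟨e⟩⟩ := isSimpleModule_iff_quot_maximal.1 hN
    rw [mult_congr e q, mult_quotient_of_isMaximal ⟨m, hm.isPrime⟩ hm q]
    exact WithTop.add_ne_top.2 ⟨ih, ENat.natCast_ne_top _⟩

end Mult

/-! ### Fundamental cycles and finite extensions of one-dimensional domains -/

section FundamentalCycle

variable {R S : Type*} [CommRing R] [CommRing S] [IsNoetherianRing R] [IsNoetherianRing S]

open scoped Classical in
lemma fundamentalCycle_apply (J : Ideal R) (q : PrimeSpectrum R) :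
    fundamentalCycle J q =
      if q.asIdeal ∈ J.minimalPrimes then ((mult R (R ⧸ J) q).toNat : ℤ) else 0 := by
  rw [mult_quotient]
  rfl

lemma mult_quotient_comap {R S : Type*} [CommRing R] [CommRing S] (f : R →+* S)
    (hf : Function.Surjective f) (J : Ideal S) (q : PrimeSpectrum S) :
    mult R (R ⧸ J.comap f) (PrimeSpectrum.comap f q) = mult S (S ⧸ J) q := by
  refine mult_comap f hf (RingEquiv.ofBijective (Ideal.quotientMap J f le_rfl)
      ⟨Ideal.quotientMap_injective, Ideal.quotientMap_surjective hf⟩).toAddEquiv ?_ q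
  intro r m
  obtain ⟨m, rfl⟩ := Ideal.Quotient.mk_surjective m
  change Ideal.quotientMap J f le_rfl (Ideal.Quotient.mk _ (r * m)) =
    Ideal.Quotient.mk _ (f r) * Ideal.quotientMap J f le_rfl (Ideal.Quotient.mk _ m)
  simp

/-- Fundamental cycles are compatible with push-forward along closed embeddings. -/
lemma fundamentalCycle_comap (f : R →+* S) (hf : Function.Surjective f) (J : Ideal S) :
    fundamentalCycle (J.comap f) =
      (fundamentalCycle J).mapDomain (PrimeSpectrum.comap f) := by
  ext p
  by_cases hp : p ∈ Set.range (PrimeSpectrum.comap f)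
  · obtain ⟨q, rfl⟩ := hp
    rw [Finsupp.mapDomain_apply (PrimeSpectrum.comap_injective_of_surjective f hf),
      fundamentalCycle_apply, fundamentalCycle_apply]
    have hmem : (PrimeSpectrum.comap f q).asIdeal ∈ (J.comap f).minimalPrimes ↔
        q.asIdeal ∈ J.minimalPrimes := by
      rw [Ideal.comap_minimalPrimes_eq_of_surjective hf]
      exact (Ideal.comap_injective_of_surjective f hf).mem_set_image
    rw [mult_quotient_comap f hf]
    by_cases h : q.asIdeal ∈ J.minimalPrimes
    · exact (if_pos (hmem.2 h)).trans (if_pos h).symm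
    · exact (if_neg (mt hmem.1 h)).trans (if_neg h).symm
  · rw [Finsupp.mapDomain_of_notMem_range _ _ hp, fundamentalCycle_apply, if_neg]
    rw [Ideal.comap_minimalPrimes_eq_of_surjective hf]
    rintro ⟨q, hq, hqp⟩
    exact hp ⟨⟨q, hq.1.1⟩, PrimeSpectrum.ext hqp⟩

end FundamentalCycle

/-- The `R`-module `B / b B`. -/
abbrev Cut (R : Type*) {B : Type*} [CommRing R] [CommRing B] [Algebra R B] (b : B) : Type _ :=
  B ⧸ LinearMap.range (LinearMap.mulLeft R b)

section Cut

variable {R B : Type*} [CommRing R] [CommRing B] [Algebra R B]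

lemma mult_cut_mul [IsDomain B] (a b : B) (ha : a ≠ 0) (q : PrimeSpectrum R) :
    mult R (Cut R (a * b)) q = mult R (Cut R b) q + mult R (Cut R a) q := by
  have h := mult_coker_comp (LinearMap.mulLeft R a) (LinearMap.mulLeft R b)
    (fun x y h => mul_left_cancel₀ ha h) q
  rwa [← LinearMap.mulLeft_mul] at h

lemma mult_cut_of_isUnit {a : B} (ha : IsUnit a) (q : PrimeSpectrum R) :
    mult R (Cut R a) q = 0 := by
  have : Subsingleton (Cut R a) := by
    rw [Submodule.Quotient.subsingleton_iff, LinearMap.range_eq_top]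
    intro y
    obtain ⟨u, rfl⟩ := ha
    exact ⟨↑u⁻¹ * y, by simp⟩
  exact mult_of_subsingleton q

/-- A finitely generated torsion-free module over a one-dimensional Noetherian domain contains a
free module with a quotient of finite length. -/
lemma exists_injective_pi (A M : Type*) [CommRing A] [IsDomain A] [IsNoetherianRing A]
    [Ring.DimensionLEOne A] [AddCommGroup M] [Module A M] [Module.Finite A M]
    [Module.IsTorsionFree A M] [Nontrivial M] :
    ∃ d : ℕ, 0 < d ∧ ∃ F : (Fin d → A) →ₗ[A] M, Function.Injective F ∧
      IsFiniteLength A (M ⧸ LinearMap.range F) := by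
  obtain ⟨v, hv⟩ := exists_linearIndependent_of_le_finrank (R := A) (M := M) le_rfl
  refine ⟨Module.finrank A M, Module.finrank_pos, Fintype.linearCombination A v,
    hv.fintypeLinearCombination_injective, ?_⟩
  set F := Fintype.linearCombination A v
  -- by maximality of `v`, the quotient by the span of `v` is torsion
  have htors : ∀ x : M, ∃ a : A, a ≠ 0 ∧ a • x ∈ LinearMap.range F := by
    intro x
    by_contra! hx
    have hli : LinearIndependent A (Fin.cons x v : Fin (Module.finrank A M + 1) → M) := by
      rw [Fintype.linearIndependent_iff]
      intro g hg
      rw [Fin.sum_univ_succ] at hg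
      simp only [Fin.cons_zero, Fin.cons_succ] at hg
      have h0 : g 0 = 0 := by
        by_contra h0
        refine hx _ h0 ⟨fun i => - g i.succ, ?_⟩
        rw [Fintype.linearCombination_apply, eq_comm, ← sub_eq_zero, ← hg, sub_eq_add_neg,
          ← Finset.sum_neg_distrib]
        simp
      rw [h0, zero_smul, zero_add] at hg
      have := Fintype.linearIndependent_iff.1 hv _ hg
      exact fun i => Fin.cases h0 this i
    have := hli.fintype_card_le_finrank
    simp at this
  obtain ⟨s, hs⟩ := Module.Finite.fg_top (R := A) (M := M)
  choose a ha0 ha using htors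
  have hz0 : ∏ x ∈ s, a x ≠ 0 := Finset.prod_ne_zero_iff.2 fun x _ => ha0 x
  set z := ∏ x ∈ s, a x
  have hz : ∀ x : M, z • x ∈ LinearMap.range F := by
    intro x
    have hx : x ∈ Submodule.span A (s : Set M) := hs ▸ Submodule.mem_top
    induction hx using Submodule.span_induction with
    | mem x hx =>
      obtain ⟨y, hy⟩ := Finset.dvd_prod_of_mem a (Finset.mem_coe.1 hx)
      change z = a x * y at hy
      rw [hy, mul_comm, mul_smul]
      exact Submodule.smul_mem _ _ (ha x)
    | zero => simp
    | add x y _ _ hx hy => rw [smul_add]; exact add_mem hx hy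
    | smul c x _ hx => rw [smul_comm]; exact Submodule.smul_mem _ _ hx
  -- the quotient is a finite module over `A / z A`, which is an Artinian ring
  have htor : Module.IsTorsionBySet A (M ⧸ LinearMap.range F) (Ideal.span {z} : Ideal A) := by
    refine (Module.isTorsionBySet_span_singleton_iff z).2 fun x => ?_
    obtain ⟨x, rfl⟩ := Submodule.Quotient.mk_surjective _ x
    rw [← Submodule.Quotient.mk_smul, Submodule.Quotient.mk_eq_zero]
    exact hz x
  let _ := htor.module
  have : IsScalarTower A (A ⧸ (Ideal.span {z} : Ideal A)) (M ⧸ LinearMap.range F) :=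
    htor.isScalarTower
  have : Module.Finite (A ⧸ (Ideal.span {z} : Ideal A)) (M ⧸ LinearMap.range F) :=
    Module.Finite.of_restrictScalars_finite A _ _
  have : Ring.KrullDimLE 0 (A ⧸ (Ideal.span {z} : Ideal A)) := by
    rw [Ring.krullDimLE_zero_iff]
    intro I hI
    have h1 : (I.comap (Ideal.Quotient.mk (Ideal.span {z}))).IsMaximal := by
      refine Ideal.IsPrime.isMaximal inferInstance fun h => hz0 ?_
      have : z ∈ I.comap (Ideal.Quotient.mk (Ideal.span {z})) := by
        rw [Ideal.mem_comap, Ideal.Quotient.eq_zero_iff_mem.2 (Ideal.mem_span_singleton_self z)]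
        exact I.zero_mem
      rw [h] at this
      exact this
    have h2 := Ideal.map_comap_of_surjective _
      (Ideal.Quotient.mk_surjective (I := Ideal.span {z})) I
    rw [← h2]
    exact (Ideal.map_eq_top_or_isMaximal_of_surjective _ Ideal.Quotient.mk_surjective
      h1).resolve_left (by rw [h2]; exact hI.ne_top)
  have : IsArtinianRing (A ⧸ (Ideal.span {z} : Ideal A)) :=
    IsNoetherianRing.isArtinianRing_of_krullDimLE_zero
  rw [isFiniteLength_iff_isNoetherian_isArtinian]
  refine ⟨inferInstance, ?_⟩
  exact isArtinian_of_surjective_algebraMap (R := A ⧸ (Ideal.span {z} : Ideal A))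
    Ideal.Quotient.mk_surjective

lemma isFiniteLength_restrictScalars (R : Type*) {A M : Type*} [CommRing R] [CommRing A]
    [AddCommGroup M] [Module A M] [Algebra R A] [Module R M] [IsScalarTower R A M]
    (h : Function.Surjective (algebraMap R A)) (hM : IsFiniteLength A M) : IsFiniteLength R M := by
  rw [← Module.length_ne_top_iff] at hM ⊢
  rwa [Module.length_eq_of_surjective h]

/-- For a finite extension `B` of a one-dimensional domain `A = R / 𝔭`, of degree `d`, the cycle of
`B / f B` is `d` times the cycle of `A / f A`, for every `f ≠ 0` in `A`. -/
lemma exists_mult_cut_eq [IsNoetherianRing R] [IsDomain B] [Module.Finite R B]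
    (p : Ideal R) [p.IsPrime] (hp : RingHom.ker (algebraMap R B) = p)
    [Ring.DimensionLEOne (R ⧸ p)] :
    ∃ d : ℕ, 0 < d ∧ ∀ f : R, f ∉ p → ∀ q : PrimeSpectrum R,
      mult R (Cut R (algebraMap R B f)) q = d * mult R (Cut R (algebraMap R (R ⧸ p) f)) q := by
  let g : (R ⧸ p) →+* B := Ideal.Quotient.lift p (algebraMap R B) fun a ha => by
    rwa [← RingHom.mem_ker, hp]
  have hg : Function.Injective g := RingHom.lift_injective_of_ker_le_ideal _ _ hp.le
  let _ : Algebra (R ⧸ p) B := g.toAlgebra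
  have : IsScalarTower R (R ⧸ p) B := IsScalarTower.of_algebraMap_eq' rfl
  have : Module.Finite (R ⧸ p) B := Module.Finite.of_restrictScalars_finite R _ _
  have : FaithfulSMul (R ⧸ p) B := (faithfulSMul_iff_algebraMap_injective _ _).2 hg
  have : Module.IsTorsionFree (R ⧸ p) B := inferInstance
  obtain ⟨d, hd, F, hF, hfin⟩ := exists_injective_pi (R ⧸ p) B
  refine ⟨d, hd, fun f hf q => ?_⟩
  have hf0 : algebraMap R B f ≠ 0 := fun h => hf (by rwa [← RingHom.mem_ker, hp] at h)
  let F' : (Fin d → R ⧸ p) →ₗ[R] B := F.restrictScalars R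
  let a : R ⧸ p := algebraMap R (R ⧸ p) f
  let mA : (Fin d → R ⧸ p) →ₗ[R] (Fin d → R ⧸ p) := (LinearMap.mulLeft R a).compLeft (Fin d)
  have hcomm : LinearMap.mulLeft R (algebraMap R B f) ∘ₗ F' = F' ∘ₗ mA := by
    refine LinearMap.ext fun x => ?_
    change algebraMap R B f * F x = F (fun i => a * x i)
    rw [show (fun i => a * x i) = a • x from rfl, map_smul, Algebra.smul_def]
    rfl
  -- the cokernel of `f ∘ F = F ∘ f` is computed in two ways; that of `F` has finite length
  have h1 := mult_coker_comp (LinearMap.mulLeft R (algebraMap R B f)) F'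
    (fun x y h => mul_left_cancel₀ hf0 h) q
  have h2 := mult_coker_comp F' mA hF q
  rw [hcomm, h2, add_comm] at h1
  have hne : mult R (B ⧸ LinearMap.range F') q ≠ ⊤ :=
    mult_ne_top_of_isFiniteLength
      (isFiniteLength_restrictScalars R (A := R ⧸ p) Ideal.Quotient.mk_surjective hfin) q
  have h3 := WithTop.add_left_cancel hne h1
  rw [← h3, ← mult_pi]
  let mk : (Fin d → R ⧸ p) →ₗ[R] (Fin d → Cut R a) :=
    (LinearMap.range (LinearMap.mulLeft R a)).mkQ.compLeft (Fin d)
  have hmk : Function.Surjective mk := fun y => by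
    choose x hx using fun i => Submodule.mkQ_surjective (LinearMap.range (LinearMap.mulLeft R a)) (y i)
    exact ⟨x, funext hx⟩
  have hker : LinearMap.range mA = LinearMap.ker mk := by
    ext x
    constructor
    · rintro ⟨y, rfl⟩
      rw [LinearMap.mem_ker]
      funext i
      change Submodule.Quotient.mk (a * y i) = 0
      rw [Submodule.Quotient.mk_eq_zero]
      exact ⟨y i, rfl⟩
    · intro hx
      rw [LinearMap.mem_ker] at hx
      have hx' : ∀ i, ∃ y, a * y = x i := fun i => by
        have : (Submodule.Quotient.mk (x i) : Cut R a) = 0 := congrFun hx i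
        rw [Submodule.Quotient.mk_eq_zero] at this
        exact this
      choose y hy using hx'
      exact ⟨y, funext hy⟩
  exact mult_congr ((Submodule.quotEquivOfEq _ _ hker).trans
    (mk.quotKerEquivOfSurjective hmk)) q

end Cut

/-! ### Cycles cut out by functions on a parametrized curve -/

section CutMult

variable {R S B : Type*} [CommRing R] [CommRing S] [CommRing B]

/-- The multiplicity at `q` of `B / b B` regarded as an `R`-module through `ψ : R → B`. -/
def cutMult (ψ : R →+* B) (b : B) (q : PrimeSpectrum R) : ℕ∞ :=
  letI := ψ.toAlgebra
  mult R (Cut R b) q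

/-- The cycle `z` on `Spec R` is the push-forward along `Spec B → Spec R` of the divisor of `b`. It
is the cycle of `B / b B` as an `R`-module; all its multiplicities are required to be finite. -/
def HasCycle (ψ : R →+* B) (b : B) (z : PrimeSpectrum R →₀ ℤ) : Prop :=
  ∀ q, ∃ m : ℕ, cutMult ψ b q = m ∧ z q = m

lemma HasCycle.mul [IsDomain B] {ψ : R →+* B} {a b : B} {y z : PrimeSpectrum R →₀ ℤ} (ha : a ≠ 0)
    (hy : HasCycle ψ a y) (hz : HasCycle ψ b z) : HasCycle ψ (a * b) (y + z) := by
  intro q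
  obtain ⟨m, hm, hm'⟩ := hy q
  obtain ⟨n, hn, hn'⟩ := hz q
  refine ⟨m + n, ?_, by simp [hm', hn']⟩
  let _ := ψ.toAlgebra
  rw [cutMult, mult_cut_mul a b ha q, Nat.cast_add, ← hm, ← hn, add_comm]
  rfl

lemma HasCycle.of_isUnit (ψ : R →+* B) {b : B} (hb : IsUnit b) : HasCycle ψ b 0 :=
  let _ := ψ.toAlgebra
  fun q => ⟨0, mult_cut_of_isUnit hb q, rfl⟩

lemma HasCycle.unit_mul [IsDomain B] {ψ : R →+* B} {u b : B} {z : PrimeSpectrum R →₀ ℤ}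
    (hu : IsUnit u) (hz : HasCycle ψ b z) : HasCycle ψ (u * b) z := by
  simpa using HasCycle.mul hu.ne_zero (HasCycle.of_isUnit ψ hu) hz

/-- If `b` generates the kernel of a map `ev` from `B` to a field, it cuts out the point at which
`ev` evaluates. -/
lemma HasCycle.of_ker {L : Type*} [Field L] (ψ : R →+* B) {b : B} (ev : B →+* L)
    (hker : RingHom.ker ev = Ideal.span {b}) (hev : Function.Surjective (ev.comp ψ)) :
    HasCycle ψ b (Finsupp.single ⟨RingHom.ker (ev.comp ψ), RingHom.ker_isPrime _⟩ 1) := by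
  intro q
  refine ⟨(Finsupp.single ⟨RingHom.ker (ev.comp ψ), RingHom.ker_isPrime _⟩ 1 :
    PrimeSpectrum R →₀ ℕ) q, ?_, ?_⟩
  rotate_left
  · rw [← Finsupp.mapRange_apply (hf := Nat.cast_zero), Finsupp.mapRange_single, Nat.cast_one]
  let _ := ψ.toAlgebra
  rw [← mult_quotient_of_isMaximal _ (RingHom.ker_isMaximal_of_surjective _ hev) q]
  let mk : R →ₗ[R] Cut R b := (LinearMap.range (LinearMap.mulLeft R b)).mkQ ∘ₗ Algebra.linearMap R B
  have hrange : ∀ x : B, x ∈ LinearMap.range (LinearMap.mulLeft R b) ↔ ev x = 0 := by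
    intro x
    rw [← RingHom.mem_ker, hker, Ideal.mem_span_singleton']
    simp only [LinearMap.mem_range, LinearMap.mulLeft_apply, mul_comm]
  have hmk : Function.Surjective mk := by
    intro y
    obtain ⟨y, rfl⟩ := Submodule.Quotient.mk_surjective _ y
    obtain ⟨r, hr⟩ := hev (ev y)
    refine ⟨r, ?_⟩
    change Submodule.Quotient.mk (ψ r) = _
    rw [Submodule.Quotient.eq, hrange, map_sub, sub_eq_zero]
    exact hr
  have hk : LinearMap.ker mk = RingHom.ker (ev.comp ψ) := by
    ext r
    rw [LinearMap.mem_ker]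
    change Submodule.Quotient.mk (ψ r) = _ ↔ _
    rw [Submodule.Quotient.mk_eq_zero, hrange]
    rfl
  exact (mult_congr ((Submodule.quotEquivOfEq _ _ hk.symm).trans
    (mk.quotKerEquivOfSurjective hmk)) q).symm

/-- The cycle cut out by `b` depends on the structure map only modulo `b`. -/
lemma cutMult_comap (f : R →+* S) (hf : Function.Surjective f) (φ : R →+* B) (ψ : S →+* B) (b : B)
    (h : ∀ r, b ∣ ψ (f r) - φ r) (q : PrimeSpectrum S) :
    cutMult φ b (PrimeSpectrum.comap f q) = cutMult ψ b q := by
  let _ := φ.toAlgebra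
  let _ := ψ.toAlgebra
  let e : Cut R b ≃+ Cut S b := QuotientAddGroup.quotientAddEquivOfEq
    (M := (LinearMap.range (LinearMap.mulLeft R b)).toAddSubgroup)
    (N := (LinearMap.range (LinearMap.mulLeft S b)).toAddSubgroup) rfl
  refine mult_comap f hf e ?_ q
  intro r x
  obtain ⟨x, rfl⟩ := Submodule.Quotient.mk_surjective _ x
  change (Submodule.Quotient.mk (φ r * x) : Cut S b) = Submodule.Quotient.mk (ψ (f r) * x)
  rw [Submodule.Quotient.eq]
  obtain ⟨c, hc⟩ := h r
  refine ⟨- (c * x), ?_⟩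
  rw [LinearMap.mulLeft_apply]
  linear_combination x * hc

/-- The scheme-theoretic intersection of an integral subscheme with a principal divisor. -/
lemma mult_quotient_map (f : R →+* S) (hf : Function.Surjective f) (t : R)
    (hker : RingHom.ker f = Ideal.span {t}) (P : Ideal R) (q : PrimeSpectrum S) :
    mult S (S ⧸ P.map f) q =
      mult R (Cut R (algebraMap R (R ⧸ P) t)) (PrimeSpectrum.comap f q) := by
  rw [← mult_quotient_comap f hf, Ideal.comap_map_of_surjective f hf]
  have hker' : Ideal.comap f ⊥ = Ideal.span {t} := hker
  rw [hker']
  let mk : R →ₗ[R] Cut R (algebraMap R (R ⧸ P) t) :=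
    (LinearMap.range (LinearMap.mulLeft R (algebraMap R (R ⧸ P) t))).mkQ ∘ₗ
      Algebra.linearMap R (R ⧸ P)
  have hmk : Function.Surjective mk :=
    (Submodule.mkQ_surjective _).comp Ideal.Quotient.mk_surjective
  have hk : LinearMap.ker mk = P ⊔ Ideal.span {t} := by
    ext r
    rw [LinearMap.mem_ker]
    change Submodule.Quotient.mk (Ideal.Quotient.mk P r) = _ ↔ _
    rw [Submodule.Quotient.mk_eq_zero, LinearMap.mem_range, Submodule.mem_sup]
    constructor
    · rintro ⟨y, hy⟩
      obtain ⟨y, rfl⟩ := Ideal.Quotient.mk_surjective y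
      refine ⟨r - t * y, ?_, t * y, Ideal.mul_mem_right _ _ (Ideal.mem_span_singleton_self t),
        by ring⟩
      rw [← Ideal.Quotient.eq_zero_iff_mem, map_sub, map_mul, ← hy]
      exact sub_self _
    · rintro ⟨x, hx, y, hy, rfl⟩
      obtain ⟨y, rfl⟩ := Ideal.mem_span_singleton'.1 hy
      refine ⟨Ideal.Quotient.mk P y, ?_⟩
      rw [map_add, Ideal.Quotient.eq_zero_iff_mem.2 hx, zero_add, map_mul, mul_comm]
      rfl
  exact mult_congr ((Submodule.quotEquivOfEq _ _ hk.symm).trans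
    (mk.quotKerEquivOfSurjective hmk)) _

end CutMult

section OneDimensional

lemma ringKrullDim_eq_one_of_dimensionLEOne (A : Type*) [CommRing A] [IsDomain A]
    [Ring.DimensionLEOne A] (h : ¬ IsField A) : ringKrullDim A = 1 := by
  apply eq_of_le_of_not_lt
  · rw [← Nat.cast_one, ← Ring.krullDimLE_iff]
    infer_instance
  · intro h'
    have h'' : ringKrullDim A ≤ 0 := Order.le_of_lt_succ h'
    rw [← Nat.cast_zero, ← Ring.krullDimLE_iff] at h''
    exact h Ring.KrullDimLE.isField_of_isDomain

variable {R B : Type*} [CommRing R] [CommRing B]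

lemma exists_prime_over (φ : R →+* B) (hφ : φ.IsIntegral) (q : Ideal R) [q.IsPrime]
    (hq : RingHom.ker φ ≤ q) : ∃ Q : Ideal B, Q.IsPrime ∧ Q.comap φ = q := by
  let _ := φ.toAlgebra
  have : Algebra.IsIntegral R B := ⟨hφ⟩
  obtain ⟨Q, -, h1, h2⟩ := Ideal.exists_ideal_over_prime_of_isIntegral q (⊥ : Ideal B) hq
  exact ⟨Q, h1, h2⟩

lemma isMaximal_of_ker_lt [IsDomain B] [Ring.DimensionLEOne B] (φ : R →+* B) (hφ : φ.IsIntegral) (q : Ideal R)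
    [q.IsPrime] (hq : RingHom.ker φ < q) : q.IsMaximal := by
  obtain ⟨Q, hQ, rfl⟩ := exists_prime_over φ hφ q hq.le
  have hQ0 : Q ≠ ⊥ := by
    rintro rfl
    exact hq.ne rfl
  have := hQ.isMaximal hQ0
  exact Ideal.isMaximal_comap_of_isIntegral_of_isMaximal' φ hφ Q

lemma dimensionLEOne_quotient_ker [IsDomain B] [Ring.DimensionLEOne B] (φ : R →+* B) (hφ : φ.IsIntegral) :
    Ring.DimensionLEOne (R ⧸ RingHom.ker φ) := by
  refine ⟨fun {p} hp0 hp => ?_⟩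
  have hlt : RingHom.ker φ < p.comap (Ideal.Quotient.mk (RingHom.ker φ)) := by
    refine lt_of_le_of_ne ?_ ?_
    · intro x hx
      rw [Ideal.mem_comap, Ideal.Quotient.eq_zero_iff_mem.2 hx]
      exact p.zero_mem
    · intro h
      refine hp0 (Ideal.comap_injective_of_surjective _ Ideal.Quotient.mk_surjective ?_)
      rw [← h]
      exact Ideal.mk_ker.symm
  have := isMaximal_of_ker_lt φ hφ _ hlt
  have h2 := Ideal.map_comap_of_surjective _
    (Ideal.Quotient.mk_surjective (I := RingHom.ker φ)) p
  rw [← h2]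
  exact (Ideal.map_eq_top_or_isMaximal_of_surjective _ Ideal.Quotient.mk_surjective
    this).resolve_left (by rw [h2]; exact hp.ne_top)

lemma not_isField_quotient_ker [IsDomain B] (φ : R →+* B) (hφ : φ.IsIntegral) (hB : ¬ IsField B) :
    ¬ IsField (R ⧸ RingHom.ker φ) := by
  intro h
  let g : (R ⧸ RingHom.ker φ) →+* B := RingHom.kerLift φ
  let _ := g.toAlgebra
  have : Algebra.IsIntegral (R ⧸ RingHom.ker φ) B := ⟨by
    refine RingHom.IsIntegral.tower_top (Ideal.Quotient.mk (RingHom.ker φ)) g ?_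
    exact hφ⟩
  exact hB (isField_of_isIntegral_of_isField' h)

end OneDimensional

/-! ### Relations from parametrized curves -/

section Simplex

variable {k : Type*} [Field k] (e : k)

lemma simplexRing_algHom_ext {n : ℕ} {A : Type*} [CommRing A] [Algebra k A]
    {f g : SimplexRing k e n →ₐ[k] A} (h : ∀ i, f (coord e n i) = g (coord e n i)) : f = g := by
  refine Ideal.Quotient.algHom_ext _ (MvPolynomial.algHom_ext fun i => ?_)
  exact h i

lemma simplexLift_surjective {n : ℕ} {A : Type*} [CommRing A] [Algebra k A] (v : Fin (n + 1) → A)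
    (hv : ∑ i, v i = algebraMap k A e) (h : Algebra.adjoin k (Set.range v) = ⊤) :
    Function.Surjective (simplexLift e v hv) := by
  rw [← AlgHom.range_eq_top, eq_top_iff, ← h, Algebra.adjoin_le_iff]
  rintro _ ⟨i, rfl⟩
  exact ⟨coord e n i, simplexLift_coord e v hv i⟩

@[simp] lemma face_coord_self (n : ℕ) (j : Fin (n + 2)) : face e n j (coord e (n + 1) j) = 0 := by
  rw [face, simplexLift_coord, Fin.insertNth_apply_same]

@[simp] lemma face_coord_succAbove (n : ℕ) (j : Fin (n + 2)) (i : Fin (n + 1)) :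
    face e n j (coord e (n + 1) (j.succAbove i)) = coord e n i := by
  rw [face, simplexLift_coord, Fin.insertNth_apply_succAbove]

lemma face_surjective (n : ℕ) (j : Fin (n + 2)) : Function.Surjective (face e n j) := by
  let s : MvPolynomial (Fin (n + 1)) k →ₐ[k] SimplexRing k e (n + 1) :=
    MvPolynomial.aeval fun i => coord e (n + 1) (j.succAbove i)
  have h : (face e n j).comp s = Ideal.Quotient.mkₐ k _ := by
    refine MvPolynomial.algHom_ext fun i => ?_
    simp only [s, AlgHom.comp_apply, MvPolynomial.aeval_X, face_coord_succAbove]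
    rfl
  intro y
  obtain ⟨x, rfl⟩ := Ideal.Quotient.mk_surjective y
  exact ⟨s x, DFunLike.congr_fun h x⟩

lemma ker_face (n : ℕ) (j : Fin (n + 2)) :
    RingHom.ker (face e n j).toRingHom = Ideal.span {coord e (n + 1) j} := by
  apply le_antisymm
  · let s : SimplexRing k e n →ₐ[k] SimplexRing k e (n + 1) ⧸ Ideal.span {coord e (n + 1) j} :=
      simplexLift e (fun i => Ideal.Quotient.mk _ (coord e (n + 1) (j.succAbove i))) (by
        have h := (Fin.sum_univ_succAbove (coord e (n + 1)) j).symm.trans (sum_coord e (n + 1))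
        have h' := congrArg (Ideal.Quotient.mk (Ideal.span {coord e (n + 1) j})) h
        rw [map_add, Ideal.Quotient.eq_zero_iff_mem.2 (Ideal.mem_span_singleton_self _), zero_add,
          map_sum] at h'
        exact h')
    have hs : s.comp (face e n j) =
        Ideal.Quotient.mkₐ k (Ideal.span {coord e (n + 1) j}) := by
      refine simplexRing_algHom_ext (A := SimplexRing k e (n + 1) ⧸ Ideal.span {coord e (n + 1) j})
        e fun i => ?_
      rw [AlgHom.comp_apply]
      rcases Fin.eq_self_or_eq_succAbove j i with rfl | ⟨i, rfl⟩
      · rw [face_coord_self, map_zero]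
        exact (Ideal.Quotient.eq_zero_iff_mem.2 (Ideal.mem_span_singleton_self _)).symm
      · rw [face_coord_succAbove]
        exact simplexLift_coord e _ _ i
    intro x hx
    rw [← Ideal.Quotient.eq_zero_iff_mem]
    have := DFunLike.congr_fun hs x
    rw [AlgHom.comp_apply, show face e n j x = 0 from hx, map_zero] at this
    exact this.symm
  · rw [Ideal.span_singleton_le_iff_mem]
    exact face_coord_self e n j

end Simplex

section Curve

variable {k : Type*} [Field k] {e : k} {n : ℕ} {B : Type*} [CommRing B] [IsDomain B] [Algebra k B]
  [Ring.DimensionLEOne B]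

/-- A curve that meets no two of the hyperplanes `tᵢ = 0` simultaneously and lies in none of them
is in good position. -/
lemma isGood_curve (hB : ¬ IsField B) (w : Fin (n + 2) → B)
    (hw : ∑ i, w i = algebraMap k B e) (hfin : (simplexLift e w hw).toRingHom.IsIntegral)
    (h0 : ∀ i, w i ≠ 0) (hcop : ∀ i j, i ≠ j → IsCoprime (w i) (w j)) :
    IsGood e n (⟨RingHom.ker (simplexLift e w hw).toRingHom, RingHom.ker_isPrime _⟩ :
      PrimeSpectrum (SimplexRing k e (n + 1))) := by
  set φ := (simplexLift e w hw).toRingHom with hφ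
  have hφc (i) : φ (coord e (n + 1) i) = w i := simplexLift_coord e w hw i
  have := dimensionLEOne_quotient_ker φ hfin
  have hprime : (RingHom.ker φ).IsPrime := RingHom.ker_isPrime _
  have hdim : ringKrullDim (SimplexRing k e (n + 1) ⧸ RingHom.ker φ) = 1 :=
    ringKrullDim_eq_one_of_dimensionLEOne _ (not_isField_quotient_ker φ hfin hB)
  have hpair : ∀ (q : PrimeSpectrum (SimplexRing k e (n + 1))) i j, i ≠ j →
      RingHom.ker φ ≤ q.asIdeal → coord e (n + 1) i ∈ q.asIdeal →
      coord e (n + 1) j ∈ q.asIdeal → False := by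
    intro q i j hij hq hi hj
    obtain ⟨Q, hQ, hQq⟩ := exists_prime_over φ hfin q.asIdeal hq
    rw [← hQq, Ideal.mem_comap, hφc] at hi hj
    obtain ⟨a, b, hab⟩ := hcop i j hij
    refine hQ.ne_top ((Ideal.eq_top_iff_one _).2 ?_)
    rw [← hab]
    exact Q.add_mem (Q.mul_mem_left _ hi) (Q.mul_mem_left _ hj)
  have hcast : (1 : WithBot ℕ∞) + (n : WithBot ℕ∞) = ((n + 1 : ℕ) : WithBot ℕ∞) := by
    push_cast
    rw [add_comm]
  refine ⟨?_, ?_, ?_⟩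
  · rw [hdim, hcast]
  · rintro ⟨q, hq, hi⟩
    exact hpair q 0 1 (by simp) hq (hi 0) (hi 1)
  · intro I q hq hI
    rcases Nat.lt_or_ge 1 I.card with hc | hc
    · obtain ⟨i, hi, j, hj, hij⟩ := Finset.one_lt_card.1 hc
      exact (hpair q i j hij hq (hI i hi) (hI j hj)).elim
    · rcases Finset.card_le_one_iff_subset_singleton.1 hc with ⟨i, hi⟩
      rcases Finset.subset_singleton_iff.1 hi with rfl | rfl
      · have h1 : ringKrullDim (SimplexRing k e (n + 1) ⧸ q.asIdeal) ≤ 1 := by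
          rw [← hdim]
          exact ringKrullDim_le_of_surjective (Ideal.Quotient.factor hq)
            (Ideal.Quotient.factor_surjective hq)
        rw [Finset.card_empty, Nat.cast_zero, add_zero, ← hcast]
        gcongr
      · have hlt : RingHom.ker φ < q.asIdeal := by
          refine lt_of_le_of_ne hq fun h => h0 i ?_
          have := hI i (Finset.mem_singleton_self i)
          rwa [← h, RingHom.mem_ker, hφc] at this
        have hmax := isMaximal_of_ker_lt φ hfin q.asIdeal hlt
        rw [ringKrullDim_eq_zero_of_isField
          ((Ideal.Quotient.maximal_ideal_iff_isField_quotient _).1 hmax), zero_add,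
          Finset.card_singleton]
        exact_mod_cast le_rfl

/-- The faces of a parametrized curve: the push-forward of the divisor of the `j`-th coordinate is
`d` times the `j`-th face of the image, where `d` is the degree of the parametrization. Here `u` is
any lift to `B` of the parametrization of the divisor `wⱼ = 0` by the coordinates of the face. -/
lemma exists_smul_faceRestriction (w : Fin (n + 2) → B)
    (hw : ∑ i, w i = algebraMap k B e) (hfin : (simplexLift e w hw).toRingHom.Finite) :
    ∃ d : ℕ, 0 < d ∧ ∀ (j : Fin (n + 2)) (_ : w j ≠ 0) (u : Fin (n + 1) → B)
      (hu : ∑ i, u i = algebraMap k B e) (_ : ∀ l, w j ∣ u l - w (j.succAbove l))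
      (z : AllCycles k e n) (_ : HasCycle (simplexLift e u hu).toRingHom (w j) z),
      d • fundamentalCycle ((RingHom.ker (simplexLift e w hw).toRingHom).map (face e n j)) = z := by
  set φ := (simplexLift e w hw).toRingHom with hφ
  have hφc (i) : φ (coord e (n + 1) i) = w i := simplexLift_coord e w hw i
  have hint : φ.IsIntegral := hfin.to_isIntegral
  have := dimensionLEOne_quotient_ker φ hint
  have hprime : (RingHom.ker φ).IsPrime := RingHom.ker_isPrime _
  have hmult : ∃ d : ℕ, 0 < d ∧ ∀ f, f ∉ RingHom.ker φ → ∀ q, cutMult φ (φ f) q =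
      d * mult (SimplexRing k e (n + 1))
        (Cut (SimplexRing k e (n + 1)) (Ideal.Quotient.mk (RingHom.ker φ) f)) q := by
    let _ := φ.toAlgebra
    have : Module.Finite (SimplexRing k e (n + 1)) B := hfin
    exact exists_mult_cut_eq (RingHom.ker φ) rfl
  obtain ⟨d, hd, hdm⟩ := hmult
  refine ⟨d, hd, fun j hj u hu hcong z hz => ?_⟩
  have hjP : coord e (n + 1) j ∉ RingHom.ker φ := by rwa [RingHom.mem_ker, hφc]
  ext q
  obtain ⟨m, hm, hzm⟩ := hz q
  have hface : (face e n j).toRingHom (coord e (n + 1) j) = 0 := face_coord_self e n j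
  have hcong' : ∀ r, w j ∣ (simplexLift e u hu).toRingHom ((face e n j).toRingHom r) - φ r := by
    intro r
    rw [← Ideal.mem_span_singleton, ← Ideal.Quotient.eq]
    refine DFunLike.congr_fun (f := ((Ideal.Quotient.mkₐ k (Ideal.span {w j})).comp
      ((simplexLift e u hu).comp (face e n j)))) (g := (Ideal.Quotient.mkₐ k _).comp
      (simplexLift e w hw)) (simplexRing_algHom_ext e fun i => ?_) r
    simp only [AlgHom.comp_apply, simplexLift_coord]
    rcases Fin.eq_self_or_eq_succAbove j i with rfl | ⟨i, rfl⟩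
    · rw [face_coord_self, map_zero, map_zero]
      exact (Ideal.Quotient.eq_zero_iff_mem.2 (Ideal.mem_span_singleton_self _)).symm
    · rw [face_coord_succAbove, simplexLift_coord]
      exact (Ideal.Quotient.eq.2 (Ideal.mem_span_singleton.2 (hcong i)))
  have h1 := cutMult_comap (face e n j).toRingHom (face_surjective e n j) φ
    (simplexLift e u hu).toRingHom (w j) hcong' q
  have h2 := hdm _ hjP (PrimeSpectrum.comap (face e n j).toRingHom q)
  have h3 := mult_quotient_map (face e n j).toRingHom (face_surjective e n j) (coord e (n + 1) j)
    (ker_face e n j) (RingHom.ker φ) q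
  rw [hφc, h1, hm] at h2
  change mult _ (SimplexRing k e n ⧸ (RingHom.ker φ).map (face e n j)) q =
    mult _ (Cut _ (Ideal.Quotient.mk (RingHom.ker φ) (coord e (n + 1) j))) _ at h3
  rw [← h3] at h2
  set J := (RingHom.ker φ).map (face e n j) with hJ
  have h4 : fundamentalCycle J q = ((mult _ (SimplexRing k e n ⧸ J) q).toNat : ℤ) := by
    rw [fundamentalCycle_apply]
    split_ifs with hmin
    · rfl
    · have h0 : mult _ (SimplexRing k e n ⧸ J) q = 0 := by
        by_cases hle : J ≤ q.asIdeal
        · -- all primes that contain `J` are maximal, so that `q` would be minimal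
          refine absurd ⟨⟨q.isPrime, hle⟩, ?_⟩ hmin
          rintro q' ⟨hq', hJq'⟩ hq'q
          have hc : RingHom.ker φ < q'.comap (face e n j).toRingHom := by
            refine lt_of_le_of_ne (Ideal.map_le_iff_le_comap.1 hJq') fun h => hjP ?_
            rw [h, Ideal.mem_comap, hface]
            exact q'.zero_mem
          have hmax := isMaximal_of_ker_lt φ hint _ hc
          have heq := hmax.eq_of_le (Ideal.comap_ne_top _ q.isPrime.ne_top)
            (Ideal.comap_mono hq'q)
          exact (Ideal.comap_injective_of_surjective _ (face_surjective e n j) heq).ge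
        · exact mult_quotient_of_not_le _ q hle
      rw [h0]
      rfl
  rw [Finsupp.smul_apply, h4, hzm]
  have h5 := congrArg ENat.toNat h2
  rw [ENat.toNat_natCast, ENat.toNat_mul, ENat.toNat_natCast] at h5
  rw [h5]
  simp

end Curve

/-! ### Splitting a coordinate of a curve -/

section SplitCoord

variable {n : ℕ} {B : Type*}

/-- The coordinates of the curve obtained from `v` by splitting the `i`-th coordinate into the two
adjacent coordinates `α` and `β`. -/
def splitCoord (i : Fin (n + 1)) (v : Fin (n + 1) → B) (α β : B) : Fin (n + 2) → B :=
  i.castSucc.insertNth (α := fun _ => B) α (Function.update v i β)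

lemma splitCoord_castSucc (i : Fin (n + 1)) (v : Fin (n + 1) → B) (α β : B) :
    splitCoord i v α β i.castSucc = α := by
  simp [splitCoord]

lemma splitCoord_castSucc_succAbove (i : Fin (n + 1)) (v : Fin (n + 1) → B) (α β : B)
    (l : Fin (n + 1)) :
    splitCoord i v α β (i.castSucc.succAbove l) = Function.update v i β l := by
  simp [splitCoord]

lemma splitCoord_succ (i : Fin (n + 1)) (v : Fin (n + 1) → B) (α β : B) :
    splitCoord i v α β i.succ = β := by
  have := splitCoord_castSucc_succAbove i v α β i
  rwa [Fin.succAbove_castSucc_self, Function.update_self] at this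

lemma splitCoord_succ_succAbove (i : Fin (n + 1)) (v : Fin (n + 1) → B) (α β : B)
    (l : Fin (n + 1)) :
    splitCoord i v α β (i.succ.succAbove l) = Function.update v i α l := by
  rcases eq_or_ne l i with rfl | h
  · rw [Fin.succAbove_of_castSucc_lt _ _ Fin.castSucc_lt_succ, splitCoord_castSucc,
      Function.update_self]
  · rw [Function.update_of_ne h, show i.succ.succAbove l = i.castSucc.succAbove l from ?_,
      splitCoord_castSucc_succAbove, Function.update_of_ne h]
    rcases lt_or_gt_of_ne h with h | h
    · rw [Fin.succAbove_of_castSucc_lt _ _ (by simpa using h.le),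
        Fin.succAbove_of_castSucc_lt _ _ (by simpa using h)]
    · rw [Fin.succAbove_of_le_castSucc _ _ (by simpa [Fin.le_def] using h),
        Fin.succAbove_of_le_castSucc _ _ (by simpa using h.le)]

lemma splitCoord_of_ne (i : Fin (n + 1)) (v : Fin (n + 1) → B) (α β : B)
    (j : Fin (n + 2)) (h1 : j ≠ i.castSucc) (h2 : j ≠ i.succ) :
    ∃ l, l ≠ i ∧ splitCoord i v α β j = v l := by
  rcases Fin.eq_self_or_eq_succAbove i.castSucc j with rfl | ⟨l, rfl⟩
  · exact absurd rfl h1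
  · have hl : l ≠ i := by
      rintro rfl
      exact h2 (Fin.succAbove_castSucc_self _)
    exact ⟨l, hl, by rw [splitCoord_castSucc_succAbove, Function.update_of_ne hl]⟩

lemma sum_splitCoord [CommRing B] (i : Fin (n + 1)) (v : Fin (n + 1) → B) (α β : B) (h : v i = α + β) :
    ∑ j, splitCoord i v α β j = ∑ j, v j := by
  rw [Fin.sum_univ_succAbove _ i.castSucc, splitCoord_castSucc]
  simp only [splitCoord_castSucc_succAbove]
  rw [Finset.sum_update_of_mem (Finset.mem_univ i), ← Finset.sum_erase_add _ _ (Finset.mem_univ i),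
    h, Finset.sdiff_singleton_eq_erase]
  ring

end SplitCoord

section Splitting

variable {k : Type*} [Field k] {e : k} {n : ℕ} {B : Type*} [CommRing B] [IsDomain B] [Algebra k B]
  [Ring.DimensionLEOne B]

/-- A curve with one coordinate split as `α + β`, all other coordinates being invertible, gives a
relation between the divisors of `α` and of `β`. -/
lemma sub_mem_boundaries_of_split (hB : ¬ IsField B) (i : Fin (n + 1)) (v : Fin (n + 1) → B)
    (hv : ∑ j, v j = algebraMap k B e) (hunit : ∀ j, j ≠ i → IsUnit (v j)) (α β : B)
    (hαβ : v i = α + β) (hα : α ≠ 0) (hβ : β ≠ 0) (hcop : IsCoprime α β)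
    (hfin : ∀ hw, (simplexLift e (splitCoord i v α β) hw).toRingHom.Finite)
    {y z : AllCycles k e n} (hy : HasCycle (simplexLift e v hv).toRingHom α y)
    (hz : HasCycle (simplexLift e v hv).toRingHom β z) :
    y - z ∈ boundaries e n n := by
  have hw : ∑ j, splitCoord i v α β j = algebraMap k B e := by rw [sum_splitCoord i v α β hαβ, hv]
  have hne : i.succ ≠ i.castSucc := by simp [Fin.ext_iff]
  have hunit' : ∀ j, j ≠ i.castSucc → j ≠ i.succ → IsUnit (splitCoord i v α β j) := by
    intro j h1 h2
    obtain ⟨l, hl, h⟩ := splitCoord_of_ne i v α β j h1 h2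
    rw [h]
    exact hunit l hl
  have h0 : ∀ j, splitCoord i v α β j ≠ 0 := by
    intro j
    by_cases h1 : j = i.castSucc
    · rwa [h1, splitCoord_castSucc]
    by_cases h2 : j = i.succ
    · rwa [h2, splitCoord_succ]
    exact (hunit' j h1 h2).ne_zero
  have hcop' : ∀ j l, j ≠ l → IsCoprime (splitCoord i v α β j) (splitCoord i v α β l) := by
    intro j l hjl
    by_cases hju : IsUnit (splitCoord i v α β j)
    · obtain ⟨u, hu⟩ := hju
      exact ⟨↑u⁻¹, 0, by simp [← hu]⟩
    by_cases hlu : IsUnit (splitCoord i v α β l)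
    · obtain ⟨u, hu⟩ := hlu
      exact ⟨0, ↑u⁻¹, by simp [← hu]⟩
    have hj : j = i.castSucc ∨ j = i.succ := by
      by_contra! h
      exact hju (hunit' j h.1 h.2)
    have hl : l = i.castSucc ∨ l = i.succ := by
      by_contra! h
      exact hlu (hunit' l h.1 h.2)
    rcases hj with rfl | rfl <;> rcases hl with rfl | rfl
    · exact absurd rfl hjl
    · rwa [splitCoord_castSucc, splitCoord_succ]
    · rw [splitCoord_castSucc, splitCoord_succ]
      exact hcop.symm
    · exact absurd rfl hjl
  have hgood := isGood_curve hB (splitCoord i v α β) hw (hfin hw).to_isIntegral h0 hcop'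
  obtain ⟨d, hd, hface⟩ := exists_smul_faceRestriction (splitCoord i v α β) hw (hfin hw)
  set P : PrimeSpectrum (SimplexRing k e (n + 1)) :=
    ⟨RingHom.ker (simplexLift e (splitCoord i v α β) hw).toRingHom, RingHom.ker_isPrime _⟩ with hP
  -- modulo `α` the remaining coordinate of the pair is `v i`, and likewise modulo `β`
  have hyf : d • fundamentalCycle (P.asIdeal.map (face e n i.castSucc)) = y := by
    refine hface i.castSucc (h0 _) v hv ?_ y (by rwa [splitCoord_castSucc])
    intro l
    rw [splitCoord_castSucc, splitCoord_castSucc_succAbove]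
    rcases eq_or_ne l i with rfl | hl
    · rw [Function.update_self, hαβ, add_sub_cancel_right]
    · rw [Function.update_of_ne hl, sub_self]
      exact dvd_zero _
  have hzf : d • fundamentalCycle (P.asIdeal.map (face e n i.succ)) = z := by
    refine hface i.succ (h0 _) v hv ?_ z (by rwa [splitCoord_succ])
    intro l
    rw [splitCoord_succ, splitCoord_succ_succAbove]
    rcases eq_or_ne l i with rfl | hl
    · rw [Function.update_self, hαβ, add_sub_cancel_left]
    · rw [Function.update_of_ne hl, sub_self]
      exact dvd_zero _
  have hof : ∀ j, j ≠ i.castSucc → j ≠ i.succ →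
      fundamentalCycle (P.asIdeal.map (face e n j)) = 0 := by
    intro j h1 h2
    rw [show P.asIdeal.map (face e n j) = ⊤ from ?_, fundamentalCycle_top]
    by_contra hne
    obtain ⟨M, hM, hle⟩ := Ideal.exists_le_maximal _ hne
    obtain ⟨Q, hQ, hQM⟩ := exists_prime_over _ (hfin hw).to_isIntegral
      (M.comap (face e n j).toRingHom) (Ideal.map_le_iff_le_comap.1 hle)
    have hmem : coord e (n + 1) j ∈ M.comap (face e n j).toRingHom := by
      rw [Ideal.mem_comap]
      change face e n j _ ∈ M
      rw [face_coord_self]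
      exact M.zero_mem
    rw [← hQM, Ideal.mem_comap] at hmem
    change simplexLift e _ hw _ ∈ Q at hmem
    rw [simplexLift_coord] at hmem
    exact hQ.ne_top (Q.eq_top_of_isUnit_mem hmem (hunit' j h1 h2))
  refine ⟨((-1 : ℤ) ^ (i : ℕ) * d) • Finsupp.single P 1, Submodule.smul_mem _ _
    (Submodule.subset_span ⟨P, hgood, rfl⟩), ?_⟩
  rw [map_smul, boundary, LinearMap.sum_apply]
  simp only [LinearMap.smul_apply, faceRestriction, Finsupp.linearCombination_single, one_smul]
  rw [Finset.sum_eq_add_of_mem i.castSucc i.succ (Finset.mem_univ _) (Finset.mem_univ _) hne.symm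
    (fun j _ hj => by rw [hof j hj.1 hj.2, smul_zero]), ← hyf, ← hzf]
  simp only [Fin.val_castSucc, Fin.val_succ, smul_add, smul_smul, ← natCast_zsmul]
  have h1 : (-1 : ℤ) ^ (i : ℕ) * (-1) ^ (i : ℕ) = 1 := by rw [← mul_pow]; simp
  have h2 : (-1 : ℤ) ^ (i : ℕ) * d * (-1) ^ (i : ℕ) = d := by linear_combination (d : ℤ) * h1
  have h3 : (-1 : ℤ) ^ (i : ℕ) * d * (-1) ^ ((i : ℕ) + 1) = - d := by
    linear_combination -(d : ℤ) * h1
  rw [h2, h3, neg_smul]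
  exact (sub_eq_add_neg _ _).symm

end Splitting

/-! ### Open subsets of the affine line -/

section CurveRing

variable {k L : Type*} [Field k] [Field L] [Algebra k L]

/-- The coordinate ring of the open subset `h ≠ 0` of the affine line over `L`. -/
abbrev CurveRing (h : Polynomial L) : Type _ := Localization.Away h

variable (h : Polynomial L)

/-- The coordinate function on the line. -/
def param : CurveRing h := algebraMap (Polynomial L) _ Polynomial.X

/-- The inverse of `h`. -/
def recip : CurveRing h := IsLocalization.Away.invSelf h

lemma algebraMap_curveRing (a : L) :
    algebraMap L (CurveRing h) a = algebraMap (Polynomial L) _ (Polynomial.C a) := rfl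

lemma algebraMap_mul_recip : algebraMap (Polynomial L) (CurveRing h) h * recip h = 1 :=
  IsLocalization.Away.mul_invSelf h

lemma isUnit_recip : IsUnit (recip h) :=
  IsUnit.of_mul_eq_one _ ((mul_comm _ _).trans (algebraMap_mul_recip h))

lemma exists_mul_recip_pow (x : CurveRing h) :
    ∃ (p : Polynomial L) (N : ℕ), x = algebraMap (Polynomial L) _ p * recip h ^ N := by
  obtain ⟨N, p, hp⟩ := IsLocalization.Away.surj h x
  refine ⟨p, N, ?_⟩
  rw [← hp, mul_assoc, ← mul_pow, algebraMap_mul_recip, one_pow, mul_one]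

lemma curveRing_isDomain (h0 : h ≠ 0) : IsDomain (CurveRing h) :=
  IsLocalization.isDomain_localization (powers_le_nonZeroDivisors_of_noZeroDivisors h0)

lemma curveRing_dimensionLEOne (h0 : h ≠ 0) : Ring.DimensionLEOne (CurveRing h) :=
  Ring.DimensionLEOne.localization (CurveRing h) (powers_le_nonZeroDivisors_of_noZeroDivisors h0)

lemma curveRing_not_isField (h0 : h ≠ 0) : ¬ IsField (CurveRing h) := by
  intro hF
  have := curveRing_isDomain h h0
  have hdeg : (h * Polynomial.X + 1).natDegree = h.natDegree + 1 := by
    rw [← Polynomial.C_1, Polynomial.natDegree_add_C, Polynomial.natDegree_mul_X h0]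
  have hp0 : h * Polynomial.X + 1 ≠ 0 := by
    intro hp
    rw [hp, Polynomial.natDegree_zero] at hdeg
    omega
  have hinj : Function.Injective (algebraMap (Polynomial L) (CurveRing h)) :=
    IsLocalization.injective _ (powers_le_nonZeroDivisors_of_noZeroDivisors h0)
  obtain ⟨y, hy⟩ := hF.mul_inv_cancel ((map_ne_zero_iff _ hinj).2 hp0)
  obtain ⟨_, ⟨N, rfl⟩, hdvd⟩ := (IsLocalization.algebraMap_isUnit_iff (Submonoid.powers h)).1
    (IsUnit.of_mul_eq_one _ hy)
  have hcop : IsCoprime (h * Polynomial.X + 1) (h ^ N) :=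
    IsCoprime.pow_right ⟨1, - Polynomial.X, by ring⟩
  have := Polynomial.natDegree_eq_zero_of_isUnit (hcop.isUnit_of_dvd hdvd)
  omega

/-- Evaluation of functions at a point `b` with `h(b) ≠ 0`. -/
def evalAt (b : L) (hb : h.eval b ≠ 0) : CurveRing h →+* L :=
  IsLocalization.Away.lift (g := Polynomial.evalRingHom b) h (isUnit_iff_ne_zero.2 hb)

lemma evalAt_algebraMap (b : L) (hb : h.eval b ≠ 0) (p : Polynomial L) :
    evalAt h b hb (algebraMap _ _ p) = p.eval b :=
  IsLocalization.Away.lift_eq h _ p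

@[simp] lemma evalAt_param (b : L) (hb : h.eval b ≠ 0) : evalAt h b hb (param h) = b := by
  rw [param, evalAt_algebraMap, Polynomial.eval_X]

@[simp] lemma evalAt_const (b : L) (hb : h.eval b ≠ 0) (a : L) :
    evalAt h b hb (algebraMap L _ a) = a := by
  rw [algebraMap_curveRing, evalAt_algebraMap, Polynomial.eval_C]

@[simp] lemma evalAt_recip (b : L) (hb : h.eval b ≠ 0) :
    evalAt h b hb (recip h) = (h.eval b)⁻¹ := by
  have := congrArg (evalAt h b hb) (algebraMap_mul_recip h)
  rw [map_mul, evalAt_algebraMap, map_one] at this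
  exact eq_inv_of_mul_eq_one_right this

lemma param_sub (b : L) : param h - algebraMap L _ b =
    algebraMap (Polynomial L) _ (Polynomial.X - Polynomial.C b) := by
  rw [map_sub]
  rfl

lemma ker_evalAt (b : L) (hb : h.eval b ≠ 0) :
    RingHom.ker (evalAt h b hb) = Ideal.span {param h - algebraMap L _ b} := by
  apply le_antisymm
  · intro x hx
    obtain ⟨p, N, rfl⟩ := exists_mul_recip_pow h x
    rw [RingHom.mem_ker, map_mul, map_pow, evalAt_recip, evalAt_algebraMap] at hx
    have hp : p.IsRoot b := (mul_eq_zero.1 hx).resolve_right (pow_ne_zero _ (inv_ne_zero hb))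
    obtain ⟨q, rfl⟩ := Polynomial.dvd_iff_isRoot.2 hp
    rw [map_mul, mul_assoc, ← param_sub]
    exact Ideal.mul_mem_right _ _ (Ideal.mem_span_singleton_self _)
  · rw [Ideal.span_singleton_le_iff_mem, RingHom.mem_ker]
    simp

lemma isUnit_param_sub (b : L) (hb : h.eval b = 0) :
    IsUnit (param h - algebraMap L (CurveRing h) b) := by
  obtain ⟨q, hq⟩ := Polynomial.dvd_iff_isRoot.2 (show h.IsRoot b from hb)
  refine IsUnit.of_mul_eq_one (algebraMap _ _ q * recip h) ?_
  rw [param_sub, ← mul_assoc, ← map_mul, ← hq, algebraMap_mul_recip]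

lemma param_sub_ne_zero (h0 : h ≠ 0) (b : L) : param h - algebraMap L (CurveRing h) b ≠ 0 := by
  rw [param_sub, map_ne_zero_iff _ (IsLocalization.injective _
    (powers_le_nonZeroDivisors_of_noZeroDivisors h0))]
  exact Polynomial.X_sub_C_ne_zero b

lemma isUnit_const {a : L} (ha : a ≠ 0) : IsUnit (algebraMap L (CurveRing h) a) :=
  (isUnit_iff_ne_zero.2 ha).map _

lemma curveRing_subring_eq_top (S : Subring (CurveRing h)) (hL : ∀ a : L, algebraMap L _ a ∈ S)
    (ht : param h ∈ S) (hr : recip h ∈ S) : S = ⊤ := by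
  rw [eq_top_iff]
  rintro x -
  obtain ⟨p, N, rfl⟩ := exists_mul_recip_pow h x
  refine S.mul_mem ?_ (S.pow_mem hr N)
  induction p using Polynomial.induction_on' with
  | add p q hp hq => rw [map_add]; exact S.add_mem hp hq
  | monomial n a =>
    rw [← Polynomial.C_mul_X_pow_eq_monomial, map_mul, map_pow]
    exact S.mul_mem (hL a) (S.pow_mem ht n)

variable {e : k} {n : ℕ}

lemma hasCycle_unit_param_sub (v : Fin (n + 1) → CurveRing h)
    (hv : ∑ j, v j = algebraMap k (CurveRing h) e) (b : L) (hb : h.eval b = 0) :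
    HasCycle (simplexLift e v hv).toRingHom (param h - algebraMap L _ b) 0 :=
  HasCycle.of_isUnit _ (isUnit_param_sub h b hb)

/-- The divisor of `t - b` is the closed point at `t = b`. -/
lemma hasCycle_param_sub (v : Fin (n + 1) → CurveRing h)
    (hv : ∑ j, v j = algebraMap k (CurveRing h) e) (b : L) (hb : h.eval b ≠ 0)
    (g : SimplexRing k e n →ₐ[k] L) (hg : Function.Surjective g)
    (hgv : ∀ j, evalAt h b hb (v j) = g (coord e n j)) :
    HasCycle (simplexLift e v hv).toRingHom (param h - algebraMap L _ b)
      (Finsupp.single ⟨RingHom.ker g, RingHom.ker_isPrime _⟩ 1) := by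
  have key : (evalAt h b hb).comp (simplexLift e v hv).toRingHom = g.toRingHom := by
    let E : CurveRing h →ₐ[k] L := { evalAt h b hb with
      commutes' := fun r => by
        change evalAt h b hb (algebraMap k _ r) = _
        rw [IsScalarTower.algebraMap_apply k L (CurveRing h), evalAt_const] }
    have : E.comp (simplexLift e v hv) = g := by
      refine simplexRing_algHom_ext e fun j => ?_
      rw [AlgHom.comp_apply, simplexLift_coord]
      exact hgv j
    rw [← this]
    rfl
  have := HasCycle.of_ker (simplexLift e v hv).toRingHom (evalAt h b hb) (ker_evalAt h b hb)
    (by rw [key]; exact hg)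
  convert this using 3
  exact congrArg RingHom.ker key.symm

end CurveRing

section RationalCurve

variable {k : Type*} [Field k] {e : k} {n : ℕ} (h : Polynomial k)

lemma hasCycle_ratPoint (v : Fin (n + 1) → CurveRing h)
    (hv : ∑ j, v j = algebraMap k (CurveRing h) e) (b : k) (hb : h.eval b ≠ 0)
    (u : Fin (n + 1) → k) (hu : ∑ j, u j = e) (huv : ∀ j, evalAt h b hb (v j) = u j) :
    HasCycle (simplexLift e v hv).toRingHom (param h - algebraMap k _ b)
      (Finsupp.single (ratPoint e u hu) 1) :=
  hasCycle_param_sub h v hv b hb (simplexLift e u hu) (fun x => ⟨algebraMap k _ x, by simp⟩)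
    (fun j => by rw [huv, simplexLift_coord])

lemma simplexLift_finite_of_mem_adjoin (w : Fin (n + 1) → CurveRing h)
    (hw : ∑ j, w j = algebraMap k (CurveRing h) e)
    (ht : param h ∈ Algebra.adjoin k (Set.range w)) (hr : recip h ∈ Algebra.adjoin k (Set.range w)) :
    (simplexLift e w hw).toRingHom.Finite := by
  refine RingHom.Finite.of_surjective _ (simplexLift_surjective e w hw ?_)
  have := curveRing_subring_eq_top h (Algebra.adjoin k (Set.range w)).toSubring
    (fun a => Subalgebra.algebraMap_mem _ a) ht hr
  rw [eq_top_iff]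
  rintro x -
  have hx : x ∈ (⊤ : Subring (CurveRing h)) := trivial
  rwa [← this] at hx

end RationalCurve

/-! ### Relations between rational points -/

section Points

variable {k : Type*} [Field k] (e : k) {n : ℕ}

open scoped Classical in
/-- The rational point `u` as a cycle, or `0` if the coordinates of `u` do not add up to `e`. -/
def pointCycle (u : Fin (n + 1) → k) : AllCycles k e n :=
  if hu : ∑ j, u j = e then Finsupp.single (ratPoint e u hu) 1 else 0

lemma pointCycle_of_eq (u : Fin (n + 1) → k) (hu : ∑ j, u j = e) :
    pointCycle e u = Finsupp.single (ratPoint e u hu) 1 :=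
  dif_pos hu

variable {e}

/-- A rational point is a boundary if the coordinates in a proper non-empty subset add up to
zero: scaling these coordinates by `t` and splitting another coordinate `uᵢ` as
`uᵢ (1 - 1 / t) + uᵢ / t` gives a curve that meets the faces in this point only. -/
lemma pointCycle_mem_boundaries (u : Fin (n + 1) → k) (hu : ∑ j, u j = e) (h0 : ∀ j, u j ≠ 0)
    (D : Finset (Fin (n + 1))) (hD : D.Nonempty) (i : Fin (n + 1)) (hi : i ∉ D)
    (hsum : ∑ j ∈ D, u j = 0) : pointCycle e u ∈ boundaries e n n := by
  classical
  have hh : (Polynomial.X : Polynomial k) ≠ 0 := Polynomial.X_ne_zero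
  set h : Polynomial k := Polynomial.X
  have := curveRing_isDomain h hh
  have := curveRing_dimensionLEOne h hh
  have htT : param h * recip h = 1 := algebraMap_mul_recip h
  set t := param h with ht
  set T := recip h with hT
  let c : k →+* CurveRing h := algebraMap k (CurveRing h)
  have hc {a : k} (ha : a ≠ 0) : IsUnit (c a) := isUnit_const h ha
  have hTu : IsUnit T := isUnit_recip h
  have htu : IsUnit t := IsUnit.of_mul_eq_one _ htT
  let v : Fin (n + 1) → CurveRing h := fun j => if j ∈ D then t * c (u j) else c (u j)
  have hv : ∑ j, v j = c e := by
    have : ∀ j, v j = c (u j) + if j ∈ D then (t - 1) * c (u j) else 0 := by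
      intro j
      simp only [v]
      split_ifs <;> ring
    simp only [this]
    rw [Finset.sum_add_distrib, ← map_sum, hu, Finset.sum_ite_mem, Finset.univ_inter,
      ← Finset.mul_sum, ← map_sum, hsum, map_zero, mul_zero, add_zero]
  have hvi : v i = c (u i) := if_neg hi
  have hαβ : v i = c (u i) * T * (t - c 1) + c (u i) * T := by
    rw [hvi, map_one]
    linear_combination - c (u i) * htT
  have hβu : IsUnit (c (u i) * T) := (hc (h0 i)).mul hTu
  have hpt : HasCycle (simplexLift e v hv).toRingHom (c (u i) * T * (t - c 1)) (pointCycle e u) := by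
    refine HasCycle.unit_mul hβu ?_
    rw [pointCycle_of_eq e u hu]
    refine hasCycle_ratPoint h v hv 1 (by simp [h]) u hu fun j => ?_
    simp only [v]
    split_ifs <;> simp [c, ht]
  have := sub_mem_boundaries_of_split (curveRing_not_isField h hh) i v hv ?_ _ _ hαβ ?_ hβu.ne_zero
    ?_ ?_ hpt (HasCycle.of_isUnit _ hβu)
  · simpa using this
  · intro j _
    simp only [v]
    split_ifs
    · exact htu.mul (hc (h0 j))
    · exact hc (h0 j)
  · exact mul_ne_zero hβu.ne_zero (param_sub_ne_zero h hh 1)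
  · obtain ⟨x, hx⟩ := hβu
    exact ⟨0, ↑x⁻¹, by rw [← hx]; simp⟩
  · intro hw
    have hmem (j) : splitCoord i v (c (u i) * T * (t - c 1)) (c (u i) * T) j ∈ Algebra.adjoin k
        (Set.range (splitCoord i v (c (u i) * T * (t - c 1)) (c (u i) * T))) :=
      Algebra.subset_adjoin ⟨j, rfl⟩
    refine simplexLift_finite_of_mem_adjoin h _ hw ?_ ?_
    · obtain ⟨j, hj⟩ := hD
      have hji : j ≠ i := fun h => hi (h ▸ hj)
      have := hmem (i.castSucc.succAbove j)
      rw [splitCoord_castSucc_succAbove, Function.update_of_ne hji] at this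
      have h2 := Subalgebra.smul_mem _ this (u j)⁻¹
      convert h2 using 1
      simp only [v, if_pos hj, Algebra.smul_def]
      rw [mul_left_comm, ← map_mul, inv_mul_cancel₀ (h0 j), map_one, mul_one]
    · have := hmem i.succ
      rw [splitCoord_succ] at this
      have h2 := Subalgebra.smul_mem _ this (u i)⁻¹
      convert h2 using 1
      rw [Algebra.smul_def, ← mul_assoc, ← map_mul, inv_mul_cancel₀ (h0 i), map_one, one_mul]

/-- The point of `Δⁿ` with homogeneous coordinates `d`, except that the `i`-th one is `x`. -/
def homPoint (i : Fin (n + 1)) (d : Fin (n + 1) → k) (x : k) : Fin (n + 1) → k :=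
  fun j => (Function.update d i x j) / ∑ l, Function.update d i x l

lemma sum_update_eq (i : Fin (n + 1)) (d : Fin (n + 1) → k) (x : k) :
    ∑ l, Function.update d i x l = x + ∑ l ∈ Finset.univ \ {i}, d l :=
  Finset.sum_update_of_mem (Finset.mem_univ i) d x

lemma sum_homPoint (i : Fin (n + 1)) (d : Fin (n + 1) → k) (x : k)
    (hx : ∑ l, Function.update d i x l ≠ 0) : ∑ j, homPoint i d x j = 1 := by
  simp only [homPoint]
  rw [← Finset.sum_div, div_self hx]

lemma pointCycle_homPoint_of_sum_eq_zero (i : Fin (n + 1)) (d : Fin (n + 1) → k) (x : k)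
    (hx : ∑ l, Function.update d i x l = 0) : pointCycle 1 (homPoint i d x) = 0 := by
  refine dif_neg ?_
  simp [homPoint, hx]

/-- The multiplicative relation: the coordinate `t` of the line `(d₀ : ⋯ : t : ⋯ : dₙ)` is split
into functions with divisors `[b] + [b']` and `[1] + [b b']`. -/
lemma homPoint_mul_mem_boundaries (i : Fin (n + 1)) (d : Fin (n + 1) → k)
    (hd : ∀ j, j ≠ i → d j ≠ 0) (hn : ∃ j, j ≠ i) (b b' : k) (hb : b ≠ 0) (hb' : b' ≠ 0)
    (hb1 : b ≠ 1) (hb1' : b' ≠ 1) :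
    (pointCycle 1 (homPoint i d b) + pointCycle 1 (homPoint i d b')) -
      (pointCycle 1 (homPoint i d 1) + pointCycle 1 (homPoint i d (b * b'))) ∈
        boundaries (1 : k) n n := by
  set s : k := ∑ l ∈ Finset.univ \ {i}, d l with hs
  have hh : (Polynomial.X + Polynomial.C s : Polynomial k) ≠ 0 := Polynomial.X_add_C_ne_zero s
  set h : Polynomial k := Polynomial.X + Polynomial.C s with hdef
  have := curveRing_isDomain h hh
  have := curveRing_dimensionLEOne h hh
  let c : k →+* CurveRing h := algebraMap k (CurveRing h)
  have hc {a : k} (ha : a ≠ 0) : IsUnit (c a) := isUnit_const h ha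
  have htT : (param h + c s) * recip h = 1 := by
    have := algebraMap_mul_recip h
    rwa [hdef, map_add] at this
  set t := param h with ht
  set T := recip h with hT
  have hTu : IsUnit T := isUnit_recip h
  let v : Fin (n + 1) → CurveRing h := fun j => Function.update (fun l => c (d l)) i t j * T
  have hvi : v i = t * T := by simp [v]
  have hvj (j) (hj : j ≠ i) : v j = c (d j) * T := by simp [v, hj]
  have hv : ∑ j, v j = c 1 := by
    simp only [v]
    rw [← Finset.sum_mul, Finset.sum_update_of_mem (Finset.mem_univ i), ← map_sum, ← hs, htT,
      map_one]
  set κ : k := ((1 - b) * (1 - b'))⁻¹ with hκ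
  have hκ0 : κ ≠ 0 := inv_ne_zero (mul_ne_zero (sub_ne_zero.2 hb1.symm) (sub_ne_zero.2 hb1'.symm))
  have hκ1 : c κ * ((1 - c b) * (1 - c b')) = 1 := by
    rw [← map_one c, ← map_sub, ← map_sub, ← map_mul, ← map_mul, hκ, inv_mul_cancel₀]
    exact mul_ne_zero (sub_ne_zero.2 hb1.symm) (sub_ne_zero.2 hb1'.symm)
  have hαu : IsUnit (c κ * T) := (hc hκ0).mul hTu
  have hαβ : v i = c κ * T * ((t - c b) * (t - c b')) +
      -(c κ * T) * ((t - c 1) * (t - c (b * b'))) := by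
    rw [hvi, map_one, map_mul]
    linear_combination - t * T * hκ1
  have hpt (x : k) : HasCycle (simplexLift 1 v hv).toRingHom (t - c x)
      (pointCycle 1 (homPoint i d x)) := by
    by_cases hx : x + s = 0
    · rw [pointCycle_homPoint_of_sum_eq_zero i d x (by rw [sum_update_eq, ← hs, hx])]
      exact hasCycle_unit_param_sub h v hv x (by simp [hdef, hx])
    · have hsum : ∑ l, Function.update d i x l ≠ 0 := by rwa [sum_update_eq, ← hs]
      rw [pointCycle_of_eq 1 _ (sum_homPoint i d x hsum)]
      refine hasCycle_ratPoint h v hv x (by simpa [hdef] using hx) _ _ fun j => ?_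
      rw [homPoint, sum_update_eq, ← hs]
      rcases eq_or_ne j i with rfl | hj
      · rw [hvi, map_mul, evalAt_param, evalAt_recip]
        simp [hdef, div_eq_mul_inv]
      · rw [hvj j hj, map_mul, evalAt_const, evalAt_recip, Function.update_of_ne hj]
        simp [hdef, div_eq_mul_inv]
  refine sub_mem_boundaries_of_split (curveRing_not_isField h hh) i v hv ?_ _ _ hαβ ?_ ?_ ?_ ?_
    (HasCycle.unit_mul hαu (HasCycle.mul (param_sub_ne_zero h hh b) (hpt b) (hpt b')))
    (HasCycle.unit_mul hαu.neg (HasCycle.mul (param_sub_ne_zero h hh 1) (hpt 1) (hpt (b * b'))))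
  · intro j hj
    rw [hvj j hj]
    exact (hc (hd j hj)).mul hTu
  · exact mul_ne_zero hαu.ne_zero
      (mul_ne_zero (param_sub_ne_zero h hh _) (param_sub_ne_zero h hh _))
  · exact mul_ne_zero hαu.neg.ne_zero
      (mul_ne_zero (param_sub_ne_zero h hh _) (param_sub_ne_zero h hh _))
  · -- the sum of the two functions is `t T`, and the first one does not vanish at `t = 0`
    have h1 : IsCoprime (t * T) (c κ * T * ((t - c b) * (t - c b'))) := by
      have hu : IsUnit (c κ * T * c (b * b')) := hαu.mul (hc (mul_ne_zero hb hb'))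
      obtain ⟨x, hx⟩ := hu
      refine ⟨- ↑x⁻¹ * c κ * (t - c b - c b'), ↑x⁻¹, ?_⟩
      have hx1 : (↑x⁻¹ : CurveRing h) * (c κ * T * (c b * c b')) = 1 := by
        rw [← map_mul, ← hx]; simp
      linear_combination hx1
    rw [← hvi, hαβ] at h1
    exact (IsCoprime.add_mul_left_left_iff (x := -(c κ * T) * ((t - c 1) * (t - c (b * b'))))
      (y := c κ * T * ((t - c b) * (t - c b'))) (z := 1)).1 (by rwa [mul_one, add_comm]) |>.symm
  · intro hw
    set w := splitCoord i v (c κ * T * ((t - c b) * (t - c b')))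
      (-(c κ * T) * ((t - c 1) * (t - c (b * b')))) with hwdef
    have hmem (j) : w j ∈ Algebra.adjoin k (Set.range w) := Algebra.subset_adjoin ⟨j, rfl⟩
    have hTm : T ∈ Algebra.adjoin k (Set.range w) := by
      obtain ⟨j, hj⟩ := hn
      have := hmem (i.castSucc.succAbove j)
      rw [hwdef, splitCoord_castSucc_succAbove, Function.update_of_ne hj, hvj j hj] at this
      have h2 := Subalgebra.smul_mem _ this (d j)⁻¹
      convert h2 using 1
      rw [Algebra.smul_def, ← mul_assoc, ← map_mul, inv_mul_cancel₀ (hd j hj), map_one, one_mul]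
    refine simplexLift_finite_of_mem_adjoin h _ hw ?_ hTm
    have h2 := hmem i.castSucc
    rw [show w i.castSucc = _ from splitCoord_castSucc _ _ _ _] at h2
    have hcm (a : k) : c a ∈ Algebra.adjoin k (Set.range w) := Subalgebra.algebraMap_mem _ a
    have hκi : c κ * c κ⁻¹ = 1 := by rw [← map_mul, mul_inv_cancel₀ hκ0, map_one]
    -- division with remainder by `t + s`
    have h3 : t = c κ⁻¹ * (c κ * T * ((t - c b) * (t - c b'))) + c (b + b' + s) -
        c ((s + b) * (s + b')) * T := by
      simp only [map_add, map_mul]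
      linear_combination (- T * (t - c b) * (t - c b')) * hκi -
        (t - (c b + c b' + c s)) * htT
    rw [show param h = _ from h3]
    exact sub_mem (add_mem (mul_mem (hcm _) h2) (hcm _)) (mul_mem (hcm _) hTm)

end Points

/-! ### The additive relation between rational points -/

section AdditiveRelation

variable {k : Type*} [Field k] {m : ℕ}

/-- The point `x ⋆ (-1, u)` of `Qᵐ⁺¹`, where `u` is the point of `Δᵐ` with homogeneous coordinates
`d`, except that the `i`-th one is `x`. -/
def addPoint (i : Fin (m + 1)) (d : Fin (m + 1) → k) (x : k) : Fin (m + 2) → k :=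
  fun j => x⁻¹ * Fin.cons (α := fun _ => k) (-1) (homPoint i d x) j

lemma sum_addPoint (i : Fin (m + 1)) (d : Fin (m + 1) → k) (x : k)
    (hx : ∑ l, Function.update d i x l ≠ 0) : ∑ j, addPoint i d x j = 0 := by
  simp only [addPoint]
  rw [← Finset.mul_sum, Fin.sum_univ_succ]
  simp [sum_homPoint i d x hx]

lemma pointCycle_addPoint_of_sum_eq_zero (i : Fin (m + 1)) (d : Fin (m + 1) → k) (x : k)
    (hx0 : x ≠ 0) (hx : ∑ l, Function.update d i x l = 0) :
    pointCycle 0 (addPoint i d x) = 0 := by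
  refine dif_neg ?_
  simp only [addPoint]
  rw [← Finset.mul_sum, Fin.sum_univ_succ]
  simp [homPoint, hx, hx0]

open scoped Classical in
/-- The additive relation: on the curve of the points `x ⋆ (-1, u)`, where only the `i`-th
homogeneous coordinate of `u` varies and is equal to `x`, the first coordinate `-1 / x` is split
into functions with divisors `[b] + [b']` and `[b + b']`. -/
lemma addPoint_add_mem_boundaries (i : Fin (m + 1)) (d : Fin (m + 1) → k)
    (hd : ∀ j, j ≠ i → d j ≠ 0) (hn : ∃ j, j ≠ i) (b b' : k) (hb : b ≠ 0) (hb' : b' ≠ 0) :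
    (pointCycle 0 (addPoint i d b) + pointCycle 0 (addPoint i d b')) -
      (if b + b' = 0 then 0 else pointCycle 0 (addPoint i d (b + b'))) ∈
        boundaries (0 : k) (m + 1) (m + 1) := by
  set s : k := ∑ l ∈ Finset.univ \ {i}, d l with hs
  have hh : (Polynomial.X * (Polynomial.X + Polynomial.C s) : Polynomial k) ≠ 0 :=
    mul_ne_zero Polynomial.X_ne_zero (Polynomial.X_add_C_ne_zero s)
  set h : Polynomial k := Polynomial.X * (Polynomial.X + Polynomial.C s) with hdef
  have := curveRing_isDomain h hh
  have := curveRing_dimensionLEOne h hh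
  let c : k →+* CurveRing h := algebraMap k (CurveRing h)
  have hc {a : k} (ha : a ≠ 0) : IsUnit (c a) := isUnit_const h ha
  have htT : param h * (param h + c s) * recip h = 1 := by
    have := algebraMap_mul_recip h
    rwa [hdef, map_mul, map_add] at this
  have heval (x : k) : h.eval x = x * (x + s) := by simp [hdef]
  set t := param h with ht
  set T := recip h with hT
  have htu : IsUnit t := IsUnit.of_mul_eq_one ((t + c s) * T) (by rw [← mul_assoc, htT])
  have hTu : IsUnit T := isUnit_recip h
  have hsT : IsUnit ((t + c s) * T) :=
    IsUnit.of_mul_eq_one t (by linear_combination htT)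
  let v : Fin (m + 2) → CurveRing h := Fin.cons (α := fun _ => CurveRing h) (-((t + c s) * T))
    fun j => Function.update (fun l => c (d l)) i t j * T
  have hv0 : v 0 = -((t + c s) * T) := rfl
  have hvi : v i.succ = t * T := by simp [v]
  have hvj (j) (hj : j ≠ i) : v j.succ = c (d j) * T := by simp [v, hj]
  have hv : ∑ j, v j = c 0 := by
    rw [Fin.sum_univ_succ]
    simp only [v, Fin.cons_zero, Fin.cons_succ]
    rw [← Finset.sum_mul, Finset.sum_update_of_mem (Finset.mem_univ i), ← map_sum, ← hs, map_zero]
    ring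
  set κ : k := -(b * b')⁻¹ with hκ
  have hκ0 : κ ≠ 0 := neg_ne_zero.2 (inv_ne_zero (mul_ne_zero hb hb'))
  have hκ1 : c κ * (c b * c b') = -1 := by
    rw [← map_mul, ← map_mul, hκ, neg_mul, inv_mul_cancel₀ (mul_ne_zero hb hb'), map_neg, map_one]
  have hαu : IsUnit (c κ * ((t + c s) * T)) := (hc hκ0).mul hsT
  have hβu : IsUnit (- c κ) := (hc hκ0).neg
  have hαβ : v 0 = c κ * ((t + c s) * T) * ((t - c b) * (t - c b')) +
      -c κ * (t - c (b + b')) := by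
    rw [hv0, map_add]
    linear_combination - c κ * (t - c b - c b') * htT - (t + c s) * T * hκ1
  have hpt (x : k) (hx0 : x ≠ 0) : HasCycle (simplexLift 0 v hv).toRingHom (t - c x)
      (pointCycle 0 (addPoint i d x)) := by
    by_cases hx : x + s = 0
    · rw [pointCycle_addPoint_of_sum_eq_zero i d x hx0 (by rw [sum_update_eq, ← hs, hx])]
      exact hasCycle_unit_param_sub h v hv x (by rw [heval, hx, mul_zero])
    · have hsum : ∑ l, Function.update d i x l ≠ 0 := by rwa [sum_update_eq, ← hs]
      rw [pointCycle_of_eq 0 _ (sum_addPoint i d x hsum)]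
      refine hasCycle_ratPoint h v hv x (by rw [heval]; exact mul_ne_zero hx0 hx) _ _ fun j => ?_
      rw [addPoint]
      refine Fin.cases ?_ (fun j => ?_) j
      · rw [hv0, map_neg, map_mul, map_add, evalAt_param, evalAt_recip, evalAt_const, heval,
          Fin.cons_zero]
        field_simp
      · rw [Fin.cons_succ, homPoint, sum_update_eq, ← hs]
        rcases eq_or_ne j i with rfl | hj
        · rw [hvi, map_mul, evalAt_param, evalAt_recip, heval, Function.update_self]
          field_simp
        · rw [hvj j hj, map_mul, evalAt_const, evalAt_recip, heval, Function.update_of_ne hj]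
          field_simp
  have hβ : HasCycle (simplexLift 0 v hv).toRingHom (-c κ * (t - c (b + b')))
      (if b + b' = 0 then 0 else pointCycle 0 (addPoint i d (b + b'))) := by
    split_ifs with h0
    · refine HasCycle.of_isUnit _ (hβu.mul ?_)
      rwa [h0, map_zero, sub_zero]
    · exact HasCycle.unit_mul hβu (hpt _ h0)
  refine sub_mem_boundaries_of_split (curveRing_not_isField h hh) 0 v hv ?_ _ _ hαβ ?_ ?_ ?_ ?_
    (HasCycle.unit_mul hαu (HasCycle.mul (param_sub_ne_zero h hh b) (hpt b hb) (hpt b' hb'))) hβ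
  · intro j hj
    obtain ⟨j, rfl⟩ := Fin.exists_succ_eq.2 hj
    rcases eq_or_ne j i with rfl | hj
    · rw [hvi]
      exact htu.mul hTu
    · rw [hvj j hj]
      exact (hc (hd j hj)).mul hTu
  · exact mul_ne_zero hαu.ne_zero
      (mul_ne_zero (param_sub_ne_zero h hh _) (param_sub_ne_zero h hh _))
  · exact mul_ne_zero hβu.ne_zero (param_sub_ne_zero h hh _)
  · -- the sum of the two functions is invertible
    obtain ⟨x, hx⟩ := hsT.neg
    refine ⟨↑x⁻¹, ↑x⁻¹, ?_⟩
    rw [← mul_add, ← hαβ, hv0, ← hx]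
    simp
  · intro hw
    set w := splitCoord 0 v (c κ * ((t + c s) * T) * ((t - c b) * (t - c b')))
      (-c κ * (t - c (b + b'))) with hwdef
    have hmem (j) : w j ∈ Algebra.adjoin k (Set.range w) := Algebra.subset_adjoin ⟨j, rfl⟩
    have hcm (a : k) : c a ∈ Algebra.adjoin k (Set.range w) := Subalgebra.algebraMap_mem _ a
    refine simplexLift_finite_of_mem_adjoin h _ hw ?_ ?_
    · have h2 := hmem (Fin.succ 0)
      rw [show w (Fin.succ 0) = _ from splitCoord_succ 0 _ _ _] at h2
      have hκi : c κ * c κ⁻¹ = 1 := by rw [← map_mul, mul_inv_cancel₀ hκ0, map_one]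
      have h3 : t = -c κ⁻¹ * (-c κ * (t - c (b + b'))) + c (b + b') := by
        linear_combination - (t - c (b + b')) * hκi
      rw [show param h = _ from h3]
      exact add_mem (mul_mem (neg_mem (hcm _)) h2) (hcm _)
    · obtain ⟨j, hj⟩ := hn
      have := hmem ((Fin.castSucc 0).succAbove j.succ)
      rw [show w _ = _ from splitCoord_castSucc_succAbove 0 _ _ _ j.succ,
        Function.update_of_ne (Fin.succ_ne_zero j), hvj j hj] at this
      have h2 := Subalgebra.smul_mem _ this (d j)⁻¹
      convert h2 using 1
      rw [Algebra.smul_def, ← mul_assoc, ← map_mul, inv_mul_cancel₀ (hd j hj), map_one, one_mul]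

end AdditiveRelation

/-! ### The action of `kˣ` on cycles -/

section Star

variable {k : Type*} [Field k]

@[simp] lemma starHom_coord (n : ℕ) (x : kˣ) (i : Fin (n + 1)) :
    starHom n x (coord 0 n i) = (x : k)⁻¹ • coord 0 n i :=
  simplexLift_coord _ _ _ i

lemma starHom_comp (n : ℕ) (x y : kˣ) :
    (starHom n x).comp (starHom n y) = starHom n (x * y) := by
  refine simplexRing_algHom_ext 0 fun i => ?_
  rw [AlgHom.comp_apply, starHom_coord, map_smul, starHom_coord, starHom_coord, smul_smul,
    Units.val_mul, mul_inv, mul_comm]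

lemma starHom_one (n : ℕ) : starHom n (1 : kˣ) = AlgHom.id k _ := by
  refine simplexRing_algHom_ext 0 fun i => ?_
  rw [starHom_coord]
  simp

lemma starHom_inv_apply (n : ℕ) (x : kˣ) (r : SimplexRing k 0 n) :
    starHom n x⁻¹ (starHom n x r) = r := by
  rw [← AlgHom.comp_apply, starHom_comp, inv_mul_cancel, starHom_one]
  rfl

lemma starHom_apply_inv (n : ℕ) (x : kˣ) (r : SimplexRing k 0 n) :
    starHom n x (starHom n x⁻¹ r) = r := by
  simpa using starHom_inv_apply n x⁻¹ r

lemma starHom_surjective (n : ℕ) (x : kˣ) : Function.Surjective (starHom n x) :=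
  fun r => ⟨_, starHom_apply_inv n x r⟩

lemma starCycle_single {n : ℕ} (x : kˣ) (P : PrimeSpectrum (SimplexRing k 0 n)) (a : ℤ) :
    starCycle x (Finsupp.single P a) =
      Finsupp.single (PrimeSpectrum.comap (starHom n x).toRingHom P) a := by
  rw [starCycle, Finsupp.lmapDomain_apply, Finsupp.mapDomain_single]

lemma starCycle_starCycle {n : ℕ} (x y : kˣ) (z : AllCycles k 0 n) :
    starCycle x (starCycle y z) = starCycle (y * x) z := by
  induction z using Finsupp.induction_linear with
  | zero => simp
  | add z z' h h' => simp only [map_add, h, h']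
  | single P a =>
    rw [starCycle_single, starCycle_single, starCycle_single]
    refine congrArg (Finsupp.single · a) (PrimeSpectrum.ext (Ideal.ext fun r => ?_))
    change starHom n y (starHom n x r) ∈ P.asIdeal ↔ starHom n (y * x) r ∈ P.asIdeal
    rw [← AlgHom.comp_apply, starHom_comp]

end Star

/-! ### Zero-cycles and the sum of two scalars -/

section ZeroCycles

variable {k : Type*} [Field k] {e : k} {n : ℕ}

lemma IsGood.isMaximal {P : PrimeSpectrum (SimplexRing k e n)} (hP : IsGood e n P) :
    P.asIdeal.IsMaximal := by
  have h0 : (0 : WithBot ℕ∞) ≤ ringKrullDim (SimplexRing k e n ⧸ P.asIdeal) :=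
    ringKrullDim_nonneg_of_nontrivial
  have hle : ringKrullDim (SimplexRing k e n ⧸ P.asIdeal) ≤ 0 := by
    have h := hP.codim
    obtain ⟨d, hd⟩ := WithBot.ne_bot_iff_exists.1 (ne_bot_of_le_ne_bot (by simp) h0)
    rw [← hd] at h ⊢
    have h' : d + (n : ℕ∞) = 0 + (n : ℕ∞) := by
      rw [zero_add]
      exact_mod_cast h
    rw [WithTop.add_right_cancel (ENat.natCast_ne_top n) h']
    rfl
  rw [← Nat.cast_zero, ← Ring.krullDimLE_iff] at hle
  refine Ideal.Quotient.maximal_of_isField _ ?_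
  convert! Ring.KrullDimLE.isField_of_isDomain (R := SimplexRing k e n ⧸ P.asIdeal)

lemma IsGood.coord_notMem {P : PrimeSpectrum (SimplexRing k e n)} (hP : IsGood e n P)
    (i : Fin (n + 1)) : coord e n i ∉ P.asIdeal := by
  intro hi
  have h := hP.proper {i} P le_rfl (by simpa using hi)
  have h0 : (0 : WithBot ℕ∞) ≤ ringKrullDim (SimplexRing k e n ⧸ P.asIdeal) :=
    ringKrullDim_nonneg_of_nontrivial
  have h1 : (0 : WithBot ℕ∞) + n + (({i} : Finset (Fin (n + 1))).card : WithBot ℕ∞) ≤ n :=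
    le_trans (by gcongr) h
  rw [Finset.card_singleton, zero_add] at h1
  have h2 : n + 1 ≤ n := by exact_mod_cast h1
  omega

lemma closedCycles_eq_goodCycles (e : k) (n : ℕ) : closedCycles e n n = goodCycles e n n := by
  cases n with
  | zero => rfl
  | succ n =>
    refine inf_eq_left.2 (Submodule.span_le.2 ?_)
    rintro _ ⟨P, hP, rfl⟩
    rw [SetLike.mem_coe, LinearMap.mem_ker, boundary, LinearMap.sum_apply]
    refine Finset.sum_eq_zero fun j _ => ?_
    have hmax := hP.isMaximal
    have htop : P.asIdeal.map (face e n j) = ⊤ := by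
      by_contra hne
      have hle : P.asIdeal ≤ (P.asIdeal.map (face e n j)).comap (face e n j) := Ideal.le_comap_map
      have heq := hmax.eq_of_le (Ideal.comap_ne_top _ hne) hle
      refine hP.coord_notMem j ?_
      rw [heq, Ideal.mem_comap, face_coord_self]
      exact Ideal.zero_mem _
    simp [faceRestriction, htop, fundamentalCycle_top]

open scoped Classical in
/-- The action of `kˣ` on closed points is additive: on the curve of the points `1 / t ⋆ u`, where
`u` is a closed point with residue field `L`, the first coordinate is split into functions with
divisors `[1 / x] + [1 / y]` and `[1 / (x + y)]`. -/
lemma starCycle_ker_add_mem_boundaries {L : Type*} [Field L] [Algebra k L] [Module.Finite k L]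
    {m : ℕ} (g : SimplexRing k 0 (m + 1) →ₐ[k] L) (hg : Function.Surjective g)
    (hu0 : ∀ j, g (coord 0 (m + 1) j) ≠ 0) (P : PrimeSpectrum (SimplexRing k 0 (m + 1)))
    (hP : P.asIdeal = RingHom.ker g) (x y : kˣ) :
    (starCycle x (Finsupp.single P 1) + starCycle y (Finsupp.single P 1)) -
      (if h : (x : k) + y = 0 then 0 else starCycle (Units.mk0 _ h) (Finsupp.single P 1)) ∈
        boundaries (0 : k) (m + 1) (m + 1) := by
  let u : Fin (m + 2) → L := fun j => g (coord 0 (m + 1) j)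
  have hu : ∑ j, u j = 0 := by
    have h := congrArg g (sum_coord (0 : k) (m + 1))
    refine (map_sum g _ _).symm.trans (h.trans ?_)
    exact (congrArg g (map_zero (algebraMap k _))).trans (map_zero g)
  have hh : (Polynomial.X : Polynomial L) ≠ 0 := Polynomial.X_ne_zero
  set h : Polynomial L := Polynomial.X with hdef
  have := curveRing_isDomain h hh
  have := curveRing_dimensionLEOne h hh
  let c : L →+* CurveRing h := algebraMap L (CurveRing h)
  have hc {a : L} (ha : a ≠ 0) : IsUnit (c a) := isUnit_const h ha
  have htT : param h * recip h = 1 := algebraMap_mul_recip h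
  set t := param h with ht
  set T := recip h with hT
  have htu : IsUnit t := IsUnit.of_mul_eq_one _ htT
  have hTu : IsUnit T := isUnit_recip h
  let v : Fin (m + 2) → CurveRing h := fun j => t * c (u j)
  have hv : ∑ j, v j = algebraMap k (CurveRing h) 0 := by
    simp only [v]
    rw [← Finset.mul_sum, ← map_sum, hu, map_zero, map_zero, mul_zero]
  let p : kˣ → L := fun x => algebraMap k L (x : k)⁻¹
  have hp0 (x : kˣ) : p x ≠ 0 := by simp [p]
  have hαu : IsUnit (c (u 0) * T) := (hc (hu0 0)).mul hTu
  have hαβ : v 0 = c (u 0) * T * ((t - c (p x)) * (t - c (p y))) +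
      c (u 0) * (c (p x + p y) - c (p x * p y) * T) := by
    simp only [v, map_add, map_mul]
    linear_combination - c (u 0) * (t - c (p x) - c (p y)) * htT
  have hpt (x : kˣ) : HasCycle (simplexLift 0 v hv).toRingHom (t - c (p x))
      (starCycle x (Finsupp.single P 1)) := by
    rw [starCycle_single]
    have := hasCycle_param_sub h v hv (p x) (by simpa [hdef] using hp0 x) (g.comp (starHom _ x))
      (hg.comp (starHom_surjective _ x)) (fun j => by
        rw [AlgHom.comp_apply, starHom_coord, map_smul, map_mul, evalAt_param, evalAt_const,
          Algebra.smul_def])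
    convert this using 2
    refine PrimeSpectrum.ext ?_
    change P.asIdeal.comap _ = _
    rw [hP]
    rfl
  have hsum : p x + p y = p x * p y * algebraMap k L (x + y) := by
    simp only [p, map_add, map_inv₀]
    have hx : algebraMap k L x ≠ 0 := by simp
    have hy : algebraMap k L y ≠ 0 := by simp
    field_simp
    ring
  have hβ : HasCycle (simplexLift 0 v hv).toRingHom
      (c (u 0) * (c (p x + p y) - c (p x * p y) * T))
      (if h : (x : k) + y = 0 then 0 else starCycle (Units.mk0 _ h) (Finsupp.single P 1)) := by
    split_ifs with h0
    · refine HasCycle.of_isUnit _ ((hc (hu0 0)).mul ?_)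
      rw [hsum, h0, map_zero, mul_zero, map_zero, zero_sub]
      exact ((hc (mul_ne_zero (hp0 x) (hp0 y))).mul hTu).neg
    · have h1 : c (u 0) * (c (p x + p y) - c (p x * p y) * T) =
          c (u 0) * c (p x * p y) * c (algebraMap k L (x + y)) * T *
            (t - c (p (Units.mk0 _ h0))) := by
        have h2 : c (algebraMap k L (x + y)) * c (p (Units.mk0 _ h0)) = 1 := by
          rw [← map_mul, ← map_mul, Units.val_mk0, mul_inv_cancel₀ h0, map_one, map_one]
        rw [hsum, map_mul]
        linear_combination c (u 0) * c (p x * p y) * T * h2 -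
          c (u 0) * c (p x * p y) * c (algebraMap k L (x + y)) * htT
      rw [h1]
      refine HasCycle.unit_mul ?_ (hpt _)
      exact ((((hc (hu0 0)).mul (hc (mul_ne_zero (hp0 x) (hp0 y)))).mul (hc
        ((map_ne_zero (algebraMap k L)).2 h0))).mul hTu)
  have hβ0 : c (u 0) * (c (p x + p y) - c (p x * p y) * T) ≠ 0 := by
    refine mul_ne_zero (hc (hu0 0)).ne_zero fun h0 => ?_
    have h1 : t * c (p x + p y) = c (p x * p y) := by
      linear_combination t * h0 + c (p x * p y) * htT
    by_cases hpq : p x + p y = 0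
    · rw [hpq, map_zero, mul_zero] at h1
      exact (hc (mul_ne_zero (hp0 x) (hp0 y))).ne_zero h1.symm
    · refine param_sub_ne_zero h hh (p x * p y / (p x + p y)) ?_
      refine (hc hpq).mul_right_cancel ?_
      rw [zero_mul, sub_mul, ← map_mul, div_mul_cancel₀ _ hpq]
      exact sub_eq_zero.2 h1
  refine sub_mem_boundaries_of_split (curveRing_not_isField h hh) 0 v hv
    (fun j _ => htu.mul (hc (hu0 j))) _ _ hαβ (mul_ne_zero hαu.ne_zero
      (mul_ne_zero (param_sub_ne_zero h hh _) (param_sub_ne_zero h hh _))) hβ0 ?_ ?_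
    (HasCycle.unit_mul hαu (HasCycle.mul (param_sub_ne_zero h hh _) (hpt x) (hpt y))) hβ
  · -- the sum of the two functions is invertible
    obtain ⟨z, hz⟩ := htu.mul (hc (hu0 0))
    refine ⟨↑z⁻¹, ↑z⁻¹, ?_⟩
    rw [← mul_add, ← hαβ]
    change _ * (t * c (u 0)) = 1
    rw [← hz]
    simp
  · intro hw
    -- the residue field `L` is algebraic over `k`, so the parametrization is an integral map
    set w := splitCoord 0 v (c (u 0) * T * ((t - c (p x)) * (t - c (p y))))
      (c (u 0) * (c (p x + p y) - c (p x * p y) * T)) with hwdef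
    set φ := simplexLift 0 w hw with hφ
    have hφc (j) : φ (coord 0 (m + 2) j) = w j := simplexLift_coord 0 w hw j
    let _ : Algebra (SimplexRing k 0 (m + 2)) (CurveRing h) := φ.toRingHom.toAlgebra
    have htow : IsScalarTower k (SimplexRing k 0 (m + 2)) (CurveRing h) :=
      IsScalarTower.of_algebraMap_eq' φ.comp_algebraMap.symm
    let S := (integralClosure (SimplexRing k 0 (m + 2)) (CurveRing h)).toSubring
    have hw (j) : w j ∈ S := by
      rw [← hφc]
      exact isIntegral_algebraMap (R := SimplexRing k 0 (m + 2)) (A := CurveRing h)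
    have hcS (a : L) : c a ∈ S := by
      have h1 : IsIntegral k (c a) := (Algebra.IsIntegral.isIntegral (R := k) a).map
        (IsScalarTower.toAlgHom k L (CurveRing h))
      exact h1.tower_top
    have hci {a : L} (ha : a ≠ 0) : c a⁻¹ * c a = 1 := by
      rw [← map_mul, inv_mul_cancel₀ ha, map_one]
    have htS : t ∈ S := by
      have h1 := hw ((Fin.castSucc 0).succAbove 1)
      rw [show w _ = _ from splitCoord_castSucc_succAbove 0 _ _ _ 1,
        Function.update_of_ne (by simp)] at h1
      have h2 := S.mul_mem (hcS (u 1)⁻¹) h1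
      convert h2 using 1
      simp only [v]
      linear_combination - t * hci (hu0 1)
    have hTS : T ∈ S := by
      have h1 := hw (Fin.succ 0)
      rw [show w _ = _ from splitCoord_succ 0 _ _ _] at h1
      have h2 := S.mul_mem (hcS (p x * p y)⁻¹) (S.sub_mem (hcS (p x + p y))
        (S.mul_mem (hcS (u 0)⁻¹) h1))
      convert h2 using 1
      linear_combination -T * hci (mul_ne_zero (hp0 x) (hp0 y)) + c (p x * p y)⁻¹ *
        (c (p x + p y) - c (p x * p y) * T) * hci (hu0 0)
    have hS := curveRing_subring_eq_top h S hcS htS hTS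
    refine RingHom.IsIntegral.to_finite (fun z => ?_) ?_
    · have hz : z ∈ S := hS ▸ Subring.mem_top z
      exact hz
    · have h1 : Algebra.FiniteType k (CurveRing h) := by
        have h2 : Algebra.FiniteType L (Polynomial L) := inferInstance
        have h3 : Algebra.FiniteType (Polynomial L) (CurveRing h) :=
          IsLocalization.finiteType_of_monoid_fg (Submonoid.powers h) _
        have h4 : Algebra.FiniteType L (CurveRing h) := h2.trans h3
        have h5 : Algebra.FiniteType k L := inferInstance
        exact h5.trans h4
      exact Algebra.FiniteType.of_restrictScalars_finiteType k (SimplexRing k 0 (m + 2)) (CurveRing h)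

open scoped Classical in
lemma starCycle_add_mem_boundaries {m : ℕ} {P : PrimeSpectrum (SimplexRing k 0 (m + 1))}
    (hP : IsGood 0 (m + 1) P) (x y : kˣ) :
    (starCycle x (Finsupp.single P 1) + starCycle y (Finsupp.single P 1)) -
      (if h : (x : k) + y = 0 then 0 else starCycle (Units.mk0 _ h) (Finsupp.single P 1)) ∈
        boundaries (0 : k) (m + 1) (m + 1) := by
  have hmax := hP.isMaximal
  have hsurj := P.asIdeal.algebraMap_residueField_surjective
  have hft : Algebra.FiniteType k P.asIdeal.ResidueField :=
    Algebra.FiniteType.of_surjective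
      (IsScalarTower.toAlgHom k (SimplexRing k 0 (m + 1)) P.asIdeal.ResidueField) hsurj
  have hfin : Module.Finite k P.asIdeal.ResidueField :=
    finite_of_finite_type_of_isJacobsonRing k P.asIdeal.ResidueField
  refine starCycle_ker_add_mem_boundaries (L := P.asIdeal.ResidueField)
    (IsScalarTower.toAlgHom k (SimplexRing k 0 (m + 1)) P.asIdeal.ResidueField)
    hsurj ?_ P ?_ x y
  · intro j hj
    exact hP.coord_notMem j (Ideal.algebraMap_residueField_eq_zero.1 hj)
  · ext r
    exact Ideal.algebraMap_residueField_eq_zero.symm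

end ZeroCycles

/-! ### Functoriality for closed embeddings compatible with the faces -/

section ClosedEmbedding

variable {R S : Type*} [CommRing R] [CommRing S]

lemma ringKrullDim_quotient_comap (f : R →+* S) (hf : Function.Surjective f) (J : Ideal S) :
    ringKrullDim (R ⧸ J.comap f) = ringKrullDim (S ⧸ J) :=
  ringKrullDim_eq_of_ringEquiv (RingEquiv.ofBijective (Ideal.quotientMap J f le_rfl)
    ⟨Ideal.quotientMap_injective, Ideal.quotientMap_surjective hf⟩)

lemma exists_comap_eq_of_comap_le (f : R →+* S) (hf : Function.Surjective f) (J : Ideal S)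
    (q : PrimeSpectrum R) (hq : J.comap f ≤ q.asIdeal) :
    ∃ q' : PrimeSpectrum S, J ≤ q'.asIdeal ∧ PrimeSpectrum.comap f q' = q := by
  have hmem : q ∈ Set.range (PrimeSpectrum.comap f) := by
    rw [range_comap_of_surjective _ f hf, PrimeSpectrum.mem_zeroLocus]
    exact fun r hr => hq (Ideal.ker_le_comap f hr)
  obtain ⟨q', rfl⟩ := hmem
  refine ⟨q', fun s hs => ?_, rfl⟩
  obtain ⟨r, rfl⟩ := hf s
  exact hq hs

/-- Pulling back to a closed subscheme commutes with the push-forward along a closed embedding,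
for a cartesian square. -/
lemma map_comap_eq_comap_map {R' S' : Type*} [CommRing R'] [CommRing S'] {f : R →+* S}
    {f' : R' →+* S'} {σ : R →+* R'} {σ' : S →+* S'} (hf : Function.Surjective f)
    (hσ' : Function.Surjective σ') (hcomm : f'.comp σ = σ'.comp f)
    (hker : RingHom.ker f' ≤ (RingHom.ker f).map σ) (J : Ideal S) :
    (J.comap f).map σ = (J.map σ').comap f' := by
  refine le_antisymm ?_ fun x hx => ?_
  · rw [Ideal.map_le_iff_le_comap, Ideal.comap_comap, hcomm, ← Ideal.comap_comap]
    exact Ideal.comap_mono Ideal.le_comap_map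
  · obtain ⟨s, hs, hsx⟩ := (Ideal.mem_map_iff_of_surjective σ' hσ').1 hx
    obtain ⟨r, rfl⟩ := hf s
    have h1 : x - σ r ∈ (J.comap f).map σ := by
      refine Ideal.map_mono (Ideal.ker_le_comap f) (hker ?_)
      rw [RingHom.mem_ker, map_sub, ← hsx, ← RingHom.comp_apply, ← RingHom.comp_apply, hcomm,
        sub_self]
    have h2 := Ideal.add_mem _ h1 (Ideal.mem_map_of_mem σ (show r ∈ J.comap f from hs))
    rwa [sub_add_cancel] at h2

variable {k : Type*} [Field k] {e e' : k} {n n' : ℕ}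

lemma faceRestriction_single (j : Fin (n + 2)) (P : PrimeSpectrum (SimplexRing k e (n + 1)))
    (a : ℤ) : faceRestriction e n j (Finsupp.single P a) =
      a • fundamentalCycle (P.asIdeal.map (face e n j)) := by
  rw [faceRestriction, Finsupp.linearCombination_single]

lemma faceRestriction_mapDomain {f : SimplexRing k e (n + 1) →ₐ[k] SimplexRing k e' (n' + 1)}
    {f' : SimplexRing k e n →ₐ[k] SimplexRing k e' n'} (hf : Function.Surjective f)
    (hf' : Function.Surjective f') {j : Fin (n + 2)} {j' : Fin (n' + 2)}
    (hcomm : f'.comp (face e n j) = (face e' n' j').comp f)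
    (hker : RingHom.ker f' ≤ (RingHom.ker f).map (face e n j)) (z : AllCycles k e' (n' + 1)) :
    faceRestriction e n j (Finsupp.lmapDomain ℤ ℤ (PrimeSpectrum.comap f.toRingHom) z) =
      Finsupp.lmapDomain ℤ ℤ (PrimeSpectrum.comap f'.toRingHom) (faceRestriction e' n' j' z) := by
  induction z using Finsupp.induction_linear with
  | zero => simp only [map_zero]
  | add z z' h h' => simp only [map_add, h, h']
  | single P a =>
    rw [Finsupp.lmapDomain_apply, Finsupp.mapDomain_single, faceRestriction_single,
      faceRestriction_single, map_smul, Finsupp.lmapDomain_apply,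
      ← fundamentalCycle_comap f'.toRingHom hf']
    refine congrArg (fun J => a • fundamentalCycle J) ?_
    exact map_comap_eq_comap_map (f := f.toRingHom) (f' := f'.toRingHom)
      (σ := (face e n j).toRingHom) (σ' := (face e' n' j').toRingHom) hf (face_surjective e' n' j')
      (congrArg AlgHom.toRingHom hcomm) hker P.asIdeal

end ClosedEmbedding

/-! ### The action of `kˣ` on the complex -/

section StarHomology

variable {k : Type*} [Field k] {p n : ℕ}

lemma starHom_coord_mem_iff (x : kˣ) (i : Fin (n + 1)) (J : Ideal (SimplexRing k 0 n)) :
    starHom n x (coord 0 n i) ∈ J ↔ coord 0 n i ∈ J := by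
  rw [starHom_coord]
  refine ⟨fun h => ?_, fun h => Submodule.smul_of_tower_mem J _ h⟩
  have := Submodule.smul_of_tower_mem J (x : k) h
  rwa [smul_smul, mul_inv_cancel₀ x.ne_zero, one_smul] at this

lemma IsGood.star {P : PrimeSpectrum (SimplexRing k 0 n)} (hP : IsGood 0 p P) (x : kˣ) :
    IsGood 0 p (PrimeSpectrum.comap (starHom n x).toRingHom P) where
  codim := by
    refine Eq.trans ?_ hP.codim
    congr 1
    exact ringKrullDim_quotient_comap (starHom n x).toRingHom (starHom_surjective n x) P.asIdeal
  vertex := by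
    rintro ⟨q, hq, hi⟩
    obtain ⟨q', hq', rfl⟩ := exists_comap_eq_of_comap_le _ (starHom_surjective n x) _ q hq
    exact hP.vertex ⟨q', hq', fun i => (starHom_coord_mem_iff x i _).1 (hi i)⟩
  proper := by
    intro I q hq hi
    obtain ⟨q', hq', rfl⟩ := exists_comap_eq_of_comap_le _ (starHom_surjective n x) _ q hq
    refine le_of_eq_of_le ?_ (hP.proper I q' hq' fun i hiI =>
      (starHom_coord_mem_iff x i _).1 (hi i hiI))
    congr 2
    exact ringKrullDim_quotient_comap (starHom n x).toRingHom (starHom_surjective n x) q'.asIdeal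

lemma starCycle_mem_goodCycles (x : kˣ) {z : AllCycles k 0 n} (hz : z ∈ goodCycles 0 p n) :
    starCycle x z ∈ goodCycles 0 p n := by
  induction hz using Submodule.span_induction with
  | mem z hz =>
    obtain ⟨P, hP, rfl⟩ := hz
    rw [starCycle_single]
    exact Submodule.subset_span ⟨_, hP.star x, rfl⟩
  | zero => simp only [map_zero, Submodule.zero_mem]
  | add z z' _ _ h h' => rw [map_add]; exact Submodule.add_mem _ h h'
  | smul a z _ h => rw [map_smul]; exact Submodule.smul_mem _ a h

lemma boundary_starCycle (x : kˣ) (z : AllCycles k 0 (n + 1)) :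
    boundary 0 n (starCycle x z) = starCycle x (boundary 0 n z) := by
  rw [boundary, LinearMap.sum_apply, LinearMap.sum_apply, map_sum]
  refine Finset.sum_congr rfl fun j _ => ?_
  rw [LinearMap.smul_apply, LinearMap.smul_apply, map_smul]
  congr 1
  refine faceRestriction_mapDomain (starHom_surjective _ x) (starHom_surjective _ x) ?_ ?_ z
  · refine simplexRing_algHom_ext 0 fun i => ?_
    rw [AlgHom.comp_apply, AlgHom.comp_apply, starHom_coord, map_smul]
    refine Fin.succAboveCases j ?_ (fun i => ?_) i
    · rw [face_coord_self, map_zero, smul_zero]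
    · rw [face_coord_succAbove, starHom_coord]
  · intro r hr
    have : r = 0 := by
      rw [← starHom_inv_apply n x r, RingHom.mem_ker.1 hr, map_zero]
    rw [this]
    exact Ideal.zero_mem _

lemma starCycle_mem_closedCycles (x : kˣ) {z : AllCycles k 0 n} (hz : z ∈ closedCycles 0 p n) :
    starCycle x z ∈ closedCycles 0 p n := by
  cases n with
  | zero => exact starCycle_mem_goodCycles x hz
  | succ n =>
    refine ⟨starCycle_mem_goodCycles x hz.1, ?_⟩
    rw [SetLike.mem_coe, LinearMap.mem_ker, boundary_starCycle, LinearMap.mem_ker.1 hz.2, map_zero]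

lemma starCycle_mem_boundaries (x : kˣ) {z : AllCycles k 0 n} (hz : z ∈ boundaries 0 p n) :
    starCycle x z ∈ boundaries 0 p n := by
  obtain ⟨w, hw, rfl⟩ := hz
  exact ⟨starCycle x w, starCycle_mem_goodCycles x hw, boundary_starCycle x w⟩

end StarHomology

/-! ### The embedding of `Δⁿ` into `Qⁿ⁺¹` -/

section Iota

variable {k : Type*} [Field k] {p n : ℕ}

@[simp] lemma iotaHom_coord_zero (n : ℕ) : iotaHom (k := k) n (coord 0 (n + 1) 0) = -1 :=
  simplexLift_coord _ _ _ 0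

@[simp] lemma iotaHom_coord_succ (n : ℕ) (i : Fin (n + 1)) :
    iotaHom (k := k) n (coord 0 (n + 1) i.succ) = coord 1 n i :=
  simplexLift_coord _ _ _ i.succ

lemma iotaHom_surjective (n : ℕ) : Function.Surjective (iotaHom (k := k) n) := by
  let s : MvPolynomial (Fin (n + 1)) k →ₐ[k] SimplexRing k 0 (n + 1) :=
    MvPolynomial.aeval fun i => coord 0 (n + 1) i.succ
  have h : (iotaHom n).comp s = Ideal.Quotient.mkₐ k _ := by
    refine MvPolynomial.algHom_ext fun i => ?_
    simp only [s, AlgHom.comp_apply, MvPolynomial.aeval_X, iotaHom_coord_succ]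
    rfl
  intro y
  obtain ⟨x, rfl⟩ := Ideal.Quotient.mk_surjective y
  exact ⟨s x, DFunLike.congr_fun h x⟩

/-- The image of `Δⁿ` in `Qⁿ⁺¹` is cut out by the equation `t₀ = -1`. -/
lemma ker_iotaHom (n : ℕ) : RingHom.ker (iotaHom (k := k) n) =
    Ideal.span {coord (0 : k) (n + 1) 0 + 1} := by
  set J : Ideal (SimplexRing k 0 (n + 1)) := Ideal.span {coord (0 : k) (n + 1) 0 + 1} with hJ
  have h0 : Ideal.Quotient.mk J (coord 0 (n + 1) 0 + 1) = 0 :=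
    Ideal.Quotient.eq_zero_iff_mem.2 (Ideal.mem_span_singleton_self _)
  apply le_antisymm
  · let s : SimplexRing k 1 n →ₐ[k] SimplexRing k 0 (n + 1) ⧸ J :=
      simplexLift 1 (fun i => Ideal.Quotient.mk J (coord 0 (n + 1) i.succ)) (by
        have h := (Fin.sum_univ_succ (coord (0 : k) (n + 1))).symm.trans (sum_coord 0 (n + 1))
        have h' := congrArg (Ideal.Quotient.mk J) h
        rw [map_add, map_sum] at h'
        rw [map_add] at h0
        simp only [map_zero, map_one] at h' h0
        refine Eq.trans ?_ (map_one (algebraMap k _)).symm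
        exact add_left_cancel (h'.trans h0.symm))
    have hs : s.comp (iotaHom n) = Ideal.Quotient.mkₐ k J := by
      refine simplexRing_algHom_ext (A := SimplexRing k 0 (n + 1) ⧸ J) 0 fun i => ?_
      rw [AlgHom.comp_apply]
      refine Fin.cases ?_ (fun i => ?_) i
      · rw [iotaHom_coord_zero]
        rw [map_add] at h0
        simp only [map_neg, map_one] at h0 ⊢
        exact (eq_neg_of_add_eq_zero_left h0).symm
      · rw [iotaHom_coord_succ]
        exact simplexLift_coord 1 _ _ i
    intro x hx
    rw [← Ideal.Quotient.eq_zero_iff_mem]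
    have h2 := DFunLike.congr_fun hs x
    rw [AlgHom.comp_apply, show iotaHom n x = 0 from hx] at h2
    simp only [map_zero] at h2
    exact h2.symm
  · rw [hJ, Ideal.span_singleton_le_iff_mem, RingHom.mem_ker]
    simp

lemma IsGood.iota {P : PrimeSpectrum (SimplexRing k 1 n)} (hP : IsGood 1 p P) :
    IsGood 0 (p + 1) (PrimeSpectrum.comap (iotaHom n).toRingHom P) where
  codim := by
    have h := hP.codim
    rw [← ringKrullDim_quotient_comap (iotaHom n).toRingHom (iotaHom_surjective n)] at h
    push_cast
    rw [← add_assoc, ← h]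
    rfl
  vertex := by
    rintro ⟨q, hq, hi⟩
    obtain ⟨q', hq', rfl⟩ := exists_comap_eq_of_comap_le _ (iotaHom_surjective n) _ q hq
    have h0 : iotaHom n (coord 0 (n + 1) 0) ∈ q'.asIdeal := hi 0
    rw [iotaHom_coord_zero, neg_mem_iff] at h0
    exact q'.isPrime.ne_top ((Ideal.eq_top_iff_one _).2 h0)
  proper := by
    intro I q hq hi
    obtain ⟨q', hq', rfl⟩ := exists_comap_eq_of_comap_le _ (iotaHom_surjective n) _ q hq
    have h0 : (0 : Fin (n + 2)) ∉ I := by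
      intro h0
      have h0 : iotaHom n (coord 0 (n + 1) 0) ∈ q'.asIdeal := hi 0 h0
      rw [iotaHom_coord_zero, neg_mem_iff] at h0
      exact q'.isPrime.ne_top ((Ideal.eq_top_iff_one _).2 h0)
    obtain ⟨I, rfl⟩ : ∃ I' : Finset (Fin (n + 1)), I = I'.map (Fin.succEmb (n + 1)) := by
      classical
      refine ⟨Finset.univ.filter fun i => i.succ ∈ I, ?_⟩
      ext i
      refine Fin.cases (by simpa using h0) (fun i => by simp) i
    have h := hP.proper I q' hq' fun i hiI => by
      have h1 : iotaHom n (coord 0 (n + 1) i.succ) ∈ q'.asIdeal :=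
        hi i.succ (Finset.mem_map_of_mem _ hiI)
      rwa [iotaHom_coord_succ] at h1
    rw [← ringKrullDim_quotient_comap (iotaHom n).toRingHom (iotaHom_surjective n)] at h
    rw [Finset.card_map]
    push_cast
    rw [← add_assoc, add_right_comm _ (1 : WithBot ℕ∞)]
    exact add_le_add_left h 1

lemma iotaCycle_single (P : PrimeSpectrum (SimplexRing k 1 n)) (a : ℤ) :
    iotaCycle n (Finsupp.single P a) =
      Finsupp.single (PrimeSpectrum.comap (iotaHom n).toRingHom P) a := by
  rw [iotaCycle, Finsupp.lmapDomain_apply, Finsupp.mapDomain_single]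

lemma iotaCycle_mem_goodCycles {z : AllCycles k 1 n} (hz : z ∈ goodCycles 1 p n) :
    iotaCycle n z ∈ goodCycles 0 (p + 1) (n + 1) := by
  induction hz using Submodule.span_induction with
  | mem z hz =>
    obtain ⟨P, hP, rfl⟩ := hz
    rw [iotaCycle_single]
    exact Submodule.subset_span ⟨_, hP.iota, rfl⟩
  | zero => simp only [map_zero, Submodule.zero_mem]
  | add z z' _ _ h h' => rw [map_add]; exact Submodule.add_mem _ h h'
  | smul a z _ h => rw [map_smul]; exact Submodule.smul_mem _ a h

lemma faceRestriction_zero_iotaCycle (z : AllCycles k 1 n) :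
    faceRestriction 0 n 0 (iotaCycle n z) = 0 := by
  induction z using Finsupp.induction_linear with
  | zero => simp only [map_zero]
  | add z z' h h' => simp only [map_add, h, h', add_zero]
  | single P a =>
    rw [iotaCycle_single, faceRestriction_single]
    have htop : (PrimeSpectrum.comap (iotaHom n).toRingHom P).asIdeal.map (face 0 n 0) = ⊤ := by
      rw [Ideal.eq_top_iff_one]
      have h1 : coord 0 (n + 1) 0 + 1 ∈
          (PrimeSpectrum.comap (iotaHom (k := k) n).toRingHom P).asIdeal := by
        change iotaHom n (coord 0 (n + 1) 0 + 1) ∈ P.asIdeal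
        have h0 : iotaHom (k := k) n (coord 0 (n + 1) 0 + 1) = 0 := by simp
        simp only [h0, Ideal.zero_mem]
      have h2 := Ideal.mem_map_of_mem (face 0 n 0) h1
      have h3 : face (0 : k) n 0 (coord 0 (n + 1) 0 + 1) = 1 := by simp
      rwa [h3] at h2
    rw [htop, fundamentalCycle_top, smul_zero]

lemma faceRestriction_succ_iotaCycle (j : Fin (n + 2)) (z : AllCycles k 1 (n + 1)) :
    faceRestriction 0 (n + 1) j.succ (iotaCycle (n + 1) z) =
      iotaCycle n (faceRestriction 1 n j z) := by
  have hface0 : face (0 : k) (n + 1) j.succ (coord 0 (n + 2) 0) = coord 0 (n + 1) 0 := by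
    have := face_coord_succAbove (0 : k) (n + 1) j.succ 0
    rwa [Fin.succ_succAbove_zero] at this
  refine faceRestriction_mapDomain (iotaHom_surjective _) (iotaHom_surjective _) ?_ ?_ z
  · refine simplexRing_algHom_ext 0 fun i => ?_
    rw [AlgHom.comp_apply, AlgHom.comp_apply]
    refine Fin.cases ?_ (fun i => ?_) i
    · rw [hface0, iotaHom_coord_zero, iotaHom_coord_zero]
      simp
    · rw [iotaHom_coord_succ]
      refine Fin.succAboveCases j ?_ (fun i => ?_) i
      · rw [face_coord_self, face_coord_self, map_zero]
      · rw [face_coord_succAbove, ← Fin.succ_succAbove_succ, face_coord_succAbove,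
          iotaHom_coord_succ]
  · rw [ker_iotaHom, ker_iotaHom, Ideal.map_span, Set.image_singleton]
    refine le_of_eq (congrArg (fun a => Ideal.span {a}) ?_)
    exact ((map_add _ _ _).trans (congrArg₂ (· + ·) hface0 (map_one _))).symm

lemma boundary_iotaCycle (z : AllCycles k 1 (n + 1)) :
    boundary 0 (n + 1) (iotaCycle (n + 1) z) = - iotaCycle n (boundary 1 n z) := by
  rw [boundary, LinearMap.sum_apply, boundary, LinearMap.sum_apply, map_sum, Fin.sum_univ_succ,
    ← Finset.sum_neg_distrib]
  rw [LinearMap.smul_apply, faceRestriction_zero_iotaCycle, smul_zero, zero_add]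
  refine Finset.sum_congr rfl fun j _ => ?_
  rw [LinearMap.smul_apply, LinearMap.smul_apply, map_smul, faceRestriction_succ_iotaCycle,
    Fin.val_succ, pow_succ, mul_neg_one, neg_smul]

lemma iotaCycle_mem_boundaries {z : AllCycles k 1 n} (hz : z ∈ boundaries 1 p n) :
    iotaCycle n z ∈ boundaries 0 (p + 1) (n + 1) := by
  obtain ⟨w, hw, rfl⟩ := hz
  refine ⟨- iotaCycle (n + 1) w, Submodule.neg_mem _ (iotaCycle_mem_goodCycles hw), ?_⟩
  rw [map_neg, boundary_iotaCycle, neg_neg]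

lemma iotaCycle_mem_closedCycles {z : AllCycles k 1 n} (hz : z ∈ closedCycles 1 n n) :
    iotaCycle n z ∈ closedCycles 0 (n + 1) (n + 1) := by
  rw [closedCycles_eq_goodCycles] at hz ⊢
  exact iotaCycle_mem_goodCycles hz

end Iota

/-! ### Maps between homology groups -/

section Homology

variable {k : Type*} [Field k] {e e' : k} {p n p' n' : ℕ}

lemma exists_chowClass (ξ : ChowHomology e p n) : ∃ z hz, chowClass e (p := p) z hz = ξ := by
  obtain ⟨⟨z, hz⟩, rfl⟩ := Submodule.Quotient.mk_surjective _ ξ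
  exact ⟨z, hz, rfl⟩

lemma chowClass_eq_iff {z z' : AllCycles k e n} (hz : z ∈ closedCycles e p n)
    (hz' : z' ∈ closedCycles e p n) :
    chowClass e z hz = chowClass e z' hz' ↔ z - z' ∈ boundaries e p n :=
  Submodule.Quotient.eq _

lemma chowClass_eq_zero_iff {z : AllCycles k e n} (hz : z ∈ closedCycles e p n) :
    chowClass e z hz = 0 ↔ z ∈ boundaries e p n :=
  Submodule.Quotient.mk_eq_zero _

lemma chowClass_add {z z' : AllCycles k e n} (hz : z ∈ closedCycles e p n)
    (hz' : z' ∈ closedCycles e p n) :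
    chowClass e z hz + chowClass e z' hz' = chowClass e (z + z') (Submodule.add_mem _ hz hz') :=
  rfl

/-- A map of cycles that preserves closed cycles and boundaries induces a map on homology. -/
def homologyMap (f : AllCycles k e n →ₗ[ℤ] AllCycles k e' n')
    (hf : ∀ z ∈ closedCycles e p n, f z ∈ closedCycles e' p' n')
    (hf' : ∀ z ∈ boundaries e p n, f z ∈ boundaries e' p' n') :
    ChowHomology e p n →+ ChowHomology e' p' n' :=
  (Submodule.mapQ ((boundaries e p n).submoduleOf (closedCycles e p n))
    ((boundaries e' p' n').submoduleOf (closedCycles e' p' n')) (f.restrict hf)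
    fun z hz => hf' z hz).toAddMonoidHom

lemma homologyMap_chowClass (f : AllCycles k e n →ₗ[ℤ] AllCycles k e' n')
    (hf : ∀ z ∈ closedCycles e p n, f z ∈ closedCycles e' p' n')
    (hf' : ∀ z ∈ boundaries e p n, f z ∈ boundaries e' p' n') (z : AllCycles k e n)
    (hz : z ∈ closedCycles e p n) :
    homologyMap f hf hf' (chowClass e z hz) = chowClass e' (f z) (hf z hz) :=
  rfl

end Homology

/-! ### The vector space structure on `SHᵐ⁺¹(k, m + 1)` -/

section VectorSpace

variable {k : Type*} [Field k] {m : ℕ}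

/-- The action of `x ∈ kˣ` on additive Chow groups. -/
def starMap (p n : ℕ) (x : kˣ) : SH k p n →+ SH k p n :=
  homologyMap (starCycle x) (fun _ => starCycle_mem_closedCycles x)
    fun _ => starCycle_mem_boundaries x

lemma starMap_mul (p n : ℕ) (x y : kˣ) (ξ : SH k p n) :
    starMap p n (x * y) ξ = starMap p n x (starMap p n y ξ) := by
  obtain ⟨z, hz, rfl⟩ := exists_chowClass ξ
  rw [starMap, starMap, starMap, homologyMap_chowClass, homologyMap_chowClass,
    homologyMap_chowClass]
  congr 1
  rw [starCycle_starCycle, mul_comm]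

lemma starMap_one (p n : ℕ) (ξ : SH k p n) : starMap p n 1 ξ = ξ := by
  obtain ⟨z, hz, rfl⟩ := exists_chowClass ξ
  rw [starMap, homologyMap_chowClass]
  congr 1
  rw [starCycle, starHom_one]
  exact Finsupp.mapDomain_id

open scoped Classical in
lemma starMap_add (x y : kˣ) (ξ : SH k (m + 1) (m + 1)) :
    starMap _ _ x ξ + starMap _ _ y ξ =
      if h : (x : k) + y = 0 then 0 else starMap _ _ (Units.mk0 _ h) ξ := by
  obtain ⟨z, hz, rfl⟩ := exists_chowClass ξ
  have hz' := hz
  rw [closedCycles_eq_goodCycles] at hz'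
  let f : AllCycles k 0 (m + 1) →ₗ[ℤ] AllCycles k 0 (m + 1) := (starCycle x + starCycle y) -
    if h : (x : k) + y = 0 then 0 else starCycle (Units.mk0 _ h)
  have hle : goodCycles (0 : k) (m + 1) (m + 1) ≤ (boundaries 0 (m + 1) (m + 1)).comap f := by
    refine Submodule.span_le.2 ?_
    rintro _ ⟨P, hP, rfl⟩
    have := starCycle_add_mem_boundaries hP x y
    rw [SetLike.mem_coe, Submodule.mem_comap]
    simp only [f, LinearMap.sub_apply, LinearMap.add_apply]
    split_ifs at this ⊢ <;> exact this
  have hmem := hle hz'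
  rw [Submodule.mem_comap] at hmem
  simp only [f, LinearMap.sub_apply, LinearMap.add_apply] at hmem
  rw [starMap, starMap, homologyMap_chowClass, homologyMap_chowClass, chowClass_add]
  split_ifs at hmem ⊢ with h
  · rw [chowClass_eq_zero_iff]
    simpa only [LinearMap.zero_apply, sub_zero] using hmem
  · rw [starMap, homologyMap_chowClass, chowClass_eq_iff]
    exact hmem

open scoped Classical in
/-- The action of `k` on `SHᵐ⁺¹(k, m + 1)`, with `0 ⋆ ξ = 0`. -/
def scalarMap (a : k) : SH k (m + 1) (m + 1) →+ SH k (m + 1) (m + 1) :=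
  if h : a = 0 then 0 else starMap _ _ (Units.mk0 a h)

lemma scalarMap_zero : scalarMap (m := m) (0 : k) = 0 := dif_pos rfl

lemma scalarMap_unit (x : kˣ) : scalarMap (m := m) (x : k) = starMap _ _ x := by
  rw [scalarMap, dif_neg x.ne_zero, Units.mk0_val]

/-- The `k`-vector space structure on `SHᵐ⁺¹(k, m + 1)`. -/
@[reducible] def additiveChowModule (k : Type*) [Field k] (m : ℕ) :
    Module k (SH k (m + 1) (m + 1)) :=
  letI : SMul k (SH k (m + 1) (m + 1)) := ⟨fun a ξ => scalarMap a ξ⟩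
  Module.ofMinimalAxioms (fun a ξ η => map_add (scalarMap a) ξ η)
    (fun a b ξ => by
      change scalarMap (a + b) ξ = scalarMap a ξ + scalarMap b ξ
      rcases eq_or_ne a 0 with rfl | ha
      · simp [scalarMap_zero]
      rcases eq_or_ne b 0 with rfl | hb
      · simp [scalarMap_zero]
      have h := starMap_add (Units.mk0 a ha) (Units.mk0 b hb) ξ
      rw [← scalarMap_unit, ← scalarMap_unit, Units.val_mk0, Units.val_mk0] at h
      rw [h]
      split_ifs with h0
      · rw [h0, scalarMap_zero, AddMonoidHom.zero_apply]
      · rw [← scalarMap_unit, Units.val_mk0])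
    (fun a b ξ => by
      change scalarMap (a * b) ξ = scalarMap a (scalarMap b ξ)
      rcases eq_or_ne a 0 with rfl | ha
      · simp [scalarMap_zero]
      rcases eq_or_ne b 0 with rfl | hb
      · simp [scalarMap_zero]
      have h := starMap_mul _ _ (Units.mk0 a ha) (Units.mk0 b hb) ξ
      rwa [← scalarMap_unit, ← scalarMap_unit, ← scalarMap_unit, Units.val_mul, Units.val_mk0,
        Units.val_mk0] at h)
    (fun ξ => by
      change scalarMap 1 ξ = ξ
      exact (DFunLike.congr_fun (scalarMap_unit 1) ξ).trans (starMap_one _ _ ξ))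

end VectorSpace

/-! ### The push-forward from the Chow group to the additive Chow group -/

section PushForward

variable {k : Type*} [Field k] {m : ℕ}

/-- The push-forward `CHᵐ(k, m) → SHᵐ⁺¹(k, m + 1)`. -/
def iotaMap (k : Type*) [Field k] (m : ℕ) : CH k m m →+ SH k (m + 1) (m + 1) :=
  homologyMap (iotaCycle m) (fun _ => iotaCycle_mem_closedCycles)
    fun _ => iotaCycle_mem_boundaries

lemma iotaCycle_ratPoint (u : Fin (m + 1) → k) (hu : ∑ i, u i = 1)
    (hu' : ∑ i, Fin.cons (α := fun _ => k) (-1) u i = 0) :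
    iotaCycle m (Finsupp.single (ratPoint 1 u hu) 1) =
      Finsupp.single (ratPoint 0 (Fin.cons (α := fun _ => k) (-1) u) hu') 1 := by
  have h : (simplexLift (A := k) 1 u hu).comp (iotaHom m) =
      simplexLift (A := k) (0 : k) (Fin.cons (α := fun _ => k) (-1) u) hu' := by
    refine simplexRing_algHom_ext 0 fun i => ?_
    rw [AlgHom.comp_apply, simplexLift_coord]
    refine Fin.cases ?_ (fun i => ?_) i
    · rw [iotaHom_coord_zero]
      simp
    · rw [iotaHom_coord_succ, simplexLift_coord, Fin.cons_succ]
  rw [iotaCycle_single]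
  refine congrArg (Finsupp.single · 1) (PrimeSpectrum.ext (Ideal.ext fun r => ?_))
  change simplexLift (A := k) 1 u hu (iotaHom m r) = 0 ↔ simplexLift (A := k) 0 _ hu' r = 0
  rw [← h, AlgHom.comp_apply]

lemma iotaMap_chowSymbol (b : Fin m → kˣ) : iotaMap k m (chowSymbol b) = additiveSymbol b := by
  unfold chowSymbol additiveSymbol
  split_ifs with hc
  · unfold pointClass
    rw [iotaMap, homologyMap_chowClass]
    congr 1
    exact iotaCycle_ratPoint _ _ _
  · rw [map_zero]

end PushForward

/-! ### Generators and relations for differential forms -/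

section MultiDerivation

/-- A multilinear map vanishes at `w` if it vanishes whenever the arguments at the places in `s`
are replaced by elements of a generating set. -/
lemma multilinearMap_eq_zero_of_span {R M N ι : Type*} [CommRing R] [AddCommGroup M] [Module R M]
    [AddCommGroup N] [Module R N] [DecidableEq ι] (L : MultilinearMap R (fun _ : ι => M) N)
    {S : Set M} (hS : Submodule.span R S = ⊤) (s : Finset ι) (w : ι → M)
    (h : ∀ w' : ι → M, (∀ l ∈ s, w' l ∈ S) → (∀ l, l ∉ s → w' l = w l) → L w' = 0) : L w = 0 := by
  induction s using Finset.induction_on generalizing w with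
  | empty => exact h w (by simp) fun _ _ => rfl
  | insert a s ha ih =>
    have hlin : L.toLinearMap w a = 0 := by
      refine LinearMap.ext_on hS fun x hx => ?_
      refine ih (Function.update w a x) fun w' h1 h2 => h w' (fun l hl => ?_) fun l hl => ?_
      · rcases Finset.mem_insert.1 hl with rfl | hl
        · rw [h2 l ha, Function.update_self]
          exact hx
        · exact h1 l hl
      · rw [Finset.mem_insert, not_or] at hl
        rw [h2 l hl.2, Function.update_of_ne hl.1]
    have := DFunLike.congr_fun hlin (w a)
    rwa [MultilinearMap.toLinearMap_apply, Function.update_eq_self] at this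

universe u

lemma update_comp_swap {A ι : Type*} [DecidableEq ι] {i j : ι} (hij : i ≠ j) (w : ι → A) (x y : A) :
    Function.update (Function.update w i x) j y ∘ Equiv.swap i j =
      Function.update (Function.update w i y) j x := by
  funext l
  rw [Function.comp_apply]
  rcases eq_or_ne l i with rfl | hi
  · rw [Equiv.swap_apply_left, Function.update_self, Function.update_of_ne hij,
      Function.update_self]
  rcases eq_or_ne l j with rfl | hj
  · rw [Equiv.swap_apply_right, Function.update_of_ne hij, Function.update_self,
      Function.update_self]
  · rw [Equiv.swap_apply_of_ne_of_ne hi hj, Function.update_of_ne hj, Function.update_of_ne hi,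
      Function.update_of_ne hj, Function.update_of_ne hi]

lemma map_update_add_update_add {A V ι : Type*} [DecidableEq ι] [AddCommGroup A] [AddCommGroup V]
    {f : (ι → A) → V} (hf : ∀ b i x y, f (Function.update b i (x + y)) =
      f (Function.update b i x) + f (Function.update b i y)) {i j : ι} (hij : i ≠ j) (w : ι → A)
    (x y : A) : f (Function.update (Function.update w i (x + y)) j (x + y)) =
      f (Function.update (Function.update w i x) j x) +
        (f (Function.update (Function.update w i x) j y) +
          f (Function.update (Function.update w i y) j x)) +
        f (Function.update (Function.update w i y) j y) := by
  have hc (u v : A) : Function.update (Function.update w i u) j v =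
      Function.update (Function.update w j v) i u := Function.update_comm hij u v w
  rw [hf (Function.update w i (x + y)) j x y, hc, hc, hf _ i, hf _ i, hc, hc, hc, hc]
  abel

variable {k : Type u} [Field k]

/-- A function of `m` variables in `k` that is an absolute derivation in each variable. -/
structure IsMultiDerivation {m : ℕ} {V : Type*} [AddCommGroup V] [Module k V]
    (F : (Fin m → k) → V) : Prop where
  map_add : ∀ (b : Fin m → k) (i : Fin m) (x y : k), F (Function.update b i (x + y)) =
    F (Function.update b i x) + F (Function.update b i y)
  map_mul : ∀ (b : Fin m → k) (i : Fin m) (x y : k), F (Function.update b i (x * y)) =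
    x • F (Function.update b i y) + y • F (Function.update b i x)

lemma IsMultiDerivation.map_one {m : ℕ} {V : Type*} [AddCommGroup V] [Module k V]
    {F : (Fin m → k) → V} (hF : IsMultiDerivation F) (b : Fin m → k) (i : Fin m) :
    F (Function.update b i 1) = 0 := by
  have h := hF.map_mul b i 1 1
  rw [mul_one, one_smul] at h
  exact left_eq_add.1 h

/-- A function that is a derivation in the last variable, as a derivation. -/
def IsMultiDerivation.last {m : ℕ} {V : Type*} [AddCommGroup V] [Module k V]
    {F : (Fin (m + 1) → k) → V} (hF : IsMultiDerivation F) (b : Fin m → k) : Derivation ℤ k V :=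
  Derivation.mk' (AddMonoidHom.mk' (fun x => F (Fin.snoc (α := fun _ => k) b x)) fun x y => by
      have h := hF.map_add (Fin.snoc (α := fun _ => k) b 0) (Fin.last m) x y
      simpa only [Fin.update_snoc_last] using h).toIntLinearMap fun x y => by
    have h := hF.map_mul (Fin.snoc (α := fun _ => k) b 0) (Fin.last m) x y
    simp only [Fin.update_snoc_last] at h
    exact h

/-- Functions that are derivations in each variable are given by multilinear maps on Kähler
differentials. The last variable is linearized first; as a function of the other variables with
values in linear maps, the result is again a derivation in each variable. -/
lemma IsMultiDerivation.exists_multilinearMap {m : ℕ} {V : Type u} [AddCommGroup V] [Module k V]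
    {F : (Fin m → k) → V} (hF : IsMultiDerivation F) :
    ∃ L : MultilinearMap k (fun _ : Fin m => Ω[k⁄ℤ]) V,
      ∀ b, L (fun i => KaehlerDifferential.D ℤ k (b i)) = F b := by
  induction m generalizing V with
  | zero =>
    exact ⟨MultilinearMap.constOfIsEmpty k _ (F 0), fun b => by
      rw [Subsingleton.elim b 0]
      rfl⟩
  | succ m ih =>
    let G : (Fin m → k) → (Ω[k⁄ℤ] →ₗ[k] V) := fun b => (hF.last b).liftKaehlerDifferential
    have hGD (b x) : G b (KaehlerDifferential.D ℤ k x) = F (Fin.snoc (α := fun _ => k) b x) :=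
      Derivation.liftKaehlerDifferential_comp_D _ x
    have hG : IsMultiDerivation G := by
      constructor
      · intro b i x y
        refine LinearMap.ext_on (KaehlerDifferential.span_range_derivation ℤ k) ?_
        rintro _ ⟨z, rfl⟩
        rw [LinearMap.add_apply, hGD, hGD, hGD, Fin.snoc_update, Fin.snoc_update, Fin.snoc_update,
          hF.map_add]
      · intro b i x y
        refine LinearMap.ext_on (KaehlerDifferential.span_range_derivation ℤ k) ?_
        rintro _ ⟨z, rfl⟩
        rw [LinearMap.add_apply, LinearMap.smul_apply, LinearMap.smul_apply, hGD, hGD, hGD,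
          Fin.snoc_update, Fin.snoc_update, Fin.snoc_update, hF.map_mul]
    obtain ⟨L, hL⟩ := ih hG
    refine ⟨MultilinearMap.uncurryRight L, fun b => ?_⟩
    rw [MultilinearMap.uncurryRight_apply]
    have h1 := hL (Fin.init (α := fun _ => k) b)
    have h2 := hGD (Fin.init (α := fun _ => k) b) (b (Fin.last m))
    rw [Fin.snoc_init_self, ← h1] at h2
    exact h2

lemma IsMultiDerivation.map_add_map_swap {m : ℕ} {V : Type*} [AddCommGroup V] [Module k V]
    {F : (Fin m → k) → V} (hF : IsMultiDerivation F)
    (halt : ∀ b i j, b i = b j → i ≠ j → F b = 0) {i j : Fin m} (hij : i ≠ j) (b : Fin m → k) :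
    F b + F (b ∘ Equiv.swap i j) = 0 := by
  have hd (x : k) : F (Function.update (Function.update b i x) j x) = 0 :=
    halt _ i j (by rw [Function.update_self, Function.update_of_ne hij, Function.update_self]) hij
  have h := map_update_add_update_add hF.map_add hij b (b i) (b j)
  rw [hd, hd, hd, zero_add, add_zero, Function.update_eq_self, Function.update_eq_self] at h
  have h2 := update_comp_swap hij b (b i) (b j)
  rw [Function.update_eq_self, Function.update_eq_self] at h2
  rw [h2, ← h]

/-- If such a function vanishes whenever two variables agree, it is given by a linear map on
differential forms. -/
lemma IsMultiDerivation.exists_linearMap {m : ℕ} {V : Type u} [AddCommGroup V] [Module k V]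
    {F : (Fin m → k) → V} (hF : IsMultiDerivation F)
    (halt : ∀ b i j, b i = b j → i ≠ j → F b = 0) :
    ∃ φ : (⋀[k]^m Ω[k⁄ℤ]) →ₗ[k] V,
      ∀ b, φ (exteriorPower.ιMulti k m fun i => KaehlerDifferential.D ℤ k (b i)) = F b := by
  obtain ⟨L, hL⟩ := hF.exists_multilinearMap
  have hspan := KaehlerDifferential.span_range_derivation ℤ k
  have hskew (i j : Fin m) (hij : i ≠ j) (w : Fin m → Ω[k⁄ℤ]) :
      L w + L (w ∘ Equiv.swap i j) = 0 := by
    refine multilinearMap_eq_zero_of_span (L + L.domDomCongr (Equiv.swap i j)) hspan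
      Finset.univ w fun w' h1 _ => ?_
    choose c hc using fun l => h1 l (Finset.mem_univ l)
    rw [← funext hc, add_apply, MultilinearMap.domDomCongr_apply, hL]
    exact (congrArg (F c + ·) (hL (c ∘ Equiv.swap i j))).trans (hF.map_add_map_swap halt hij c)
  have hdiag (i j : Fin m) (hij : i ≠ j) (w : Fin m → Ω[k⁄ℤ]) (x : Ω[k⁄ℤ]) :
      L (Function.update (Function.update w i x) j x) = 0 := by
    have hx : x ∈ Submodule.span k (Set.range (KaehlerDifferential.D ℤ k)) := hspan ▸ trivial
    induction hx using Submodule.span_induction with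
    | mem x hx =>
      obtain ⟨a, rfl⟩ := hx
      refine multilinearMap_eq_zero_of_span L hspan (Finset.univ \ {i, j}) _ fun w' h1 h2 => ?_
      have hi : w' i = KaehlerDifferential.D ℤ k a := by
        rw [h2 i (by simp), Function.update_of_ne hij, Function.update_self]
      have hj : w' j = KaehlerDifferential.D ℤ k a := by
        rw [h2 j (by simp), Function.update_self]
      have h3 (l : Fin m) : ∃ c, KaehlerDifferential.D ℤ k c = w' l ∧ (l = i ∨ l = j → c = a) := by
        by_cases hl : l = i ∨ l = j
        · refine ⟨a, ?_, fun _ => rfl⟩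
          rcases hl with rfl | rfl
          exacts [hi.symm, hj.symm]
        · obtain ⟨c, hc⟩ := h1 l (by simpa using hl)
          exact ⟨c, hc, fun h => absurd h hl⟩
      choose c hc hca using h3
      rw [← funext hc, hL]
      exact halt c i j ((hca i (Or.inl rfl)).trans (hca j (Or.inr rfl)).symm) hij
    | zero => exact L.map_coord_zero j (Function.update_self _ _ _)
    | add x y _ _ hx hy =>
      -- in characteristic two skew-symmetry is not enough, but the diagonal terms are zero
      have h := hskew i j hij (Function.update (Function.update w i x) j y)
      rw [update_comp_swap hij] at h
      rw [map_update_add_update_add L.map_update_add hij, hx, hy, h, zero_add, zero_add]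
    | smul c x _ hx =>
      rw [L.map_update_smul, Function.update_comm hij, L.map_update_smul,
        Function.update_comm hij.symm, hx, smul_zero, smul_zero]
  let f : Ω[k⁄ℤ] [⋀^Fin m]→ₗ[k] V := ⟨L, fun v i j hv hij => by
    have := hdiag i j hij v (v j)
    rwa [← hv, Function.update_eq_self, hv, Function.update_eq_self] at this⟩
  refine ⟨exteriorPower.alternatingMapLinearEquiv f, fun b => ?_⟩
  rw [exteriorPower.alternatingMapLinearEquiv_apply_ιMulti]
  exact hL b

end MultiDerivation

/-! ### Maps defined on symbols -/

section SymbolPresentation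

universe u

variable {k : Type u} [Field k] {m : ℕ}

open scoped Classical in
/-- A map on tuples of units that is multiplicative in each entry, satisfies the Steinberg relation,
and for which `x • s(…, x, …)` is additive in `x`, is of the form `b ↦ φ (dlog b₁ ∧ ⋯ ∧ dlog b_m)`:
then `(∏ bᵢ) • s(b)` is a derivation in each variable. -/
theorem exists_linearMap_dlogForm {V : Type u} [AddCommGroup V] [Module k V]
    (s : (Fin m → kˣ) → V)
    (hmul : ∀ b i x y, s (Function.update b i (x * y)) =
      s (Function.update b i x) + s (Function.update b i y))
    (hst : ∀ b i j, i ≠ j → (b i : k) + b j = 1 → s b = 0)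
    (hadd : ∀ b i (x y : kˣ), (x : k) • s (Function.update b i x) +
      (y : k) • s (Function.update b i y) = if h : (x : k) + y = 0 then 0 else
        ((x : k) + y) • s (Function.update b i (Units.mk0 _ h))) :
    ∃ φ : (⋀[k]^m Ω[k⁄ℤ]) →ₗ[k] V, ∀ b, φ (dlogForm b) = s b := by
  let τ : k → kˣ := fun x => if h : x = 0 then 1 else Units.mk0 x h
  have hτ (x : k) (hx : x ≠ 0) : (τ x : k) = x := by simp [τ, hx]
  have hτu (x : kˣ) : τ x = x := Units.ext (hτ x x.ne_zero)
  let F : (Fin m → k) → V := fun b => (∏ l, b l) • s (τ ∘ b)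
  have hF0 (b : Fin m → k) (i : Fin m) (hi : b i = 0) : F b = 0 := by
    simp only [F]
    rw [Finset.prod_eq_zero (Finset.mem_univ i) hi, zero_smul]
  have hFu (b : Fin m → k) (i : Fin m) (x : k) : F (Function.update b i x) =
      (∏ l ∈ Finset.univ \ {i}, b l) • x • s (Function.update (τ ∘ b) i (τ x)) := by
    simp only [F]
    rw [Finset.prod_update_of_mem (Finset.mem_univ i), mul_comm, mul_smul, Function.comp_update]
  have hF : IsMultiDerivation F := by
    constructor
    · intro b i x y
      rw [hFu, hFu, hFu, ← smul_add]
      congr 1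
      rcases eq_or_ne x 0 with rfl | hx
      · rw [zero_smul, zero_add, zero_add]
      rcases eq_or_ne y 0 with rfl | hy
      · rw [zero_smul, add_zero, add_zero]
      have h := hadd (τ ∘ b) i (τ x) (τ y)
      rw [hτ x hx, hτ y hy] at h
      rw [h]
      split_ifs with h0
      · rw [h0, zero_smul]
      · congr 3
        exact Units.ext (hτ _ h0)
    · intro b i x y
      rw [hFu, hFu, hFu, smul_comm x, smul_comm y, ← smul_add]
      congr 1
      rcases eq_or_ne x 0 with rfl | hx
      · simp
      rcases eq_or_ne y 0 with rfl | hy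
      · simp
      have h1 : τ (x * y) = τ x * τ y := Units.ext (by
        rw [Units.val_mul, hτ _ (mul_ne_zero hx hy), hτ x hx, hτ y hy])
      rw [h1, hmul, smul_add, mul_smul, smul_comm y x, mul_smul, add_comm]
  have halt (b : Fin m → k) (i j : Fin m) (hb : b i = b j) (hij : i ≠ j) : F b = 0 := by
    rcases eq_or_ne (b i) 0 with h0 | h0
    · exact hF0 b i h0
    rcases eq_or_ne (b j) 1 with h1 | h1
    · have := hF.map_one b j
      rwa [← h1, Function.update_eq_self] at this
    -- the tuple with `1 - bⱼ` in the place of `bⱼ` is a Steinberg symbol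
    have hne : 1 - b j ≠ 0 := sub_ne_zero.2 h1.symm
    have hst' : F (Function.update b j (1 - b j)) = 0 := by
      simp only [F]
      rw [hst _ i j hij, smul_zero]
      rw [Function.comp_apply, Function.comp_apply, Function.update_self,
        Function.update_of_ne hij, hτ _ h0, hτ _ hne, hb, add_sub_cancel]
    have h2 := hF.map_add b j (b j) (1 - b j)
    rw [add_sub_cancel, hF.map_one, Function.update_eq_self, hst', add_zero] at h2
    exact h2.symm
  obtain ⟨φ, hφ⟩ := hF.exists_linearMap halt
  refine ⟨φ, fun b => ?_⟩
  have h1 : dlogForm b = (∏ l, (b l : k)⁻¹) •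
      exteriorPower.ιMulti k m fun l => KaehlerDifferential.D ℤ k (b l : k) :=
    (exteriorPower.ιMulti k m (M := Ω[k⁄ℤ])).toMultilinearMap.map_smul_univ
      (fun l => (b l : k)⁻¹) fun l => KaehlerDifferential.D ℤ k (b l : k)
  have h2 : τ ∘ (fun l => (b l : k)) = b := funext fun l => hτu (b l)
  rw [h1, map_smul, hφ]
  simp only [F]
  rw [h2, smul_smul, ← Finset.prod_mul_distrib, Finset.prod_congr rfl fun l _ =>
    inv_mul_cancel₀ (b l).ne_zero, Finset.prod_const_one, one_smul]

/-- A map on tuples of units that is multiplicative in each entry and satisfies the Steinberg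
relation factors through Milnor K-theory. -/
theorem exists_addMonoidHom_milnorSymbol {V : Type*} [AddCommGroup V] (s : (Fin m → kˣ) → V)
    (hmul : ∀ b i x y, s (Function.update b i (x * y)) =
      s (Function.update b i x) + s (Function.update b i y))
    (hst : ∀ b i j, i ≠ j → (b i : k) + b j = 1 → s b = 0) :
    ∃ T : MilnorK k m →+ V, ∀ b, T (milnorSymbol b) = s b := by
  have hadd (b : Fin m → Additive kˣ) (i : Fin m) (x y : Additive kˣ) :
      s (Additive.toMul ∘ Function.update b i (x + y)) =
        s (Additive.toMul ∘ Function.update b i x) +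
          s (Additive.toMul ∘ Function.update b i y) := by
    rw [Function.comp_update, Function.comp_update, Function.comp_update, toMul_add, hmul]
  let f : MultilinearMap ℤ (fun _ : Fin m => Additive kˣ) V :=
    MultilinearMap.mk' (fun b => s (Additive.toMul ∘ b)) hadd fun b i c x =>
      map_zsmul (AddMonoidHom.mk' (fun x => s (Additive.toMul ∘ Function.update b i x))
        (hadd b i)) c x
  refine ⟨((steinbergRelations k m).liftQ (PiTensorProduct.lift f) ?_).toAddMonoidHom,
    fun b => ?_⟩
  · rw [steinbergRelations, Submodule.span_le]
    rintro z ⟨b, ⟨i, j, hij, h⟩, rfl⟩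
    change PiTensorProduct.lift f _ = 0
    rw [PiTensorProduct.lift.tprod]
    exact hst b i j (fun h => by subst h; omega) h
  · change PiTensorProduct.lift f (PiTensorProduct.tprod ℤ fun i => Additive.ofMul (b i)) = _
    rw [PiTensorProduct.lift.tprod]
    rfl

lemma milnorK_addMonoidHom_ext {V : Type*} [AddCommGroup V] {f g : MilnorK k m →+ V}
    (h : ∀ b, f (milnorSymbol b) = g (milnorSymbol b)) : f = g := by
  refine AddMonoidHom.ext fun z => ?_
  obtain ⟨z, rfl⟩ := Submodule.Quotient.mk_surjective _ z
  induction z using PiTensorProduct.induction_on with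
  | smul_tprod r b =>
    rw [Submodule.Quotient.mk_smul, map_zsmul, map_zsmul]
    exact congrArg (r • ·) (h fun i => (b i).toMul)
  | add x y hx hy => rw [Submodule.Quotient.mk_add, map_add, map_add, hx, hy]

end SymbolPresentation

/-! ### The relations between the symbols -/

section Symbols

variable {k : Type*} [Field k] {m : ℕ}

/-- The homogeneous coordinates `(b₁ : ⋯ : b_m : -1)` of `symbolPoint b`. -/
def symbolCoord (b : Fin m → kˣ) : Fin (m + 1) → k :=
  Fin.snoc (α := fun _ => k) (fun i => (b i : k)) (-1)

@[simp] lemma symbolCoord_castSucc (b : Fin m → kˣ) (i : Fin m) :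
    symbolCoord b i.castSucc = b i := by simp [symbolCoord]

@[simp] lemma symbolCoord_last (b : Fin m → kˣ) : symbolCoord b (Fin.last m) = -1 := by
  simp [symbolCoord]

lemma symbolCoord_ne_zero (b : Fin m → kˣ) (j : Fin (m + 1)) : symbolCoord b j ≠ 0 := by
  refine Fin.lastCases (by simp) (fun i => by simp) j

lemma sum_symbolCoord (b : Fin m → kˣ) : ∑ j, symbolCoord b j = symbolSum b := by
  rw [Fin.sum_univ_castSucc, symbolSum, add_comm]
  simp

lemma symbolPoint_apply (b : Fin m → kˣ) (j : Fin (m + 1)) :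
    symbolPoint b j = symbolCoord b j / symbolSum b := by
  refine Fin.lastCases (by simp [symbolPoint]) (fun i => by simp [symbolPoint]) j

lemma symbolCoord_update (b : Fin m → kˣ) (i : Fin m) (x : kˣ) :
    symbolCoord (Function.update b i x) = Function.update (symbolCoord b) i.castSucc (x : k) := by
  have h : (fun l => (Function.update b i x l : k)) =
      Function.update (fun l => (b l : k)) i (x : k) := Function.comp_update Units.val b i x
  rw [symbolCoord, symbolCoord, h, Fin.snoc_update]

lemma symbolPoint_update (b : Fin m → kˣ) (i : Fin m) (x : kˣ) :
    symbolPoint (Function.update b i x) = homPoint i.castSucc (symbolCoord b) (x : k) := by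
  funext j
  rw [symbolPoint_apply, homPoint, ← sum_symbolCoord, symbolCoord_update]

lemma pointCycle_symbolPoint_mem (b : Fin m → kˣ) :
    pointCycle 1 (symbolPoint b) ∈ closedCycles 1 m m := by
  unfold pointCycle
  split_ifs with h
  · refine single_ratPoint_mem 1 _ h fun j => symbolPoint_ne_zero b (fun hc => ?_) j
    simp [symbolPoint_apply, hc] at h
  · exact Submodule.zero_mem _

lemma chowSymbol_eq (b : Fin m → kˣ) :
    chowSymbol b = chowClass 1 (pointCycle 1 (symbolPoint b)) (pointCycle_symbolPoint_mem b) := by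
  unfold chowSymbol
  split_ifs with hc
  · unfold pointClass
    congr 1
    rw [pointCycle_of_eq 1 _ (sum_symbolPoint b hc)]
  · refine ((chowClass_eq_zero_iff _).2 ?_).symm
    rw [pointCycle, dif_neg]
    · exact Submodule.zero_mem _
    · rw [not_not] at hc
      simp [symbolPoint_apply, hc]

/-- A symbol is zero if some of its homogeneous coordinates add up to zero. -/
lemma chowSymbol_eq_zero (b : Fin m → kˣ) (D : Finset (Fin (m + 1))) (hD : D.Nonempty)
    (h : ∑ j ∈ D, symbolCoord b j = 0) : chowSymbol b = 0 := by
  by_cases hc : symbolSum b = 0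
  · exact dif_neg (not_not.2 hc)
  obtain ⟨i, hi⟩ : ∃ i, i ∉ D := by
    by_contra! hall
    rw [Finset.eq_univ_iff_forall.2 hall, sum_symbolCoord] at h
    exact hc h
  rw [chowSymbol_eq, chowClass_eq_zero_iff]
  refine pointCycle_mem_boundaries _ (sum_symbolPoint b hc) (symbolPoint_ne_zero b hc) D hD i hi ?_
  simp only [symbolPoint_apply]
  rw [← Finset.sum_div, h, zero_div]

lemma chowSymbol_update_one (b : Fin m → kˣ) (i : Fin m) :
    chowSymbol (Function.update b i 1) = 0 := by
  refine chowSymbol_eq_zero _ {i.castSucc, Fin.last m} (by simp) ?_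
  rw [Finset.sum_pair (Fin.castSucc_ne_last i)]
  simp

lemma chowSymbol_steinberg (b : Fin m → kˣ) (i j : Fin m) (hij : i ≠ j)
    (h : (b i : k) + b j = 1) : chowSymbol b = 0 := by
  refine chowSymbol_eq_zero _ {i.castSucc, j.castSucc, Fin.last m} (by simp) ?_
  rw [Finset.sum_insert, Finset.sum_pair (Fin.castSucc_ne_last j)]
  · rw [symbolCoord_castSucc, symbolCoord_castSucc, symbolCoord_last, ← add_assoc, h,
      add_neg_cancel]
  · simp [hij, Fin.castSucc_ne_last]

lemma chowSymbol_update_mul (b : Fin m → kˣ) (i : Fin m) (x y : kˣ) :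
    chowSymbol (Function.update b i (x * y)) =
      chowSymbol (Function.update b i x) + chowSymbol (Function.update b i y) := by
  rcases eq_or_ne x 1 with rfl | hx
  · rw [chowSymbol_update_one, one_mul, zero_add]
  rcases eq_or_ne y 1 with rfl | hy
  · rw [chowSymbol_update_one, mul_one, add_zero]
  have hne {x : kˣ} (hx : x ≠ 1) : (x : k) ≠ 1 := fun h => hx (Units.ext h)
  have h := homPoint_mul_mem_boundaries i.castSucc (symbolCoord b)
    (fun j _ => symbolCoord_ne_zero b j) ⟨Fin.last m, (Fin.castSucc_ne_last i).symm⟩ x y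
    x.ne_zero y.ne_zero (hne hx) (hne hy)
  have h1 : homPoint i.castSucc (symbolCoord b) 1 = symbolPoint (Function.update b i 1) := by
    rw [symbolPoint_update, Units.val_one]
  rw [← Units.val_mul, ← symbolPoint_update, ← symbolPoint_update, ← symbolPoint_update, h1] at h
  have h2 := (chowClass_eq_iff (Submodule.add_mem _ (pointCycle_symbolPoint_mem _)
    (pointCycle_symbolPoint_mem _)) (Submodule.add_mem _ (pointCycle_symbolPoint_mem _)
    (pointCycle_symbolPoint_mem _))).2 h
  rw [← chowClass_add (pointCycle_symbolPoint_mem _) (pointCycle_symbolPoint_mem _),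
    ← chowClass_add (pointCycle_symbolPoint_mem _) (pointCycle_symbolPoint_mem _), ← chowSymbol_eq, ← chowSymbol_eq, ← chowSymbol_eq,
    ← chowSymbol_eq, chowSymbol_update_one, zero_add] at h2
  exact h2.symm

lemma starCycle_ratPoint (x : kˣ) (u u' : Fin (m + 1) → k) (hu : ∑ j, u j = 0)
    (hu' : ∑ j, u' j = 0) (h : ∀ j, u' j = (x : k)⁻¹ * u j) :
    starCycle x (Finsupp.single (ratPoint 0 u hu) 1) = Finsupp.single (ratPoint 0 u' hu') 1 := by
  have h : (simplexLift (A := k) 0 u hu).comp (starHom m x) = simplexLift (A := k) 0 u' hu' := by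
    refine simplexRing_algHom_ext 0 fun j => ?_
    rw [AlgHom.comp_apply, starHom_coord, map_smul, simplexLift_coord, simplexLift_coord, h,
      smul_eq_mul]
  rw [starCycle_single]
  refine congrArg (Finsupp.single · 1) (PrimeSpectrum.ext (Ideal.ext fun r => ?_))
  change simplexLift (A := k) 0 u hu (starHom m x r) = 0 ↔ simplexLift (A := k) 0 u' hu' r = 0
  rw [← h, AlgHom.comp_apply]

lemma starMap_additiveSymbol (b : Fin m → kˣ) (i : Fin m) (x : kˣ) :
    ∃ hz : pointCycle 0 (addPoint i.castSucc (symbolCoord b) (x : k)) ∈ closedCycles 0 _ _,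
      starMap _ _ x (additiveSymbol (Function.update b i x)) = chowClass 0 _ hz := by
  have hs : ∑ j, Function.update (symbolCoord b) i.castSucc (x : k) j =
      symbolSum (Function.update b i x) := by rw [← symbolCoord_update, sum_symbolCoord]
  unfold additiveSymbol
  split_ifs with hc
  · have hsum := sum_addPoint i.castSucc (symbolCoord b) (x : k) (by rwa [hs])
    have h := starCycle_ratPoint x (Fin.cons (α := fun _ => k) (-1) (symbolPoint (Function.update b i x))) _ (by
      simp [Fin.sum_univ_succ, sum_symbolPoint _ hc]) hsum
      (fun j => by rw [addPoint, ← symbolPoint_update])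
    rw [pointCycle_of_eq 0 _ hsum, ← h]
    exact ⟨starCycle_mem_closedCycles x (single_ratPoint_mem 0 _ _ fun j => Fin.cases (by simp)
      (fun j => by simpa using symbolPoint_ne_zero _ hc j) j), rfl⟩
  · rw [not_not] at hc
    rw [pointCycle_addPoint_of_sum_eq_zero i.castSucc _ _ x.ne_zero (by rwa [hs])]
    exact ⟨Submodule.zero_mem _, map_zero _⟩

open scoped Classical in
lemma starMap_additiveSymbol_add (b : Fin m → kˣ) (i : Fin m) (x y : kˣ) :
    starMap _ _ x (additiveSymbol (Function.update b i x)) +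
      starMap _ _ y (additiveSymbol (Function.update b i y)) =
        if h : (x : k) + y = 0 then 0 else
          starMap _ _ (Units.mk0 _ h) (additiveSymbol (Function.update b i (Units.mk0 _ h))) := by
  have h := addPoint_add_mem_boundaries i.castSucc (symbolCoord b)
    (fun j _ => symbolCoord_ne_zero b j) ⟨Fin.last m, (Fin.castSucc_ne_last i).symm⟩ (x : k) y
    x.ne_zero y.ne_zero
  obtain ⟨hzx, hx⟩ := starMap_additiveSymbol b i x
  obtain ⟨hzy, hy⟩ := starMap_additiveSymbol b i y
  rw [hx, hy, chowClass_add]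
  split_ifs at h ⊢ with h0
  · rw [sub_zero] at h
    exact (chowClass_eq_zero_iff _).2 h
  · obtain ⟨hz, hxy⟩ := starMap_additiveSymbol b i (Units.mk0 _ h0)
    rw [hxy]
    exact (chowClass_eq_iff _ _).2 h

end Symbols

end AdditiveChow

end

theorem proposition4p2 (k : Type*) [Field k] (m : ℕ) :
    ∃ _ : Module k (SH k (m + 1) (m + 1)),
      (∀ (a : kˣ) (z : AllCycles k 0 (m + 1)) (hz : z ∈ closedCycles 0 (m + 1) (m + 1)),
        ∃ haz : starCycle a z ∈ closedCycles 0 (m + 1) (m + 1),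
          (a : k) • chowClass 0 z hz = chowClass 0 (starCycle a z) haz) ∧
      ∃ φ : (⋀[k]^m Ω[k⁄ℤ]) →ₗ[k] SH k (m + 1) (m + 1),
        (∀ (a : k) (b : Fin m → kˣ), φ (a • dlogForm b) = a • additiveSymbol b) ∧
        ∃ T : MilnorK k m →+ CH k m m,
          (∀ b : Fin m → kˣ, T (milnorSymbol b) = chowSymbol b) ∧
          ∃ ι : CH k m m →+ SH k (m + 1) (m + 1),
            (∀ (z : AllCycles k 1 m) (hz : z ∈ closedCycles 1 m m),
              ∃ hιz : iotaCycle m z ∈ closedCycles 0 (m + 1) (m + 1),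
                ι (chowClass 1 z hz) = chowClass 0 (iotaCycle m z) hιz) ∧
            ∀ κ : MilnorK k m, φ (dlogMilnor m κ) = ι (T κ) := by
  let _ : Module k (SH k (m + 1) (m + 1)) := additiveChowModule k m
  have hsmul (x : kˣ) (ξ : SH k (m + 1) (m + 1)) : (x : k) • ξ = starMap _ _ x ξ :=
    DFunLike.congr_fun (scalarMap_unit x) ξ
  obtain ⟨T, hT⟩ := exists_addMonoidHom_milnorSymbol (chowSymbol (k := k) (m := m))
    chowSymbol_update_mul chowSymbol_steinberg
  obtain ⟨φ, hφ⟩ := exists_linearMap_dlogForm (additiveSymbol (k := k) (m := m))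
    (fun b i x y => by simp only [← iotaMap_chowSymbol, chowSymbol_update_mul, map_add])
    (fun b i j hij h => by rw [← iotaMap_chowSymbol, chowSymbol_steinberg b i j hij h, map_zero])
    (fun b i x y => by
      rw [hsmul, hsmul, starMap_additiveSymbol_add]
      split_ifs with h
      · rfl
      · exact (hsmul (Units.mk0 _ h) _).symm)
  refine ⟨additiveChowModule k m, fun a z hz => ⟨starCycle_mem_closedCycles a hz, hsmul a _⟩, φ,
    fun a b => by rw [map_smul, hφ], T, hT, iotaMap k m,
    fun z hz => ⟨iotaCycle_mem_closedCycles hz, rfl⟩, fun κ => ?_⟩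
  have h : (φ.toAddMonoidHom.comp (dlogMilnor m).toAddMonoidHom) = (iotaMap k m).comp T :=
    milnorK_addMonoidHom_ext fun b => by
      change φ (dlogMilnor m (milnorSymbol b)) = iotaMap k m (T (milnorSymbol b))
      rw [dlogMilnor_symbol, hφ, hT, iotaMap_chowSymbol]
  exact DFunLike.congr_fun h κ
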